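/- **Proposition 3.1.** Let $M>0$. There is a constant $C$, depending only on $M$, such that the following holds. Let $b:(0,\infty)\to\mathbb R$ be measurable with $$\|b\|_{L^\infty(0,\infty)}+\Big|\int_{t_1}^{t_2}b(\tau)\,d\tau\Big|\le M\qquad\text{for all } t_2>t_1>0,$$ let $N>0$, $T>0$, let $u_0\in H^2(\mathbb R^3;\mathbb R^3)$ be divergence free, and let $u\in L^\infty(0,T;H^2(\mathbb R^3;\mathbb{R}^3))\cap L^2(0,T;H^3(\mathbb R^3;\mathbb{R}^3))$ be a weak solution on $(0,T)\times\mathbb R^3$ of the Navier–Stokes system with time oscillation $$\partial_t u-\Delta u+b(Nt)\,u\cdot\nabla u+\nabla p=0,\qquad \nabla\cdot u=0,\qquad u|_{t=0}=u_0,$$ that is, $\nabla\cdot u(t)=0$ in the sense of distributions for almost every $t\in(0,T)$ and, for every divergence-free $\varphi\in C_c^\infty(\mathbb R^3;\mathbb R^3)$ and almost every $t\in(0,T)$, $$\int_{\mathbb R^3}u(t)\cdot\varphi\,dx=\int_{\mathbb R^3}u_0\cdot\varphi\,dx+\int_0^t\Big(\int_{\mathbb R^3}u(\tau)\cdot\Delta\varphi\,dx+b(N\tau)\int_{\mathbb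 R^3}\big((u(\tau)\cdot\nabla)\varphi\big)\cdot u(\tau)\,dx\Big)d\tau .$$ Put $$X_T=\|u\|_{L^\infty(0,T;\dot H^2(\mathbb R^3))}^2+\|u\|_{L^2(0,T;\dot H^3(\mathbb R^3))}^2 .$$ Then $$X_T\le C\left(\|u_0\|_{\dot H^2}^2+\frac1{\sqrt[3]{N}}\Big(\|u_0\|_{L^2}^{3/4}X_T^{9/8}+\|u_0\|_{L^2}^{3/2}X_T^{5/4}+\|u_0\|_{H^2}^3\Big)^{1/3}\|u_0\|_{L^2}^{1/6}X_T^{11/12}\right).$$ -/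

import Mathlib

open MeasureTheory Set
open scoped ENNReal NNReal ContDiff FourierTransform Laplacian

noncomputable section

namespace OscNS

/-- Three-dimensional Euclidean space. -/
abbrev R3 : Type := EuclideanSpace ℝ (Fin 3)

/-- Real square-integrable vector fields on `ℝ³`. -/
abbrev Field3 : Type := Lp R3 2 (volume : Measure R3)

/-- The `i`-th component of an `L²` vector field, regarded as a complex-valued `L²` function. -/
def component (f : Field3) (i : Fin 3) : Lp ℂ 2 (volume : Measure R3) :=
  (Complex.ofRealCLM.comp (EuclideanSpace.proj i : R3 →L[ℝ] ℝ)).compLp f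

/-- The homogeneous norm `‖f‖_{Ḣᵏ} = (∫ |2πξ|^{2k} |f̂(ξ)|² dξ)^{1/2}`, where
`f̂(ξ) = ∫ f(x) e^{-2πi x·ξ} dx`; it equals `∞` if `f ∉ Ḣᵏ`. -/
def homNorm (k : ℕ) (f : Field3) : ℝ≥0∞ :=
  (∑ i, ∫⁻ ξ : R3, ENNReal.ofReal ((2 * Real.pi * ‖ξ‖) ^ (2 * k)) *
    ‖𝓕 (component f i) ξ‖ₑ ^ 2) ^ (1 / 2 : ℝ)

/-- The norm `‖f‖_{Hᵏ} = (∫ (1 + |2πξ|²)^k |f̂(ξ)|² dξ)^{1/2}`; it equals `∞` if `f ∉ Hᵏ`. -/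
def sobNorm (k : ℕ) (f : Field3) : ℝ≥0∞ :=
  (∑ i, ∫⁻ ξ : R3, ENNReal.ofReal ((1 + (2 * Real.pi * ‖ξ‖) ^ 2) ^ k) *
    ‖𝓕 (component f i) ξ‖ₑ ^ 2) ^ (1 / 2 : ℝ)

/-- `∇ · f = 0` in the sense of distributions. -/
def IsDivFree (f : Field3) : Prop :=
  ∀ ψ : R3 → ℝ, ContDiff ℝ ∞ ψ → HasCompactSupport ψ → ∫ x, fderiv ℝ ψ x (f x) = 0

/-- The pointwise divergence `∑ᵢ ∂ᵢ φⁱ` of a differentiable vector field. -/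
def divergence (φ : R3 → R3) (x : R3) : ℝ :=
  ∑ i, fderiv ℝ φ x (EuclideanSpace.single i 1) i

/-- The condition `‖b‖_{L^∞} + |∫_{t₁}^{t₂} b| ≤ M` for all `t₂ > t₁ > 0`, for a measurable
function `b` on the half-line (the values of `b` on `(-∞, 0]` play no role). -/
structure IsOscillating (M : ℝ) (b : ℝ → ℝ) : Prop where
  aestronglyMeasurable : AEStronglyMeasurable b (volume.restrict (Ioi 0))
  bound : ∀ t₁ t₂ : ℝ, 0 < t₁ → t₁ < t₂ →
    eLpNorm b ⊤ (volume.restrict (Ioi 0)) + ‖∫ τ in t₁..t₂, b τ‖ₑ ≤ ENNReal.ofReal M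

/-- `u` is a solution on `(0, T) × ℝ³`, of class `L^∞(0,T; H²) ∩ L²(0,T; H³)`, of
`∂ₜu - Δu + b(Nt) u·∇u + ∇p = 0`, `∇·u = 0`, `u(0) = u₀`, with divergence-free datum `u₀ ∈ H²`.

The equation is understood weakly. The test fields `φ` are smooth, compactly supported and
divergence-free, so that the gradient `∇p` of an arbitrary pressure tests to zero, and
`-∫ (u·∇u)·φ = ∫ ((u·∇)φ)·u` because `∇·u = 0`. The initial condition is contained in the
equation, which is integrated in time from `0` to `t`. -/
structure IsSolution (b : ℝ → ℝ) (N : ℝ) (u₀ : Field3) (T : ℝ) (u : ℝ → Field3) : Prop where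
  initial_mem : sobNorm 2 u₀ < ⊤
  initial_divFree : IsDivFree u₀
  aestronglyMeasurable : AEStronglyMeasurable u (volume.restrict (Ioo 0 T))
  mem_Linfty_H2 : essSup (fun t => sobNorm 2 (u t)) (volume.restrict (Ioo 0 T)) < ⊤
  mem_L2_H3 : ∫⁻ t in Ioo 0 T, sobNorm 3 (u t) ^ 2 < ⊤
  divFree : ∀ᵐ t ∂(volume.restrict (Ioo 0 T)), IsDivFree (u t)
  equation : ∀ φ : R3 → R3, ContDiff ℝ ∞ φ → HasCompactSupport φ →
    (∀ x, divergence φ x = 0) →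
    ∀ᵐ t ∂(volume.restrict (Ioo 0 T)),
      (∫ x, inner ℝ (u t x) (φ x)) = (∫ x, inner ℝ (u₀ x) (φ x)) +
        ∫ τ in (0 : ℝ)..t, ((∫ x, inner ℝ (u τ x) ((Δ φ) x)) +
          b (N * τ) * ∫ x, inner ℝ (fderiv ℝ φ x (u τ x)) (u τ x))

/-- `X_T = ‖u‖²_{L^∞(0,T; Ḣ²)} + ‖u‖²_{L²(0,T; Ḣ³)}`. -/
def XT (T : ℝ) (u : ℝ → Field3) : ℝ≥0∞ :=
  essSup (fun t => homNorm 2 (u t)) (volume.restrict (Ioo 0 T)) ^ 2 +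
    ∫⁻ t in Ioo 0 T, homNorm 3 (u t) ^ 2

end OscNS

end

/-! ### Weighted trilinear estimates for nonnegative functions of the frequency. -/

noncomputable section

namespace OscNS

/-! The proof is an Ḣ² energy estimate on the Fourier side, in which the oscillation is exploited
only at low frequency. Let α be the amplitude of û and W = ∫ α. Up to constants the energy identity
has dissipation ‖u‖²_{Ḣ³} and source b(Nt) T(u,u,u), with T bounded by ∫∫ |ζ+η|⁵ α(ζ+η) α(ζ) α(η).
The triangle inequality moves weights from one factor to another; Cauchy–Schwarz then puts two
factors in L² and the third in L¹, where W ≤ C ‖u‖_{L²}^{1/4} ‖u‖_{Ḣ²}^{3/4}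
(`exists_wiener_interpolation`).

Fix a cutoff K. If some frequency exceeds K, one more derivative can be traded for K⁻¹, so this part
of T is at most K⁻¹ ‖u‖²_{Ḣ³} W (`tri_five_high_le`) and is integrable in time. If all three
frequencies are below K, write b(Nτ) as the derivative of its primitive, which is at most M/N
(`abs_oscPrim_le`), and integrate by parts in time. The boundary term costs K² ‖u‖_{Ḣ²} ‖u‖_{Ḣ¹} W.
In the time derivative of T the equation is inserted: the Laplacian gives K² ‖u‖_{Ḣ³} ‖u‖_{Ḣ²} W and
the nonlinearity gives K² ‖u‖²_{Ḣ²} W² (`enorm_dT3_le`). All of these carry the factor 1/N.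

The basic energy inequality (`energy_inequality`) bounds ‖u(t)‖_{L²} and the time integral of
‖u‖²_{Ḣ¹} by the datum, and interpolation with X_T controls the rest. With p = ‖u₀‖_{L²}^{1/4} and y
= X_T^{1/8} the source is at most a constant times K⁻¹ p y¹¹ + N⁻¹ K² (p³y⁹ + p⁶y¹⁰)
(`exists_XT_le_cutoff`). Balancing the two terms in K gives the power N^{-1/3} and the exponents of
the statement; the H² term of the datum only enlarges the bound.

The solution is only weak, so the identities must be justified. Testing with ∂_kψ e_l - ∂_lψ e_k
gives the vorticity equation, and separability of L² provides one null set of times for all tests. A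
field is determined by its curl and divergence, so every frequency-truncated component is almost
everywhere in time equal to a Lipschitz path driven by the Leray-projected equation
(`mulOp_chi_eq_path`). On a bounded band all operators are bounded on L², so energies and trilinear
forms may be differentiated along the path; the truncation is removed by monotone convergence
(`hsq_bounds`). -/

/-- The `L²` norm of a nonnegative function. -/
def l2 (F : R3 → ℝ≥0∞) : ℝ≥0∞ := (∫⁻ ξ, F ξ ^ 2) ^ (1 / 2 : ℝ)

/-- The convolution `∫ G(ξ - η) H(η) dη` of nonnegative functions. -/
def lconv (G H : R3 → ℝ≥0∞) (ξ : R3) : ℝ≥0∞ := ∫⁻ η, G (ξ - η) * H η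

/-- The trilinear form `∫∫ F(ξ) G(ξ - η) H(η) dη dξ`. -/
def tri (F G H : R3 → ℝ≥0∞) : ℝ≥0∞ := ∫⁻ ξ, F ξ * lconv G H ξ

/-- The weighted norm `‖|ξ|^k α‖_{L²}`. -/
def mom (k : ℕ) (α : R3 → ℝ≥0∞) : ℝ≥0∞ := l2 (fun ξ => ‖ξ‖ₑ ^ k * α ξ)

lemma l2_sq (F : R3 → ℝ≥0∞) : l2 F ^ 2 = ∫⁻ ξ, F ξ ^ 2 := by
  rw [l2, ← ENNReal.rpow_natCast, ← ENNReal.rpow_mul]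
  norm_num

lemma le_l2_of_sq_le {a b : ℝ≥0∞} (h : a ^ 2 ≤ b ^ 2) : a ≤ b := by
  by_contra hlt
  push Not at hlt
  exact absurd h (not_le.mpr (ENNReal.pow_lt_pow_left two_ne_zero hlt))

lemma l2_mono {F G : R3 → ℝ≥0∞} (h : ∀ ξ, F ξ ≤ G ξ) : l2 F ≤ l2 G := by
  unfold l2
  gcongr with ξ
  exact h ξ

lemma l2_const_mul (c : ℝ≥0∞) (F : R3 → ℝ≥0∞) (hF : Measurable F) :
    l2 (fun ξ => c * F ξ) = c * l2 F := by
  apply le_antisymm <;> apply le_l2_of_sq_le <;>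
  · rw [mul_pow, l2_sq, l2_sq]
    simp only [mul_pow]
    rw [lintegral_const_mul _ (by fun_prop)]

lemma lintegral_mul_le_l2 (F G : R3 → ℝ≥0∞) (hF : AEMeasurable F) (hG : AEMeasurable G) :
    ∫⁻ ξ, F ξ * G ξ ≤ l2 F * l2 G := by
  have h := ENNReal.lintegral_mul_le_Lp_mul_Lq volume Real.HolderConjugate.two_two hF hG
  simpa [l2, ENNReal.rpow_ofNat] using h

lemma l2_comp_sub (F : R3 → ℝ≥0∞) (η : R3) : l2 (fun ξ => F (ξ - η)) = l2 F := by
  unfold l2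
  rw [lintegral_sub_right_eq_self (fun ξ => F ξ ^ 2) η]

lemma lconv_comm (G H : R3 → ℝ≥0∞) (ξ : R3) : lconv G H ξ = lconv H G ξ := by
  unfold lconv
  rw [← lintegral_sub_left_eq_self _ ξ]
  simp [mul_comm]

lemma measurable_lconv {G H : R3 → ℝ≥0∞} (hG : Measurable G) (hH : Measurable H) :
    Measurable (lconv G H) := by
  unfold lconv
  fun_prop

lemma tri_comm (F G H : R3 → ℝ≥0∞) : tri F G H = tri F H G := by
  unfold tri
  simp only [lconv_comm G H]

/-- Tonelli and the substitution ζ = ξ - η. In these variables the output frequency is ζ + η, so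
weights on the first slot can be distributed over the other two by the triangle inequality. -/
lemma tri_eq {F G H : R3 → ℝ≥0∞} (hF : Measurable F) (hG : Measurable G) (hH : Measurable H) :
    tri F G H = ∫⁻ η, ∫⁻ ζ, F (ζ + η) * G ζ * H η := by
  have h1 : tri F G H = ∫⁻ ξ, ∫⁻ η, F ξ * (G (ξ - η) * H η) := by
    unfold tri lconv
    congr with ξ
    rw [lintegral_const_mul _ (by fun_prop)]
  rw [h1, lintegral_lintegral_swap (by fun_prop)]
  congr with η
  rw [← lintegral_add_right_eq_self _ η]
  simp [mul_assoc]

lemma tri_const_mul (c : ℝ≥0∞) {F G H : R3 → ℝ≥0∞} (hF : Measurable F) (hG : Measurable G)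
    (hH : Measurable H) : tri (fun ξ => c * F ξ) G H = c * tri F G H := by
  unfold tri
  have := measurable_lconv hG hH
  simp only [mul_assoc]
  rw [lintegral_const_mul _ (by fun_prop)]

/-- Weight splitting: a bound of the integrand by a sum of two products bounds the form. -/
lemma tri_le_add {F G H F₁ G₁ H₁ F₂ G₂ H₂ : R3 → ℝ≥0∞} {c d : ℝ≥0∞} (hF : Measurable F)
    (hG : Measurable G) (hH : Measurable H) (hF₁ : Measurable F₁) (hG₁ : Measurable G₁)
    (hH₁ : Measurable H₁) (hF₂ : Measurable F₂) (hG₂ : Measurable G₂) (hH₂ : Measurable H₂)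
    (h : ∀ ζ η, c * (F (ζ + η) * G ζ * H η) ≤
      d * (F₁ (ζ + η) * G₁ ζ * H₁ η + F₂ (ζ + η) * G₂ ζ * H₂ η)) :
    c * tri F G H ≤ d * (tri F₁ G₁ H₁ + tri F₂ G₂ H₂) := by
  rw [tri_eq hF hG hH, tri_eq hF₁ hG₁ hH₁, tri_eq hF₂ hG₂ hH₂,
    ← lintegral_const_mul _ (by fun_prop), ← lintegral_add_left (by fun_prop),
    ← lintegral_const_mul _ (by fun_prop)]
  refine lintegral_mono fun η => ?_
  dsimp only
  rw [← lintegral_const_mul _ (by fun_prop), ← lintegral_add_left (by fun_prop),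
    ← lintegral_const_mul _ (by fun_prop)]
  exact lintegral_mono fun ζ => h ζ η

/-- For fixed η, Cauchy–Schwarz in ζ and translation invariance bound the inner integral by the two
L² norms; the remaining function of η is integrated. -/
lemma tri_le {F G H : R3 → ℝ≥0∞} (hF : Measurable F) (hG : Measurable G) (hH : Measurable H) :
    tri F G H ≤ l2 F * l2 G * ∫⁻ η, H η := by
  rw [tri_eq hF hG hH]
  calc ∫⁻ η, ∫⁻ ζ, F (ζ + η) * G ζ * H η
      ≤ ∫⁻ η, (l2 F * l2 G) * H η := by
        refine lintegral_mono fun η => ?_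
        dsimp only
        rw [lintegral_mul_const _ (by fun_prop)]
        gcongr
        refine (lintegral_mul_le_l2 _ _ (by fun_prop) (by fun_prop)).trans ?_
        have := l2_comp_sub F (-η)
        simp only [sub_neg_eq_add] at this
        rw [this]
    _ = _ := lintegral_const_mul _ hH

lemma tri_le' {F G H : R3 → ℝ≥0∞} (hF : Measurable F) (hG : Measurable G) (hH : Measurable H) :
    tri F G H ≤ l2 F * l2 H * ∫⁻ η, G η := by
  rw [tri_comm]
  exact tri_le hF hH hG

lemma lintegral_lconv {G H : R3 → ℝ≥0∞} (hG : Measurable G) (hH : Measurable H) :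
    ∫⁻ ξ, lconv G H ξ = (∫⁻ ξ, G ξ) * ∫⁻ ξ, H ξ := by
  have h : ∫⁻ ξ, lconv G H ξ = tri (fun _ => 1) G H := by simp [tri]
  rw [h, tri_eq measurable_const hG hH]
  simp only [one_mul]
  rw [← lintegral_const_mul _ hH]
  congr with η
  rw [lintegral_mul_const _ hG]

/-- Young's inequality `‖G * H‖₂ ≤ ‖G‖₂ ‖H‖₁`. -/
lemma l2_lconv_le {G H : R3 → ℝ≥0∞} (hG : Measurable G) (hH : Measurable H) :
    l2 (lconv G H) ≤ l2 G * ∫⁻ ξ, H ξ := by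
  apply le_l2_of_sq_le
  rw [l2_sq, mul_pow, l2_sq]
  -- Split H into two square roots and apply Cauchy–Schwarz; one factor integrates to the mass of H.
  have key : ∀ ξ, lconv G H ξ ^ 2 ≤ (∫⁻ η, H η) * lconv (fun ζ => G ζ ^ 2) H ξ := by
    intro ξ
    have h1 : lconv G H ξ = ∫⁻ η, (G (ξ - η) * H η ^ (1 / 2 : ℝ)) * H η ^ (1 / 2 : ℝ) := by
      unfold lconv
      congr with η
      rw [mul_assoc, ← ENNReal.rpow_add_of_nonneg _ _ (by norm_num) (by norm_num)]
      norm_num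
    have hs : ∀ x : ℝ≥0∞, (x ^ (1 / 2 : ℝ)) ^ 2 = x := by
      intro x
      rw [← ENNReal.rpow_natCast, ← ENNReal.rpow_mul]
      norm_num
    calc lconv G H ξ ^ 2 ≤ (l2 (fun η => G (ξ - η) * H η ^ (1 / 2 : ℝ)) *
          l2 (fun η => H η ^ (1 / 2 : ℝ))) ^ 2 := by
          rw [h1]
          gcongr
          exact lintegral_mul_le_l2 _ _ (by fun_prop) (by fun_prop)
      _ = _ := by
          rw [mul_pow, l2_sq, l2_sq, mul_comm]
          simp only [mul_pow, hs]
          rfl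
  calc ∫⁻ ξ, lconv G H ξ ^ 2 ≤ ∫⁻ ξ, (∫⁻ η, H η) * lconv (fun ζ => G ζ ^ 2) H ξ :=
        lintegral_mono key
    _ = _ := by
        rw [lintegral_const_mul _ (measurable_lconv (by fun_prop) hH),
          lintegral_lconv (by fun_prop) hH]
        ring

lemma mom_sq (k : ℕ) (α : R3 → ℝ≥0∞) : mom k α ^ 2 = ∫⁻ ξ, ‖ξ‖ₑ ^ (2 * k) * α ξ ^ 2 := by
  rw [mom, l2_sq]
  congr with ξ
  rw [mul_pow, ← pow_mul, mul_comm k]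

/-- `‖f‖²_{Ḣ^{k+1}} ≤ ‖f‖_{Ḣ^k} ‖f‖_{Ḣ^{k+2}}`. -/
lemma mom_succ_sq_le (k : ℕ) {α : R3 → ℝ≥0∞} (hα : Measurable α) :
    mom (k + 1) α ^ 2 ≤ mom k α * mom (k + 2) α := by
  rw [mom_sq]
  refine le_trans (le_of_eq ?_) (lintegral_mul_le_l2 (fun ξ => ‖ξ‖ₑ ^ k * α ξ)
    (fun ξ => ‖ξ‖ₑ ^ (k + 2) * α ξ) (by fun_prop) (by fun_prop))
  congr with ξ
  ring

lemma sq_add_le_ennreal (a b : ℝ≥0∞) : (a + b) ^ 2 ≤ 2 * (a ^ 2 + b ^ 2) := by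
  have h := ENNReal.rpow_add_le_mul_rpow_add_rpow a b (p := 2) (by norm_num)
  norm_num at h
  exact_mod_cast h

lemma cube_add_le_ennreal (a b : ℝ≥0∞) : (a + b) ^ 3 ≤ 4 * (a ^ 3 + b ^ 3) := by
  have h := ENNReal.rpow_add_le_mul_rpow_add_rpow a b (p := 3) (by norm_num)
  norm_num at h
  exact_mod_cast h

lemma add_mul_self_le_ennreal (a b : ℝ≥0∞) : (a + b) * a ≤ 2 * (a ^ 2 + b ^ 2) :=
  calc (a + b) * a ≤ (a + b) * (a + b) := by gcongr; exact le_self_add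
    _ = (a + b) ^ 2 := by ring
    _ ≤ _ := sq_add_le_ennreal a b

/-- Three derivatives stay on the first slot and two go to either of the others, which leaves one
factor free of weights for the L¹ norm. -/
lemma tri_five_le {α : R3 → ℝ≥0∞} (hα : Measurable α) :
    tri (fun ξ => ‖ξ‖ₑ ^ 5 * α ξ) α α ≤ 4 * (mom 3 α * mom 2 α * ∫⁻ ξ, α ξ) := by
  have h := tri_le_add (c := 1) (d := 2) (F := fun ξ => ‖ξ‖ₑ ^ 5 * α ξ) (G := α) (H := α)
    (F₁ := fun ξ => ‖ξ‖ₑ ^ 3 * α ξ) (G₁ := fun ξ => ‖ξ‖ₑ ^ 2 * α ξ) (H₁ := α)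
    (F₂ := fun ξ => ‖ξ‖ₑ ^ 3 * α ξ) (G₂ := α) (H₂ := fun ξ => ‖ξ‖ₑ ^ 2 * α ξ)
    (by fun_prop) (by fun_prop) (by fun_prop) (by fun_prop) (by fun_prop) (by fun_prop)
    (by fun_prop) (by fun_prop) (by fun_prop) (fun ζ η => by
      calc 1 * (‖ζ + η‖ₑ ^ 5 * α (ζ + η) * α ζ * α η)
          = ‖ζ + η‖ₑ ^ 2 * (‖ζ + η‖ₑ ^ 3 * α (ζ + η) * α ζ * α η) := by ring
        _ ≤ 2 * (‖ζ‖ₑ ^ 2 + ‖η‖ₑ ^ 2) * (‖ζ + η‖ₑ ^ 3 * α (ζ + η) * α ζ * α η) := by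
            gcongr
            exact (pow_le_pow_left' (enorm_add_le ζ η) 2).trans (sq_add_le_ennreal _ _)
        _ = _ := by ring)
  rw [one_mul] at h
  refine h.trans ?_
  have h1 := tri_le (F := fun ξ => ‖ξ‖ₑ ^ 3 * α ξ) (G := fun ξ => ‖ξ‖ₑ ^ 2 * α ξ) (H := α)
    (by fun_prop) (by fun_prop) hα
  have h2 := tri_le' (F := fun ξ => ‖ξ‖ₑ ^ 3 * α ξ) (H := fun ξ => ‖ξ‖ₑ ^ 2 * α ξ) (G := α)
    (by fun_prop) hα (by fun_prop)
  calc _ ≤ 2 * (mom 3 α * mom 2 α * (∫⁻ ξ, α ξ) + mom 3 α * mom 2 α * ∫⁻ ξ, α ξ) := by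
        gcongr
        · exact h1
        · exact h2
    _ = _ := by ring

/-- High-frequency gain: the form with five derivatives, if one frequency is at least `K`. -/
lemma tri_five_high_le {α F G H : R3 → ℝ≥0∞} (hα : Measurable α) (hF : Measurable F)
    (hG : Measurable G) (hH : Measurable H) (hFα : ∀ ξ, F ξ ≤ α ξ) (hGα : ∀ ξ, G ξ ≤ α ξ)
    (hHα : ∀ ξ, H ξ ≤ α ξ) (K : ℝ≥0∞)
    (hK : ∀ ζ η, F (ζ + η) ≠ 0 → G ζ ≠ 0 → H η ≠ 0 → K ≤ ‖ζ‖ₑ + ‖η‖ₑ) :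
    K * tri (fun ξ => ‖ξ‖ₑ ^ 5 * F ξ) G H ≤ 8 * (mom 3 α ^ 2 * ∫⁻ ξ, α ξ) := by
  have h := tri_le_add (c := K) (d := 4) (F := fun ξ => ‖ξ‖ₑ ^ 5 * F ξ) (G := G) (H := H)
    (F₁ := fun ξ => ‖ξ‖ₑ ^ 3 * α ξ) (G₁ := fun ξ => ‖ξ‖ₑ ^ 3 * α ξ) (H₁ := α)
    (F₂ := fun ξ => ‖ξ‖ₑ ^ 3 * α ξ) (G₂ := α) (H₂ := fun ξ => ‖ξ‖ₑ ^ 3 * α ξ)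
    (by fun_prop) (by fun_prop) (by fun_prop) (by fun_prop) (by fun_prop) (by fun_prop)
    (by fun_prop) (by fun_prop) (by fun_prop) (fun ζ η => by
      -- Where the integrand does not vanish, K is replaced by |ζ| + |η|; with two of the five
      -- derivatives this makes a cube, which is shared between ζ and η.
      by_cases h0 : F (ζ + η) ≠ 0 ∧ G ζ ≠ 0 ∧ H η ≠ 0
      · calc K * (‖ζ + η‖ₑ ^ 5 * F (ζ + η) * G ζ * H η)
          = K * ‖ζ + η‖ₑ ^ 2 * (‖ζ + η‖ₑ ^ 3 * F (ζ + η) * G ζ * H η) := by ring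
        _ ≤ (‖ζ‖ₑ + ‖η‖ₑ) * (‖ζ‖ₑ + ‖η‖ₑ) ^ 2 * (‖ζ + η‖ₑ ^ 3 * α (ζ + η) * α ζ * α η) := by
            gcongr
            · exact hK ζ η h0.1 h0.2.1 h0.2.2
            · exact enorm_add_le ζ η
            · exact hFα _
            · exact hGα _
            · exact hHα _
        _ = (‖ζ‖ₑ + ‖η‖ₑ) ^ 3 * (‖ζ + η‖ₑ ^ 3 * α (ζ + η) * α ζ * α η) := by ring
        _ ≤ 4 * (‖ζ‖ₑ ^ 3 + ‖η‖ₑ ^ 3) * (‖ζ + η‖ₑ ^ 3 * α (ζ + η) * α ζ * α η) := by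
            gcongr
            exact cube_add_le_ennreal _ _
        _ = _ := by ring
      · have : F (ζ + η) * G ζ * H η = 0 := by
          by_contra hne
          exact h0 ⟨fun h => hne (by simp [h]), fun h => hne (by simp [h]),
            fun h => hne (by simp [h])⟩
        calc K * (‖ζ + η‖ₑ ^ 5 * F (ζ + η) * G ζ * H η)
          = K * (‖ζ + η‖ₑ ^ 5 * (F (ζ + η) * G ζ * H η)) := by ring
        _ ≤ _ := by simp [this])
  refine h.trans ?_
  have h1 := tri_le (F := fun ξ => ‖ξ‖ₑ ^ 3 * α ξ) (G := fun ξ => ‖ξ‖ₑ ^ 3 * α ξ) (H := α)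
    (by fun_prop) (by fun_prop) hα
  have h2 := tri_le' (F := fun ξ => ‖ξ‖ₑ ^ 3 * α ξ) (H := fun ξ => ‖ξ‖ₑ ^ 3 * α ξ) (G := α)
    (by fun_prop) hα (by fun_prop)
  calc _ ≤ 4 * (mom 3 α * mom 3 α * (∫⁻ ξ, α ξ) + mom 3 α * mom 3 α * ∫⁻ ξ, α ξ) := by
        gcongr
        · exact h1
        · exact h2
    _ = _ := by ring

/-- The analogue for the L² energy, with a single derivative: the factor K becomes a derivative on
one of the other two slots. It makes the high-frequency energy flux of order K⁻¹. -/
lemma tri_one_high_le {α F G H : R3 → ℝ≥0∞} (hα : Measurable α) (hF : Measurable F)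
    (hG : Measurable G) (hH : Measurable H) (hFα : ∀ ξ, F ξ ≤ α ξ) (hGα : ∀ ξ, G ξ ≤ α ξ)
    (hHα : ∀ ξ, H ξ ≤ α ξ) (K : ℝ≥0∞)
    (hK : ∀ ζ η, F (ζ + η) ≠ 0 → G ζ ≠ 0 → H η ≠ 0 → K ≤ ‖ζ‖ₑ + ‖η‖ₑ) :
    K * tri (fun ξ => ‖ξ‖ₑ ^ 1 * F ξ) G H ≤ 2 * (mom 1 α ^ 2 * ∫⁻ ξ, α ξ) := by
  have h := tri_le_add (c := K) (d := 1) (F := fun ξ => ‖ξ‖ₑ ^ 1 * F ξ) (G := G) (H := H)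
    (F₁ := fun ξ => ‖ξ‖ₑ ^ 1 * α ξ) (G₁ := fun ξ => ‖ξ‖ₑ ^ 1 * α ξ) (H₁ := α)
    (F₂ := fun ξ => ‖ξ‖ₑ ^ 1 * α ξ) (G₂ := α) (H₂ := fun ξ => ‖ξ‖ₑ ^ 1 * α ξ)
    (by fun_prop) (by fun_prop) (by fun_prop) (by fun_prop) (by fun_prop) (by fun_prop)
    (by fun_prop) (by fun_prop) (by fun_prop) (fun ζ η => by
      by_cases h0 : F (ζ + η) ≠ 0 ∧ G ζ ≠ 0 ∧ H η ≠ 0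
      · calc
        K * (‖ζ + η‖ₑ ^ 1 * F (ζ + η) * G ζ * H η)
          ≤ (‖ζ‖ₑ + ‖η‖ₑ) * (‖ζ + η‖ₑ ^ 1 * α (ζ + η) * α ζ * α η) := by
            gcongr ?_ * (_ * ?_ * ?_ * ?_)
            · exact hK ζ η h0.1 h0.2.1 h0.2.2
            · exact hFα _
            · exact hGα _
            · exact hHα _
        _ = _ := by ring
      · have : F (ζ + η) * G ζ * H η = 0 := by
          by_contra hne
          exact h0 ⟨fun h => hne (by simp [h]), fun h => hne (by simp [h]),
            fun h => hne (by simp [h])⟩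
        calc K * (‖ζ + η‖ₑ ^ 1 * F (ζ + η) * G ζ * H η)
          = K * (‖ζ + η‖ₑ ^ 1 * (F (ζ + η) * G ζ * H η)) := by ring
        _ ≤ _ := by simp [this])
  refine h.trans ?_
  have h1 := tri_le (F := fun ξ => ‖ξ‖ₑ ^ 1 * α ξ) (G := fun ξ => ‖ξ‖ₑ ^ 1 * α ξ) (H := α)
    (by fun_prop) (by fun_prop) hα
  have h2 := tri_le' (F := fun ξ => ‖ξ‖ₑ ^ 1 * α ξ) (H := fun ξ => ‖ξ‖ₑ ^ 1 * α ξ) (G := α)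
    (by fun_prop) hα (by fun_prop)
  calc _ ≤ 1 * (mom 1 α * mom 1 α * (∫⁻ ξ, α ξ) + mom 1 α * mom 1 α * ∫⁻ ξ, α ξ) := by
        gcongr
        · exact h1
        · exact h2
    _ = _ := by ring

/-- Bernstein-type bound of the form with five derivatives for a low-frequency first slot. -/
lemma tri_five_low_le {α F : R3 → ℝ≥0∞} (hα : Measurable α) (hF : Measurable F)
    (hFα : ∀ ξ, F ξ ≤ α ξ) (K : ℝ≥0∞) (hK : ∀ ξ, F ξ ≠ 0 → ‖ξ‖ₑ ≤ K) :
    tri (fun ξ => ‖ξ‖ₑ ^ 5 * F ξ) α α ≤ 2 * K ^ 2 * (mom 2 α * mom 1 α * ∫⁻ ξ, α ξ) := by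
  have h := tri_le_add (c := 1) (d := K ^ 2) (F := fun ξ => ‖ξ‖ₑ ^ 5 * F ξ) (G := α) (H := α)
    (F₁ := fun ξ => ‖ξ‖ₑ ^ 2 * α ξ) (G₁ := fun ξ => ‖ξ‖ₑ ^ 1 * α ξ) (H₁ := α)
    (F₂ := fun ξ => ‖ξ‖ₑ ^ 2 * α ξ) (G₂ := α) (H₂ := fun ξ => ‖ξ‖ₑ ^ 1 * α ξ)
    (by fun_prop) (by fun_prop) (by fun_prop) (by fun_prop) (by fun_prop) (by fun_prop)
    (by fun_prop) (by fun_prop) (by fun_prop) (fun ζ η => by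
      by_cases h0 : F (ζ + η) = 0
      · simp [h0]
      calc 1 * (‖ζ + η‖ₑ ^ 5 * F (ζ + η) * α ζ * α η)
          = ‖ζ + η‖ₑ ^ 2 * (‖ζ + η‖ₑ * (‖ζ + η‖ₑ ^ 2 * F (ζ + η) * α ζ * α η)) := by ring
        _ ≤ K ^ 2 * ((‖ζ‖ₑ + ‖η‖ₑ) * (‖ζ + η‖ₑ ^ 2 * α (ζ + η) * α ζ * α η)) := by
            gcongr
            · exact hK _ h0
            · exact enorm_add_le ζ η
            · exact hFα _
        _ = _ := by ring)
  rw [one_mul] at h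
  refine h.trans ?_
  have h1 := tri_le (F := fun ξ => ‖ξ‖ₑ ^ 2 * α ξ) (G := fun ξ => ‖ξ‖ₑ ^ 1 * α ξ) (H := α)
    (by fun_prop) (by fun_prop) hα
  have h2 := tri_le' (F := fun ξ => ‖ξ‖ₑ ^ 2 * α ξ) (H := fun ξ => ‖ξ‖ₑ ^ 1 * α ξ) (G := α)
    (by fun_prop) hα (by fun_prop)
  calc _ ≤ K ^ 2 * (mom 2 α * mom 1 α * (∫⁻ ξ, α ξ) + mom 2 α * mom 1 α * ∫⁻ ξ, α ξ) := by
        gcongr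
        · exact h1
        · exact h2
    _ = _ := by ring

/-- A Leibniz rule: the weight |ξ|² falls on one of the two factors, and Young's inequality puts the
other in L¹. -/
lemma mom_two_lconv_le {α : R3 → ℝ≥0∞} (hα : Measurable α) :
    mom 2 (lconv α α) ≤ 4 * (mom 2 α * ∫⁻ ξ, α ξ) := by
  have hm : Measurable (lconv (fun ξ => ‖ξ‖ₑ ^ 2 * α ξ) α) := measurable_lconv (by fun_prop) hα
  calc mom 2 (lconv α α) ≤ l2 (fun ξ => 4 * lconv (fun ξ => ‖ξ‖ₑ ^ 2 * α ξ) α ξ) := by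
        refine l2_mono fun ξ => ?_
        have h1 : 4 * lconv (fun ξ => ‖ξ‖ₑ ^ 2 * α ξ) α ξ
            = 2 * (lconv (fun ξ => ‖ξ‖ₑ ^ 2 * α ξ) α ξ + lconv α (fun ξ => ‖ξ‖ₑ ^ 2 * α ξ) ξ) := by
          rw [lconv_comm α]
          ring
        rw [h1]
        unfold lconv
        rw [← lintegral_const_mul _ (by fun_prop), ← lintegral_add_left (by fun_prop),
          ← lintegral_const_mul _ (by fun_prop)]
        refine lintegral_mono fun η => ?_
        calc ‖ξ‖ₑ ^ 2 * (α (ξ - η) * α η)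
            ≤ 2 * (‖ξ - η‖ₑ ^ 2 + ‖η‖ₑ ^ 2) * (α (ξ - η) * α η) := by
              gcongr
              have := enorm_add_le (ξ - η) η
              rw [sub_add_cancel] at this
              exact (pow_le_pow_left' this 2).trans (sq_add_le_ennreal _ _)
          _ = _ := by ring
    _ = 4 * l2 (lconv (fun ξ => ‖ξ‖ₑ ^ 2 * α ξ) α) := l2_const_mul _ _ hm
    _ ≤ _ := by
        gcongr
        exact l2_lconv_le (by fun_prop) hα

/-- The quartic term with the quadratic nonlinearity in the first slot. -/
lemma tri_quartic_first_le {α Q : R3 → ℝ≥0∞} (hα : Measurable α)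
    (hQα : ∀ ξ, Q ξ ≤ lconv α α ξ) (K : ℝ≥0∞) (hK : ∀ ξ, Q ξ ≠ 0 → ‖ξ‖ₑ ≤ K) :
    tri (fun ξ => ‖ξ‖ₑ ^ 6 * Q ξ) α α ≤ 16 * K ^ 2 * (mom 2 α ^ 2 * (∫⁻ ξ, α ξ) ^ 2) := by
  have hm := measurable_lconv hα hα
  calc tri (fun ξ => ‖ξ‖ₑ ^ 6 * Q ξ) α α
      ≤ ∫⁻ ξ, K ^ 2 * ((‖ξ‖ₑ ^ 2 * lconv α α ξ) ^ 2) := by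
        refine lintegral_mono fun ξ => ?_
        by_cases h0 : Q ξ = 0
        · simp [h0]
        -- Two of the six derivatives are absorbed by K²; the remaining four make a perfect square.
        calc ‖ξ‖ₑ ^ 6 * Q ξ * lconv α α ξ
            = ‖ξ‖ₑ ^ 2 * (‖ξ‖ₑ ^ 4 * Q ξ * lconv α α ξ) := by ring
          _ ≤ K ^ 2 * (‖ξ‖ₑ ^ 4 * lconv α α ξ * lconv α α ξ) := by
              gcongr
              · exact hK _ h0
              · exact hQα _
          _ = _ := by ring
    _ = K ^ 2 * mom 2 (lconv α α) ^ 2 := by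
        rw [lintegral_const_mul _ (by fun_prop), mom, l2_sq]
    _ ≤ K ^ 2 * (4 * (mom 2 α * ∫⁻ ξ, α ξ)) ^ 2 := by
        gcongr
        exact mom_two_lconv_le hα
    _ = _ := by ring

/-- The quartic term with the quadratic nonlinearity in the second slot. -/
lemma tri_quartic_second_le {α F : R3 → ℝ≥0∞} (hα : Measurable α) (hF : Measurable F)
    (hFα : ∀ ξ, F ξ ≤ α ξ) (K : ℝ≥0∞) (hK : ∀ ξ, F ξ ≠ 0 → ‖ξ‖ₑ ≤ K) :
    tri (fun ξ => ‖ξ‖ₑ ^ 5 * F ξ) (fun ξ => ‖ξ‖ₑ * lconv α α ξ) α ≤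
      10 * K ^ 2 * (mom 2 α ^ 2 * (∫⁻ ξ, α ξ) ^ 2) := by
  have hm := measurable_lconv hα hα
  -- Of the five derivatives on the first slot, two become K² and two stay. The fifth is bounded by
  -- |ζ| + |η| and joins the derivative |ζ| of the second slot, giving two derivatives on either the
  -- second or the third.
  have h := tri_le_add (c := 1) (d := 2 * K ^ 2) (F := fun ξ => ‖ξ‖ₑ ^ 5 * F ξ)
    (G := fun ξ => ‖ξ‖ₑ * lconv α α ξ) (H := α)
    (F₁ := fun ξ => ‖ξ‖ₑ ^ 2 * α ξ) (G₁ := fun ξ => ‖ξ‖ₑ ^ 2 * lconv α α ξ) (H₁ := α)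
    (F₂ := fun ξ => ‖ξ‖ₑ ^ 2 * α ξ) (G₂ := lconv α α) (H₂ := fun ξ => ‖ξ‖ₑ ^ 2 * α ξ)
    (by fun_prop) (by fun_prop) (by fun_prop) (by fun_prop) (by fun_prop) (by fun_prop)
    (by fun_prop) (by fun_prop) (by fun_prop) (fun ζ η => by
      by_cases h0 : F (ζ + η) = 0
      · simp [h0]
      calc 1 * (‖ζ + η‖ₑ ^ 5 * F (ζ + η) * (‖ζ‖ₑ * lconv α α ζ) * α η)
          = ‖ζ + η‖ₑ ^ 2 * (‖ζ + η‖ₑ * ‖ζ‖ₑ *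
            (‖ζ + η‖ₑ ^ 2 * F (ζ + η) * lconv α α ζ * α η)) := by ring
        _ ≤ K ^ 2 * ((‖ζ‖ₑ + ‖η‖ₑ) * ‖ζ‖ₑ * (‖ζ + η‖ₑ ^ 2 * α (ζ + η) * lconv α α ζ * α η)) := by
            gcongr
            · exact hK _ h0
            · exact enorm_add_le ζ η
            · exact hFα _
        _ ≤ K ^ 2 * (2 * (‖ζ‖ₑ ^ 2 + ‖η‖ₑ ^ 2) *
            (‖ζ + η‖ₑ ^ 2 * α (ζ + η) * lconv α α ζ * α η)) := by
            exact mul_le_mul' le_rfl (mul_le_mul' (add_mul_self_le_ennreal _ _) le_rfl)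
        _ = _ := by ring)
  rw [one_mul] at h
  refine h.trans ?_
  have h1 := tri_le (F := fun ξ => ‖ξ‖ₑ ^ 2 * α ξ) (G := fun ξ => ‖ξ‖ₑ ^ 2 * lconv α α ξ) (H := α)
    (by fun_prop) (by fun_prop) hα
  have h2 := tri_le' (F := fun ξ => ‖ξ‖ₑ ^ 2 * α ξ) (H := fun ξ => ‖ξ‖ₑ ^ 2 * α ξ) (G := lconv α α)
    (by fun_prop) hm (by fun_prop)
  rw [lintegral_lconv hα hα] at h2
  calc _ ≤ 2 * K ^ 2 * (mom 2 α * (4 * (mom 2 α * ∫⁻ ξ, α ξ)) * (∫⁻ ξ, α ξ) +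
        mom 2 α * mom 2 α * ((∫⁻ ξ, α ξ) * ∫⁻ ξ, α ξ)) := by
        gcongr
        · refine h1.trans ?_
          gcongr
          · exact le_rfl
          · exact mom_two_lconv_le hα
        · exact h2
    _ = _ := by ring

/-! ### Interpolation of the L¹ norm of the Fourier transform. -/

/-- The weight `(λ⁴ + |ξ|⁴)⁻¹`. -/
def wienerWeight (l : ℝ) (ξ : R3) : ℝ≥0∞ := ENNReal.ofReal ((l ^ 4 + ‖ξ‖ ^ 4)⁻¹)

/-- Decay of order 4 is integrable in dimension 3; the comparison uses (1 + r)⁴ ≤ 8(1 + r⁴). -/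
lemma lintegral_wienerWeight_one_lt_top : ∫⁻ ξ, wienerWeight 1 ξ < ⊤ := by
  have h := finite_integral_one_add_norm (E := R3) (μ := volume) (r := 4) (by
    simp; norm_num)
  refine lt_of_le_of_lt (b := ENNReal.ofReal 8 * ∫⁻ ξ : R3, ENNReal.ofReal ((1 + ‖ξ‖) ^ (-4 : ℝ)))
    ?_ (ENNReal.mul_lt_top ENNReal.ofReal_lt_top h)
  rw [← lintegral_const_mul _ (by fun_prop)]
  refine lintegral_mono fun ξ => ?_
  unfold wienerWeight
  rw [← ENNReal.ofReal_mul (by norm_num)]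
  apply ENNReal.ofReal_le_ofReal
  have h0 : (0 : ℝ) ≤ ‖ξ‖ := norm_nonneg ξ
  rw [Real.rpow_neg (by positivity), inv_le_comm₀ (by positivity) (by positivity)]
  have h4 : (1 + ‖ξ‖) ^ (4 : ℝ) = (1 + ‖ξ‖) ^ 4 := by norm_cast
  rw [h4, mul_inv, inv_inv]
  nlinarith [sq_nonneg (1 - ‖ξ‖), sq_nonneg (1 - ‖ξ‖ ^ 2), sq_nonneg (‖ξ‖ ^ 2 - ‖ξ‖),
    mul_nonneg h0 (sq_nonneg (1 - ‖ξ‖)), mul_nonneg h0 h0]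

/-- Scaling ξ by l: the volume contributes l³ and the weight l⁻⁴. -/
lemma lintegral_wienerWeight {l : ℝ} (hl : 0 < l) :
    ∫⁻ ξ, wienerWeight l ξ = ENNReal.ofReal l⁻¹ * ∫⁻ ξ, wienerWeight 1 ξ := by
  have hmap := Measure.map_addHaar_smul (volume : Measure R3) hl.ne'
  have hm : Measurable (wienerWeight l) := by unfold wienerWeight; fun_prop
  have hm1 : Measurable (wienerWeight 1) := by unfold wienerWeight; fun_prop
  have h1 : ∫⁻ ξ, wienerWeight l (l • ξ) = ENNReal.ofReal (l ^ 3)⁻¹ * ∫⁻ ξ, wienerWeight l ξ := by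
    rw [← lintegral_map (μ := volume) (f := wienerWeight l) (g := fun ξ : R3 => l • ξ) hm
      (by fun_prop)]
    erw [hmap]
    rw [lintegral_smul_measure]
    simp [abs_of_pos hl]
  have h2 : ∫⁻ ξ, wienerWeight l (l • ξ) = ENNReal.ofReal (l ^ 4)⁻¹ * ∫⁻ ξ, wienerWeight 1 ξ := by
    rw [← lintegral_const_mul _ hm1]
    congr with ξ
    unfold wienerWeight
    rw [← ENNReal.ofReal_mul (by positivity), norm_smul, Real.norm_of_nonneg hl.le]
    congr 1
    rw [← mul_inv]
    ring_nf
  calc ∫⁻ ξ, wienerWeight l ξ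
      = ENNReal.ofReal (l ^ 3) * (ENNReal.ofReal (l ^ 3)⁻¹ * ∫⁻ ξ, wienerWeight l ξ) := by
        rw [← mul_assoc, ← ENNReal.ofReal_mul (by positivity), mul_inv_cancel₀ (by positivity)]
        simp
    _ = ENNReal.ofReal (l ^ 3) * (ENNReal.ofReal (l ^ 4)⁻¹ * ∫⁻ ξ, wienerWeight 1 ξ) := by
        rw [← h1, h2]
    _ = _ := by
        rw [← mul_assoc, ← ENNReal.ofReal_mul (by positivity)]
        congr 2
        field_simp

lemma lintegral_eq_zero_of_mom_eq_zero {k : ℕ} {α : R3 → ℝ≥0∞} (hα : Measurable α)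
    (h : mom k α = 0) : ∫⁻ ξ, α ξ = 0 := by
  have h1 : mom k α ^ 2 = 0 := by rw [h]; simp
  rw [mom_sq, lintegral_eq_zero_iff (by fun_prop)] at h1
  rw [lintegral_eq_zero_iff hα]
  have h0 : ∀ᵐ ξ : R3, ξ ≠ 0 := by
    rw [ae_iff]
    simp
  filter_upwards [h1, h0] with ξ hξ hξ0
  simpa [hξ0] using hξ

/-- `‖û‖_{L¹} ≤ C ‖u‖_{L²}^{1/4} ‖u‖_{Ḣ²}^{3/4}`. -/
theorem exists_wiener_interpolation : ∃ C : ℝ≥0, ∀ α : R3 → ℝ≥0∞, Measurable α →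
    mom 0 α ≠ ⊤ → mom 2 α ≠ ⊤ →
    ∫⁻ ξ, α ξ ≤ C * mom 0 α ^ (1 / 4 : ℝ) * mom 2 α ^ (3 / 4 : ℝ) := by
  obtain ⟨J, hJ⟩ : ∃ J : ℝ≥0, ∫⁻ ξ, wienerWeight 1 ξ = J :=
    ⟨_, (ENNReal.coe_toNNReal lintegral_wienerWeight_one_lt_top.ne).symm⟩
  refine ⟨(2 * J) ^ (1 / 2 : ℝ), fun α hα h0 h2 => ?_⟩
  by_cases hz0 : mom 0 α = 0
  · simp [lintegral_eq_zero_of_mom_eq_zero hα hz0]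
  by_cases hz2 : mom 2 α = 0
  · simp [lintegral_eq_zero_of_mom_eq_zero hα hz2]
  obtain ⟨a, ha⟩ : ∃ a : ℝ, mom 0 α = ENNReal.ofReal a ∧ 0 < a :=
    ⟨(mom 0 α).toReal, (ENNReal.ofReal_toReal h0).symm, ENNReal.toReal_pos hz0 h0⟩
  obtain ⟨d, hd⟩ : ∃ d : ℝ, mom 2 α = ENNReal.ofReal d ∧ 0 < d :=
    ⟨(mom 2 α).toReal, (ENNReal.ofReal_toReal h2).symm, ENNReal.toReal_pos hz2 h2⟩
  obtain ⟨ha, ha0⟩ := ha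
  obtain ⟨hd, hd0⟩ := hd
  -- This choice balances the two parts of the weighted L² norm: l⁴a² = d².
  set l : ℝ := Real.sqrt (d / a) with hl
  have hl0 : 0 < l := Real.sqrt_pos.mpr (by positivity)
  have hl2 : l ^ 2 = d / a := Real.sq_sqrt (by positivity)
  have hw : Measurable (wienerWeight l) := by unfold wienerWeight; fun_prop
  have key : (∫⁻ ξ, α ξ) ^ 2 ≤ (ENNReal.ofReal l⁻¹ * J) * (2 * ENNReal.ofReal d ^ 2) := by
    have e1 : ∀ ξ : R3, α ξ = wienerWeight l ξ ^ (1 / 2 : ℝ) *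
        (ENNReal.ofReal (l ^ 4 + ‖ξ‖ ^ 4) ^ (1 / 2 : ℝ) * α ξ) := by
      intro ξ
      have hp : 0 < l ^ 4 + ‖ξ‖ ^ 4 := by positivity
      rw [← mul_assoc, ← ENNReal.mul_rpow_of_nonneg _ _ (by norm_num), wienerWeight,
        ← ENNReal.ofReal_mul (by positivity), inv_mul_cancel₀ hp.ne']
      simp
    have hs : ∀ x : ℝ≥0∞, (x ^ (1 / 2 : ℝ)) ^ 2 = x := by
      intro x
      rw [← ENNReal.rpow_natCast, ← ENNReal.rpow_mul]
      norm_num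
    calc (∫⁻ ξ, α ξ) ^ 2
        ≤ (l2 (fun ξ => wienerWeight l ξ ^ (1 / 2 : ℝ)) *
            l2 (fun ξ => ENNReal.ofReal (l ^ 4 + ‖ξ‖ ^ 4) ^ (1 / 2 : ℝ) * α ξ)) ^ 2 := by
          gcongr
          rw [lintegral_congr e1]
          exact lintegral_mul_le_l2 _ _ (by fun_prop) (by fun_prop)
      _ = (∫⁻ ξ, wienerWeight l ξ) * ∫⁻ ξ, ENNReal.ofReal (l ^ 4 + ‖ξ‖ ^ 4) * α ξ ^ 2 := by
          rw [mul_pow, l2_sq, l2_sq]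
          simp only [mul_pow, hs]
      _ = (∫⁻ ξ, wienerWeight l ξ) * (ENNReal.ofReal (l ^ 4) * mom 0 α ^ 2 + mom 2 α ^ 2) := by
          congr 1
          rw [mom_sq, mom_sq, ← lintegral_const_mul _ (by fun_prop),
            ← lintegral_add_left (by fun_prop)]
          congr with ξ
          rw [ENNReal.ofReal_add (by positivity) (by positivity), add_mul,
            ENNReal.ofReal_pow (norm_nonneg ξ), ofReal_norm]
          simp
      _ = _ := by
          rw [lintegral_wienerWeight hl0, hJ, ha, hd]
          congr 1
          rw [← ENNReal.ofReal_pow ha0.le, ← ENNReal.ofReal_mul (by positivity), two_mul,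
            ← ENNReal.ofReal_pow hd0.le]
          congr 2
          rw [show l ^ 4 = (l ^ 2) ^ 2 by ring, hl2]
          field_simp
  have hfin : (∫⁻ ξ, α ξ) = ((∫⁻ ξ, α ξ) ^ 2) ^ (1 / 2 : ℝ) := by
    rw [← ENNReal.rpow_natCast, ← ENNReal.rpow_mul]
    norm_num
  rw [hfin, ha, hd]
  refine (ENNReal.rpow_le_rpow key (by norm_num)).trans (le_of_eq ?_)
  have hlr : l⁻¹ = a ^ (1 / 2 : ℝ) * d ^ (-(1 / 2) : ℝ) := by
    rw [hl, Real.sqrt_eq_rpow, Real.div_rpow hd0.le ha0.le, inv_div, Real.rpow_neg hd0.le]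
    rfl
  rw [hlr, ENNReal.ofReal_rpow_of_pos ha0, ENNReal.ofReal_rpow_of_pos hd0,
    ENNReal.coe_rpow_of_nonneg _ (by norm_num), mul_assoc (ENNReal.ofNNReal _ ^ _),
    ← ENNReal.ofReal_mul (by positivity)]
  have e2 : ENNReal.ofReal (a ^ (1 / 2 : ℝ) * d ^ (-(1 / 2) : ℝ)) * J * (2 * ENNReal.ofReal d ^ 2)
      = ((2 * J : ℝ≥0) : ℝ≥0∞) * ENNReal.ofReal (a ^ (1 / 2 : ℝ) * d ^ (3 / 2 : ℝ)) := by
    rw [← ENNReal.ofReal_pow hd0.le]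
    have : a ^ (1 / 2 : ℝ) * d ^ (3 / 2 : ℝ) = a ^ (1 / 2 : ℝ) * d ^ (-(1 / 2) : ℝ) * d ^ 2 := by
      rw [mul_assoc, ← Real.rpow_natCast d 2, ← Real.rpow_add hd0]
      norm_num
    rw [this, ENNReal.ofReal_mul (by positivity) (q := d ^ 2)]
    push_cast
    ring
  rw [e2, ENNReal.mul_rpow_of_nonneg _ _ (by norm_num), ENNReal.ofReal_rpow_of_pos (by positivity)]
  congr 2
  rw [Real.mul_rpow (by positivity) (by positivity), ← Real.rpow_mul ha0.le, ← Real.rpow_mul hd0.le]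
  norm_num

end OscNS

end

/-! ### Multipliers and convolutions as bounded operators on L². -/

noncomputable section

namespace OscNS

/-- Complex square-integrable functions on (frequency) space. -/
abbrev L2C : Type := Lp ℂ 2 (volume : Measure R3)

open Classical in
/-- Multiplication by an essentially bounded function, as an operator on `L²`
(zero if the function is not essentially bounded). -/
def mulOp (m : R3 → ℂ) : L2C →L[ℂ] L2C :=
  if h : MemLp m ∞ volume then
    (ContinuousLinearMap.mul ℂ ℂ).holderL volume ∞ 2 2 (h.toLp m) else 0

lemma coeFn_mulOp {m : R3 → ℂ} (h : MemLp m ∞ volume) (f : L2C) :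
    mulOp m f =ᵐ[volume] fun ξ => m ξ * f ξ := by
  rw [mulOp, dif_pos h, ContinuousLinearMap.holderL_apply_apply]
  filter_upwards [(ContinuousLinearMap.mul ℂ ℂ).coeFn_holder (r := 2) (h.toLp m) f,
    h.coeFn_toLp] with ξ h1 h2
  rw [h1, h2]
  rfl

lemma memLp_infty_of_bound {m : R3 → ℂ} (hm : Measurable m) (C : ℝ) (h : ∀ ξ, ‖m ξ‖ ≤ C) :
    MemLp m ∞ volume :=
  MeasureTheory.memLp_top_of_bound hm.aestronglyMeasurable C (Filter.Eventually.of_forall h)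

/-- The convolution of two square-integrable functions. -/
def convFun (f g : L2C) (ξ : R3) : ℂ := ∫ η, f (ξ - η) * g η

lemma measurePreserving_const_sub (ξ : R3) :
    MeasurePreserving (fun η : R3 => ξ - η) volume volume :=
  Measure.measurePreserving_sub_left volume ξ

lemma integrable_conv (f g : L2C) (ξ : R3) : Integrable (fun η => f (ξ - η) * g η) :=
  ((Lp.memLp f).comp_measurePreserving (measurePreserving_const_sub ξ)).integrable_mul (Lp.memLp g)

lemma enorm_eq_l2 (f : L2C) : ‖f‖ₑ = l2 (fun ξ => ‖f ξ‖ₑ) := by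
  rw [Lp.enorm_def, eLpNorm_eq_lintegral_rpow_enorm_toReal (by norm_num) (by norm_num), l2]
  simp

lemma measurable_enorm_coe (f : L2C) : Measurable (fun ξ => ‖f ξ‖ₑ) :=
  (Lp.stronglyMeasurable f).measurable.enorm

lemma enorm_convFun_le (f g : L2C) (ξ : R3) :
    ‖convFun f g ξ‖ₑ ≤ lconv (fun ξ => ‖f ξ‖ₑ) (fun ξ => ‖g ξ‖ₑ) ξ := by
  unfold convFun lconv
  refine (enorm_integral_le_lintegral_enorm _).trans (le_of_eq ?_)
  simp

lemma lconv_le_l2 {G H : R3 → ℝ≥0∞} (hG : Measurable G) (hH : Measurable H) (ξ : R3) :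
    lconv G H ξ ≤ l2 G * l2 H := by
  refine (lintegral_mul_le_l2 _ _ (by fun_prop) (by fun_prop)).trans (le_of_eq ?_)
  congr 1
  unfold l2
  rw [lintegral_sub_left_eq_self (fun η => G η ^ 2) ξ]

lemma norm_convFun_le (f g : L2C) (ξ : R3) : ‖convFun f g ξ‖ ≤ ‖f‖ * ‖g‖ := by
  have h := (enorm_convFun_le f g ξ).trans
    (lconv_le_l2 (measurable_enorm_coe f) (measurable_enorm_coe g) ξ)
  rw [← enorm_eq_l2, ← enorm_eq_l2, ← ofReal_norm, ← ofReal_norm, ← ofReal_norm,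
    ← ENNReal.ofReal_mul (norm_nonneg _)] at h
  exact (ENNReal.ofReal_le_ofReal_iff (by positivity)).mp h

lemma stronglyMeasurable_convFun (f g : L2C) : StronglyMeasurable (convFun f g) := by
  have h : StronglyMeasurable (fun p : R3 × R3 => f (p.1 - p.2) * g p.2) :=
    ((Lp.stronglyMeasurable f).comp_measurable (measurable_fst.sub measurable_snd)).mul
      ((Lp.stronglyMeasurable g).comp_measurable measurable_snd)
  exact h.integral_prod_right

lemma convFun_add_left (f f' g : L2C) (ξ : R3) :
    convFun (f + f') g ξ = convFun f g ξ + convFun f' g ξ := by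
  unfold convFun
  rw [← integral_add (integrable_conv f g ξ) (integrable_conv f' g ξ)]
  refine integral_congr_ae ?_
  filter_upwards [(measurePreserving_const_sub ξ).quasiMeasurePreserving.ae (Lp.coeFn_add f f')]
    with η h
  simp only [h, Pi.add_apply]
  ring

lemma convFun_add_right (f g g' : L2C) (ξ : R3) :
    convFun f (g + g') ξ = convFun f g ξ + convFun f g' ξ := by
  unfold convFun
  rw [← integral_add (integrable_conv f g ξ) (integrable_conv f g' ξ)]
  refine integral_congr_ae ?_
  filter_upwards [Lp.coeFn_add g g'] with η h
  simp only [h, Pi.add_apply]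
  ring

lemma convFun_smul_left (c : ℂ) (f g : L2C) (ξ : R3) :
    convFun (c • f) g ξ = c * convFun f g ξ := by
  unfold convFun
  rw [← integral_const_mul]
  refine integral_congr_ae ?_
  filter_upwards [(measurePreserving_const_sub ξ).quasiMeasurePreserving.ae (Lp.coeFn_smul c f)]
    with η h
  simp only [h, Pi.smul_apply, smul_eq_mul]
  ring

lemma convFun_smul_right (c : ℂ) (f g : L2C) (ξ : R3) :
    convFun f (c • g) ξ = c * convFun f g ξ := by
  unfold convFun
  rw [← integral_const_mul]
  refine integral_congr_ae ?_
  filter_upwards [Lp.coeFn_smul c g] with η h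
  simp only [h, Pi.smul_apply, smul_eq_mul]
  ring

/-- A convolution of two L² functions is only bounded, so square integrability must come from the
symbol m. This is why nonlinear symbols are always cut off or weighted. -/
lemma memLp_mul_convFun {m : R3 → ℂ} (hm : MemLp m 2 volume) (f g : L2C) :
    MemLp (fun ξ => m ξ * convFun f g ξ) 2 volume :=
  MemLp.mul (p := 2) (q := ∞) (r := 2) (memLp_infty_of_bound
    (stronglyMeasurable_convFun f g).measurable _ (norm_convFun_le f g)) hm

/-- The map `(f, g) ↦ m · (f * g)` for square-integrable `m`, as a bilinear map. -/
def convLin (m : R3 → ℂ) (hm : MemLp m 2 volume) : L2C →ₗ[ℂ] L2C →ₗ[ℂ] L2C :=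
  LinearMap.mk₂ ℂ (fun f g => (memLp_mul_convFun hm f g).toLp)
    (fun f f' g => by
      rw [← MemLp.toLp_add]
      congr 1
      ext ξ
      simp [convFun_add_left, mul_add])
    (fun c f g => by
      rw [← MemLp.toLp_const_smul]
      congr 1
      ext ξ
      simp only [convFun_smul_left, Pi.smul_apply, smul_eq_mul]
      ring)
    (fun f g g' => by
      rw [← MemLp.toLp_add]
      congr 1
      ext ξ
      simp [convFun_add_right, mul_add])
    (fun c f g => by
      rw [← MemLp.toLp_const_smul]
      congr 1
      ext ξ
      simp only [convFun_smul_right, Pi.smul_apply, smul_eq_mul]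
      ring)

lemma norm_convLin_le (m : R3 → ℂ) (hm : MemLp m 2 volume) (f g : L2C) :
    ‖convLin m hm f g‖ ≤ (eLpNorm m 2 volume).toReal * ‖f‖ * ‖g‖ := by
  have h : ‖(memLp_mul_convFun hm f g).toLp‖ ≤ (‖f‖ * ‖g‖) * (eLpNorm m 2 volume).toReal := by
    rw [← Lp.norm_toLp m hm]
    refine Lp.norm_le_mul_norm_of_ae_le_mul ?_
    filter_upwards [(memLp_mul_convFun hm f g).coeFn_toLp, hm.coeFn_toLp] with ξ h1 h2
    rw [h1, h2, norm_mul, mul_comm]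
    gcongr
    exact norm_convFun_le f g ξ
  calc _ ≤ _ := h
    _ = _ := by ring

open Classical in
/-- The map `(f, g) ↦ m · (f * g)` for square-integrable `m`, as a bounded bilinear map
(zero if `m` is not square-integrable). -/
def convOp (m : R3 → ℂ) : L2C →L[ℂ] L2C →L[ℂ] L2C :=
  if hm : MemLp m 2 volume then
    LinearMap.mkContinuous₂ (convLin m hm) (eLpNorm m 2 volume).toReal (norm_convLin_le m hm) else 0

lemma coeFn_convOp {m : R3 → ℂ} (hm : MemLp m 2 volume) (f g : L2C) :
    convOp m f g =ᵐ[volume] fun ξ => m ξ * convFun f g ξ := by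
  rw [convOp, dif_pos hm]
  exact (memLp_mul_convFun hm f g).coeFn_toLp

lemma mulOp_mulOp {p m : R3 → ℂ} (hp : MemLp p ∞ volume) (hm : MemLp m ∞ volume) (f : L2C) :
    mulOp p (mulOp m f) = mulOp (fun ξ => p ξ * m ξ) f := by
  apply Lp.ext
  filter_upwards [coeFn_mulOp hp (mulOp m f), coeFn_mulOp hm f,
    coeFn_mulOp (m := fun ξ => p ξ * m ξ) (MemLp.mul (p := ∞) (q := ∞) (r := ∞) hm hp) f]
    with ξ h1 h2 h3
  rw [h1, h2, h3]
  ring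

lemma mulOp_convOp {p m : R3 → ℂ} (hp : MemLp p ∞ volume) (hm : MemLp m 2 volume) (f g : L2C) :
    mulOp p (convOp m f g) = convOp (fun ξ => p ξ * m ξ) f g := by
  apply Lp.ext
  filter_upwards [coeFn_mulOp hp (convOp m f g), coeFn_convOp hm f g,
    coeFn_convOp (m := fun ξ => p ξ * m ξ) (MemLp.mul (p := ∞) (q := 2) (r := 2) hm hp) f g]
    with ξ h1 h2 h3
  rw [h1, h2, h3]
  ring

lemma enorm_inner_le (f g : L2C) : ‖inner ℂ f g‖ₑ ≤ ∫⁻ ξ, ‖f ξ‖ₑ * ‖g ξ‖ₑ := by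
  rw [L2.inner_def]
  refine (enorm_integral_le_lintegral_enorm _).trans (lintegral_mono fun ξ => ?_)
  rw [← enorm_mul, RCLike.inner_apply, enorm_mul, enorm_mul, mul_comm]
  gcongr
  simp [enorm_eq_nnnorm]

/-- Bound of a trilinear expression by the nonnegative form `tri`. -/
lemma enorm_inner_convOp_le {m : R3 → ℂ} (hm : MemLp m 2 volume) (f g h : L2C)
    {F G H : R3 → ℝ≥0∞} (hF : ∀ᵐ ξ, ‖f ξ‖ₑ * ‖m ξ‖ₑ ≤ F ξ) (hG : ∀ᵐ ξ, ‖g ξ‖ₑ ≤ G ξ)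
    (hH : ∀ᵐ ξ, ‖h ξ‖ₑ ≤ H ξ) : ‖inner ℂ f (convOp m g h)‖ₑ ≤ tri F G H := by
  refine (enorm_inner_le _ _).trans (lintegral_mono_ae ?_)
  filter_upwards [coeFn_convOp hm g h, hF] with ξ h1 h2
  rw [h1, enorm_mul, ← mul_assoc]
  gcongr
  refine (enorm_convFun_le g h ξ).trans (lintegral_mono_ae ?_)
  filter_upwards [(measurePreserving_const_sub ξ).quasiMeasurePreserving.ae hG, hH] with η h3 h4
  gcongr

end OscNS

end

/-! ### Density of compactly supported functions in Schwartz space. -/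

noncomputable section

namespace OscNS

open scoped SchwartzMap LineDeriv
open Filter Topology

section Density

variable {F : Type*} [NormedAddCommGroup F] [NormedSpace ℝ F]

/-- A fixed smooth cutoff function, equal to one near the unit ball. -/
def cutoffBump : ContDiffBump (0 : R3) := ⟨1, 2, one_pos, one_lt_two⟩

/-- The cutoff at scale `n + 1`. -/
def cutoff (n : ℕ) (x : R3) : ℝ := cutoffBump ((n + 1 : ℝ)⁻¹ • x)

lemma contDiff_cutoff (n : ℕ) : ContDiff ℝ ∞ (cutoff n) :=
  cutoffBump.contDiff.comp (contDiff_const_smul _)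

lemma hasCompactSupport_cutoff (n : ℕ) : HasCompactSupport (cutoff n) :=
  cutoffBump.hasCompactSupport.comp_smul (by positivity)

lemma cutoff_eq_one {n : ℕ} {x : R3} (hx : ‖x‖ < n + 1) : cutoff n x = 1 := by
  apply cutoffBump.one_of_mem_closedBall
  have : (0 : ℝ) < n + 1 := by positivity
  rw [mem_closedBall_zero_iff, norm_smul, Real.norm_of_nonneg (by positivity)]
  change _ ≤ (1 : ℝ)
  rw [inv_mul_le_iff₀ this]
  linarith

/-- Rescaling by a factor at most one does not increase derivatives, so the bounds for the fixed
bump serve all n. The difference with 1 is the multiplier of the truncation error. -/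
lemma exists_iteratedFDeriv_cutoff_le (i : ℕ) :
    ∃ C, ∀ n x, ‖iteratedFDeriv ℝ i (fun y => cutoff n y - 1) x‖ ≤ C := by
  have hsm : ContDiff ℝ ∞ (fun y : R3 => cutoffBump y - 1) := cutoffBump.contDiff.sub contDiff_const
  have hb : ∃ C, ∀ x, ‖iteratedFDeriv ℝ i (fun y : R3 => cutoffBump y - 1) x‖ ≤ C := by
    rcases Nat.eq_zero_or_pos i with rfl | hi
    · refine ⟨1, fun x => ?_⟩
      rw [norm_iteratedFDeriv_zero, Real.norm_eq_abs, abs_le]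
      exact ⟨by linarith [cutoffBump.nonneg (x := x)], by linarith [cutoffBump.le_one (x := x)]⟩
    · have hc : Continuous (iteratedFDeriv ℝ i (cutoffBump : R3 → ℝ)) :=
        (cutoffBump.contDiff (n := (⊤ : ℕ∞))).continuous_iteratedFDeriv (mod_cast le_top)
      obtain ⟨C, hC⟩ := hc.bounded_above_of_compact_support
        (cutoffBump.hasCompactSupport.iteratedFDeriv i)
      refine ⟨C, fun x => ?_⟩
      have : iteratedFDeriv ℝ i (fun y : R3 => cutoffBump y - 1) x
          = iteratedFDeriv ℝ i (cutoffBump : R3 → ℝ) x := by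
        have h := iteratedFDeriv_sub_apply (𝕜 := ℝ) (i := i) (x := x) (f := (cutoffBump : R3 → ℝ))
          (g := fun _ => (1 : ℝ)) cutoffBump.contDiff.contDiffAt contDiff_const.contDiffAt
        rw [iteratedFDeriv_const_of_ne hi.ne'] at h
        simpa using! h
      rw [this]
      exact hC x
  obtain ⟨C, hC⟩ := hb
  refine ⟨C, fun n x => ?_⟩
  have h1 : (fun y => cutoff n y - 1) = (fun y : R3 => cutoffBump y - 1) ∘
      (((n + 1 : ℝ)⁻¹) • ContinuousLinearMap.id ℝ R3) := by
    ext y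
    simp [cutoff]
  rw [h1, ContinuousLinearMap.iteratedFDeriv_comp_right _ hsm _ (mod_cast le_top)]
  refine (ContinuousMultilinearMap.norm_compContinuousLinearMap_le _ _).trans ?_
  calc _ ≤ C * ∏ _j : Fin i, (1 : ℝ) := by
        gcongr
        · exact (norm_nonneg _).trans (hC 0)
        · exact hC _
        · refine (ContinuousLinearMap.opNorm_le_bound _ zero_le_one fun y => ?_)
          simp only [smul_apply, ContinuousLinearMap.id_apply, norm_smul]
          gcongr
          rw [Real.norm_of_nonneg (by positivity)]
          exact inv_le_one_of_one_le₀ (by linarith [n.cast_nonneg (α := ℝ)])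
    _ = C := by simp

/-- The truncation of a Schwartz function. -/
def truncate (n : ℕ) (ψ : 𝓢(R3, F)) : 𝓢(R3, F) := SchwartzMap.smulLeftCLM F (cutoff n) ψ

lemma truncate_apply (n : ℕ) (ψ : 𝓢(R3, F)) (x : R3) : truncate n ψ x = cutoff n x • ψ x :=
  SchwartzMap.smulLeftCLM_apply_apply
    ((hasCompactSupport_cutoff n).hasTemperateGrowth (contDiff_cutoff n)) ψ x

lemma hasCompactSupport_truncate (n : ℕ) (ψ : 𝓢(R3, F)) : HasCompactSupport (truncate n ψ) := by
  have : (truncate n ψ : R3 → F) = fun x => cutoff n x • ψ x := by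
    ext x
    exact truncate_apply n ψ x
  rw [this]
  exact (hasCompactSupport_cutoff n).smul_right

/-- Compactly supported smooth functions are dense in Schwartz space. -/
lemma tendsto_truncate (ψ : 𝓢(R3, F)) : Tendsto (fun n => truncate n ψ) atTop (𝓝 ψ) := by
  rw [(schwartz_withSeminorms ℝ R3 F).tendsto_nhds]
  rintro ⟨k, l⟩ ε hε
  choose C hC using exists_iteratedFDeriv_cutoff_le
  set B : ℝ := ∑ i ∈ Finset.range (l + 1), (l.choose i : ℝ) * C i *
    SchwartzMap.seminorm ℝ (k + 1) (l - i) ψ with hB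
  have hC0 : ∀ i, 0 ≤ C i := fun i => (norm_nonneg _).trans (hC i 0 0)
  have hB0 : 0 ≤ B := Finset.sum_nonneg fun i _ => by
    have := hC0 i
    positivity
  have hbound : ∀ n : ℕ, SchwartzMap.seminorm ℝ k l (truncate n ψ - ψ) ≤ B / (n + 1) := by
    intro n
    refine SchwartzMap.seminorm_le_bound ℝ k l _ (by positivity) fun x => ?_
    have hfun : ((truncate n ψ - ψ : 𝓢(R3, F)) : R3 → F) = fun y => (cutoff n y - 1) • ψ y := by
      ext y
      simp [truncate_apply, sub_smul]
    rw [hfun]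
    have hn : (0 : ℝ) < n + 1 := by positivity
    rcases lt_or_ge ‖x‖ (n + 1) with hx | hx
    · have : (fun y => (cutoff n y - 1) • ψ y) =ᶠ[𝓝 x] fun _ => 0 := by
        filter_upwards [(isOpen_lt continuous_norm continuous_const).mem_nhds hx] with y hy
        rw [cutoff_eq_one hy]
        simp
      rw [(this.iteratedFDeriv ℝ l).eq_of_nhds]
      simp only [iteratedFDeriv_fun_zero, Pi.zero_apply, norm_zero, mul_zero]
      positivity
    · have h1 := norm_iteratedFDeriv_smul_le (𝕜 := ℝ) (f := fun y => cutoff n y - 1) (g := ψ)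
        ((contDiff_cutoff n).sub contDiff_const) (ψ.smooth ⊤) x (n := l) (mod_cast le_top)
      -- The error lives outside the ball of radius n + 1, where one extra power of |x| buys the
      -- decay 1/(n + 1).
      have h2 : ‖x‖ ^ k ≤ ‖x‖ ^ (k + 1) / (n + 1) := by
        rw [le_div_iff₀ hn, pow_succ]
        gcongr
      calc ‖x‖ ^ k * ‖iteratedFDeriv ℝ l (fun y => (cutoff n y - 1) • ψ y) x‖
          ≤ (‖x‖ ^ (k + 1) / (n + 1)) * ∑ i ∈ Finset.range (l + 1), (l.choose i : ℝ) *
            ‖iteratedFDeriv ℝ i (fun y => cutoff n y - 1) x‖ * ‖iteratedFDeriv ℝ (l - i) ψ x‖ := by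
            gcongr
        _ = (∑ i ∈ Finset.range (l + 1), (l.choose i : ℝ) *
            ‖iteratedFDeriv ℝ i (fun y => cutoff n y - 1) x‖ *
            (‖x‖ ^ (k + 1) * ‖iteratedFDeriv ℝ (l - i) ψ x‖)) / (n + 1) := by
            rw [Finset.mul_sum, Finset.sum_div]
            refine Finset.sum_congr rfl fun i _ => ?_
            ring
        _ ≤ B / (n + 1) := by
            rw [hB]
            gcongr with i hi
            · exact mul_nonneg (by positivity) (hC0 i)
            · exact hC i n x
            · exact SchwartzMap.le_seminorm ℝ (k + 1) (l - i) ψ x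
  have hlim : Tendsto (fun n : ℕ => B / ((n : ℝ) + 1)) atTop (𝓝 0) :=
    tendsto_const_div_atTop_nhds_zero_nat B |>.comp (tendsto_add_atTop_nat 1) |>.congr fun n => by
      simp
  filter_upwards [hlim.eventually (gt_mem_nhds hε)] with n hn
  exact (hbound n).trans_lt hn

end Density

end OscNS

end

/-! ### Pairing L² with Schwartz functions, and the convolution theorem. -/

noncomputable section

namespace OscNS

open scoped SchwartzMap LineDeriv
open Filter Topology

/-- The bilinear pairing `∫ h f` of a Schwartz function with an `L²` function,
continuous in the latter. -/
def pairL (h : 𝓢(R3, ℂ)) : L2C →L[ℂ] ℂ :=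
  (ContinuousLinearMap.mul ℂ ℂ).lpPairing volume 2 2 (h.toLp 2)

/-- The bilinear pairing `∫ h f`, continuous in the Schwartz function. -/
def pairS (f : L2C) : 𝓢(R3, ℂ) →L[ℂ] ℂ :=
  (((ContinuousLinearMap.mul ℂ ℂ).lpPairing volume 2 2).flip f) ∘L SchwartzMap.toLpCLM ℂ ℂ 2 volume

lemma pairS_apply (f : L2C) (h : 𝓢(R3, ℂ)) : pairS f h = pairL h f := rfl

lemma pairL_apply (f : L2C) (h : 𝓢(R3, ℂ)) : pairL h f = ∫ x, h x * f x := by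
  rw [pairL, ContinuousLinearMap.lpPairing_eq_integral]
  refine integral_congr_ae ?_
  filter_upwards [h.coeFn_toLp 2] with x hx
  rw [hx]
  rfl

/-- The L² Fourier transform agrees with the one on tempered distributions, which is defined by this
duality. -/
lemma pairL_fourier (f : L2C) (h : 𝓢(R3, ℂ)) : pairL h (𝓕 f) = pairL (𝓕 h) f := by
  have h1 := congrArg (fun T => T h) (Lp.fourier_toTemperedDistribution_eq f)
  simp only [TemperedDistribution.fourier_apply, Lp.toTemperedDistribution_apply] at h1
  rw [pairL_apply, pairL_apply]
  exact h1.symm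

lemma eq_zero_of_pairL_eq_zero {f : L2C} (hf : ∀ h : 𝓢(R3, ℂ), pairL h f = 0) : f = 0 := by
  have h1 := Lp.ker_toTemperedDistributionCLM_eq_bot (F := ℂ) (μ := (volume : Measure R3)) (p := 2)
  rw [LinearMap.ker_eq_bot'] at h1
  apply h1
  ext h
  have := hf h
  rw [pairL_apply] at this
  simpa using this

/-- A continuous functional on complex Schwartz functions which vanishes on real compactly
supported functions vanishes. -/
lemma eq_zero_of_real_compactSupport (Λ : 𝓢(R3, ℂ) →L[ℂ] ℂ)
    (h : ∀ ψ : 𝓢(R3, ℝ), HasCompactSupport ψ → Λ (ψ.postcompCLM Complex.ofRealCLM) = 0) :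
    Λ = 0 := by
  have hreal : ∀ ψ : 𝓢(R3, ℝ), Λ (ψ.postcompCLM Complex.ofRealCLM) = 0 := by
    intro ψ
    have hc : Continuous fun ψ : 𝓢(R3, ℝ) => Λ (ψ.postcompCLM Complex.ofRealCLM) :=
      Λ.continuous.comp (SchwartzMap.postcompCLM Complex.ofRealCLM).continuous
    have ht := (hc.tendsto ψ).comp (tendsto_truncate ψ)
    refine tendsto_nhds_unique ht (tendsto_const_nhds.congr fun n => ?_)
    exact (h _ (hasCompactSupport_truncate n ψ)).symm
  ext ψ
  have hdec : ψ = (ψ.postcompCLM Complex.reCLM).postcompCLM Complex.ofRealCLM +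
      Complex.I • (ψ.postcompCLM Complex.imCLM).postcompCLM Complex.ofRealCLM := by
    ext x
    simp only [add_apply, smul_apply, SchwartzMap.postcompCLM_apply,
      Complex.ofRealCLM_apply, Complex.reCLM_apply, Complex.imCLM_apply, smul_eq_mul]
    rw [mul_comm]
    exact (Complex.re_add_im _).symm
  rw [hdec, map_add, map_smul, hreal, hreal]
  simp

lemma fourierInv_neg_apply (s : 𝓢(R3, ℂ)) (x : R3) :
    (𝓕⁻ s : 𝓢(R3, ℂ)) (-x) = (𝓕 s : 𝓢(R3, ℂ)) x := by
  rw [SchwartzMap.fourierInv_apply_eq]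
  simp

lemma fourier_fourier_apply (s : 𝓢(R3, ℂ)) (x : R3) :
    (𝓕 (𝓕 s : 𝓢(R3, ℂ)) : 𝓢(R3, ℂ)) x = s (-x) := by
  rw [← fourierInv_neg_apply]
  exact congrArg (fun t : 𝓢(R3, ℂ) => t (-x))
    (FourierTransform.fourierInv_fourier_eq (E := 𝓢(R3, ℂ)) (F := 𝓢(R3, ℂ)) s)

/-- The convolution of two scalar Schwartz functions. -/
def convS (s₁ s₂ : 𝓢(R3, ℂ)) : 𝓢(R3, ℂ) :=
  SchwartzMap.convolution (ContinuousLinearMap.mul ℂ ℂ) s₂ s₁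

lemma convFun_toLp (s₁ s₂ : 𝓢(R3, ℂ)) (ξ : R3) :
    convFun (s₁.toLp 2) (s₂.toLp 2) ξ = convS s₁ s₂ ξ := by
  rw [convS, SchwartzMap.convolution_apply, convFun, convolution]
  refine integral_congr_ae ?_
  filter_upwards [(measurePreserving_const_sub ξ).quasiMeasurePreserving.ae
    (s₁.coeFn_toLp 2 volume), s₂.coeFn_toLp 2 volume] with η h3 h4
  rw [h3, h4]
  simp [mul_comm]

lemma fourier_convS_fourier (s₁ s₂ : 𝓢(R3, ℂ)) (x : R3) :
    (𝓕 (convS (𝓕 s₁) (𝓕 s₂)) : 𝓢(R3, ℂ)) x = s₁ (-x) * s₂ (-x) := by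
  rw [convS, SchwartzMap.fourier_convolution, SchwartzMap.pairing_apply_apply,
    fourier_fourier_apply, fourier_fourier_apply, ContinuousLinearMap.mul_apply', mul_comm]

/-- Write g as 𝓕 (𝓕⁻ g), move the outer transform onto the convolution, where it becomes a reflected
product, and reflect the integration variable. -/
lemma integral_convS_mul (s₁ s₂ g : 𝓢(R3, ℂ)) :
    ∫ ξ, convS (𝓕 s₁) (𝓕 s₂) ξ * g ξ = ∫ x, (𝓕 g : 𝓢(R3, ℂ)) x * (s₁ x * s₂ x) := by
  have e2 : ∫ ξ, convS (𝓕 s₁) (𝓕 s₂) ξ * g ξ =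
      ∫ x, (𝓕 (convS (𝓕 s₁) (𝓕 s₂)) : 𝓢(R3, ℂ)) x * (𝓕⁻ g : 𝓢(R3, ℂ)) x := by
    rw [SchwartzMap.integral_fourier_mul_eq,
      FourierTransform.fourier_fourierInv_eq (E := 𝓢(R3, ℂ)) (F := 𝓢(R3, ℂ)) g]
  rw [e2, ← integral_neg_eq_self]
  refine integral_congr_ae (Eventually.of_forall fun x => ?_)
  dsimp only
  rw [fourier_convS_fourier, neg_neg, fourierInv_neg_apply, mul_comm]

lemma pairL_convOp_toLp {m : R3 → ℂ} (hm : MemLp m 2 volume) (g h : 𝓢(R3, ℂ))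
    (hg : ∀ ξ, m ξ * h ξ = g ξ) (s₁ s₂ : 𝓢(R3, ℂ)) :
    pairL h (convOp m ((𝓕 s₁).toLp 2) ((𝓕 s₂).toLp 2)) =
      ∫ x, (𝓕 g : 𝓢(R3, ℂ)) x * ((s₁.toLp 2 : L2C) x * (s₂.toLp 2 : L2C) x) := by
  have e1 : ∫ ξ, h ξ * (convOp m ((𝓕 s₁).toLp 2) ((𝓕 s₂).toLp 2)) ξ =
      ∫ ξ, convS (𝓕 s₁) (𝓕 s₂) ξ * g ξ := by
    refine integral_congr_ae ?_
    filter_upwards [coeFn_convOp hm ((𝓕 s₁).toLp 2) ((𝓕 s₂).toLp 2)] with ξ h6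
    rw [h6, convFun_toLp, ← hg]
    ring
  rw [pairL_apply, e1, integral_convS_mul]
  have h7 := s₁.coeFn_toLp 2 volume
  have h8 := s₂.coeFn_toLp 2 volume
  generalize (𝓕 g : 𝓢(R3, ℂ)) = φ
  refine integral_congr_ae ?_
  filter_upwards [h7, h8] with x h9 h10
  exact congrArg (φ x * ·) (congrArg₂ (· * ·) h9.symm h10.symm)

/-- The pairing with a product of two square-integrable functions is continuous. -/
lemma integral_mul_mul_eq_lpPairing (φ : 𝓢(R3, ℂ)) (f₁ f₂ : L2C) :
    ∫ x, φ x * (f₁ x * f₂ x) =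
      (ContinuousLinearMap.mul ℂ ℂ).lpPairing volume 2 2 (mulOp φ f₁) f₂ := by
  rw [ContinuousLinearMap.lpPairing_eq_integral]
  refine integral_congr_ae ?_
  filter_upwards [coeFn_mulOp φ.memLp_top f₁] with x hx
  simp only [ContinuousLinearMap.mul_apply', hx]
  ring

/-- The Fourier transform of a product of square-integrable functions is the convolution of
their Fourier transforms, tested against a Schwartz function. -/
lemma pairL_convOp {m : R3 → ℂ} (hm : MemLp m 2 volume) (g h : 𝓢(R3, ℂ))
    (hg : ∀ ξ, m ξ * h ξ = g ξ) (f₁ f₂ : L2C) :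
    pairL h (convOp m (𝓕 f₁) (𝓕 f₂)) = ∫ x, (𝓕 g : 𝓢(R3, ℂ)) x * (f₁ x * f₂ x) := by
  have hd := SchwartzMap.denseRange_toLpCLM (E := R3) (F := ℂ) (p := 2) (μ := volume)
    ENNReal.ofNat_ne_top
  rw [integral_mul_mul_eq_lpPairing]
  set B : L2C →L[ℂ] L2C →L[ℂ] ℂ := (ContinuousLinearMap.mul ℂ ℂ).lpPairing volume 2 2
  set A : L2C →L[ℂ] L2C := mulOp (𝓕 g : 𝓢(R3, ℂ)) with hA
  set P : L2C →L[ℂ] ℂ := pairL h with hP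
  set Q : L2C →L[ℂ] L2C →L[ℂ] L2C := convOp m with hQ
  have hF : Continuous (fun f : L2C => (𝓕 f : L2C)) := (Lp.fourierTransformₗᵢ R3 ℂ).continuous
  have hcl : IsClosed {p : L2C × L2C | P (Q (𝓕 p.1) (𝓕 p.2)) = B (A p.1) p.2} := by
    apply isClosed_eq
    · exact P.continuous.comp
        ((Q.continuous.comp (hF.comp continuous_fst)).clm_apply (hF.comp continuous_snd))
    · exact ((B.continuous.comp (A.continuous.comp continuous_fst))).clm_apply continuous_snd
  -- Both sides are continuous in the pair of L² functions, so it suffices to check Schwartz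
  -- functions.
  refine hd.induction_on₂ (p := fun f₁ f₂ : L2C => P (Q (𝓕 f₁) (𝓕 f₂)) = B (A f₁) f₂)
    hcl (fun s₁ s₂ => ?_) f₁ f₂
  simp only [SchwartzMap.toLpCLM_apply, SchwartzMap.toLp_fourier_eq]
  rw [hP, hQ, pairL_convOp_toLp hm g h hg, integral_mul_mul_eq_lpPairing]

end OscNS

end

/-! ### Fourier transforms of real and of divergence-free fields. -/

noncomputable section

namespace OscNS

open scoped SchwartzMap LineDeriv ComplexConjugate
open Filter Topology

/-- The Fourier transform of the `i`-th component, as an operator. -/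
def hatL (i : Fin 3) : Field3 →L[ℝ] L2C :=
  ((Lp.fourierTransformₗᵢ R3 ℂ).toContinuousLinearEquiv.toContinuousLinearMap.restrictScalars ℝ) ∘L
    ContinuousLinearMap.compLpL 2 volume
      (Complex.ofRealCLM.comp (EuclideanSpace.proj i : R3 →L[ℝ] ℝ))

lemma hatL_apply (i : Fin 3) (f : Field3) : hatL i f = 𝓕 (component f i) := rfl

lemma coeFn_component (f : Field3) (i : Fin 3) :
    component f i =ᵐ[volume] fun x => ((f x i : ℝ) : ℂ) := by
  unfold component
  filter_upwards [ContinuousLinearMap.coeFn_compLp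
    (Complex.ofRealCLM.comp (EuclideanSpace.proj i : R3 →L[ℝ] ℝ)) f] with x hx
  rw [hx]
  rfl

/-- The Schwartz function `ξ ↦ conj (h (-ξ))`. -/
def starNeg (h : 𝓢(R3, ℂ)) : 𝓢(R3, ℂ) :=
  (SchwartzMap.compCLMOfContinuousLinearEquiv ℝ (ContinuousLinearEquiv.neg ℝ) h).postcompCLM
    (Complex.conjCLE : ℂ →L[ℝ] ℂ)

lemma starNeg_apply (h : 𝓢(R3, ℂ)) (ξ : R3) : starNeg h ξ = conj (h (-ξ)) := rfl

lemma fourier_starNeg (h : 𝓢(R3, ℂ)) (x : R3) :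
    (𝓕 (starNeg h) : 𝓢(R3, ℂ)) x = conj ((𝓕 h : 𝓢(R3, ℂ)) x) := by
  rw [SchwartzMap.fourier_coe, SchwartzMap.fourier_coe, Real.fourier_eq, Real.fourier_eq,
    ← integral_conj, ← integral_neg_eq_self]
  refine integral_congr_ae (Eventually.of_forall fun v => ?_)
  simp only [starNeg_apply, neg_neg, inner_neg_left, Circle.smul_def, smul_eq_mul, map_mul]
  congr 1
  rw [← Circle.coe_inv_eq_conj, ← AddChar.map_neg_eq_inv, neg_neg]

/-- The function `ξ ↦ conj (a (-ξ))` for square-integrable `a`. -/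
def starNegL (a : L2C) : L2C :=
  MemLp.toLp (fun ξ => conj (a (-ξ)))
    (((Lp.memLp a).comp_measurePreserving (Measure.measurePreserving_neg volume)).star)

lemma coeFn_starNegL (a : L2C) : starNegL a =ᵐ[volume] fun ξ => conj (a (-ξ)) :=
  MemLp.coeFn_toLp _

lemma pairL_starNegL (a : L2C) (h : 𝓢(R3, ℂ)) :
    pairL h (starNegL a) = conj (pairL (starNeg h) a) := by
  rw [pairL_apply, pairL_apply, ← integral_conj, ← integral_neg_eq_self]
  refine integral_congr_ae ?_
  filter_upwards [(Measure.measurePreserving_neg (volume : Measure R3)).quasiMeasurePreserving.ae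
    (coeFn_starNegL a)] with ξ hξ
  rw [hξ, neg_neg, starNeg_apply, map_mul, Complex.conj_conj]

/-- Reality: the Fourier transform of a real function is Hermitian. -/
lemma hat_neg (f : Field3) (i : Fin 3) : ∀ᵐ ξ, hatL i f (-ξ) = conj (hatL i f ξ) := by
  have h1 : starNegL (hatL i f) = hatL i f := by
    rw [← sub_eq_zero]
    refine eq_zero_of_pairL_eq_zero fun h => ?_
    rw [map_sub, sub_eq_zero, pairL_starNegL, hatL_apply, pairL_fourier, pairL_fourier,
      pairL_apply, pairL_apply, ← integral_conj]
    refine integral_congr_ae ?_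
    filter_upwards [coeFn_component f i] with x hx
    rw [hx, map_mul, fourier_starNeg, Complex.conj_conj, Complex.conj_ofReal]
  filter_upwards [coeFn_starNegL (hatL i f)] with ξ h2
  rw [h1] at h2
  rw [h2, Complex.conj_conj]

/-- The standard basis. -/
def e (k : Fin 3) : R3 := EuclideanSpace.single k 1

/-- The symbol of the derivative dual to `∂_k`. -/
def sig (k : Fin 3) (ξ : R3) : ℂ := -(2 * Real.pi * Complex.I) * (ξ k : ℂ)

/-- Multiplication of a Schwartz function by `sig k`. -/
def sigS (k : Fin 3) (g : 𝓢(R3, ℂ)) : 𝓢(R3, ℂ) :=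
  -(2 * Real.pi * Complex.I) • SchwartzMap.smulLeftCLM ℂ (inner ℝ · (e k)) g

lemma inner_e (x : R3) (k : Fin 3) : inner ℝ x (e k) = x k := by
  simp [e, EuclideanSpace.inner_single_right]

lemma sigS_apply (k : Fin 3) (g : 𝓢(R3, ℂ)) (ξ : R3) : sigS k g ξ = sig k ξ * g ξ := by
  have : (inner ℝ · (e k) : R3 → ℝ).HasTemperateGrowth := by fun_prop
  rw [sigS, smul_apply, SchwartzMap.smulLeftCLM_apply_apply this, inner_e, sig]
  simp only [smul_eq_mul, Complex.real_smul]
  ring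

lemma lineDeriv_fourier (k : Fin 3) (g : 𝓢(R3, ℂ)) :
    (∂_{e k} (𝓕 g : 𝓢(R3, ℂ)) : 𝓢(R3, ℂ)) = 𝓕 (sigS k g) :=
  SchwartzMap.lineDerivOp_fourier_eq g (e k)

/-- Complexification of a real Schwartz function. -/
def toC (ψ : 𝓢(R3, ℝ)) : 𝓢(R3, ℂ) := ψ.postcompCLM Complex.ofRealCLM

lemma toC_apply (ψ : 𝓢(R3, ℝ)) (x : R3) : toC ψ x = (ψ x : ℂ) := rfl

lemma lineDeriv_toC (v : R3) (ψ : 𝓢(R3, ℝ)) :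
    (∂_{v} (toC ψ) : 𝓢(R3, ℂ)) = toC (∂_{v} ψ) := by
  ext x
  rw [SchwartzMap.lineDerivOp_apply_eq_fderiv, toC_apply, SchwartzMap.lineDerivOp_apply_eq_fderiv]
  have h := (Complex.ofRealCLM.hasFDerivAt (x := ψ x)).comp x (ψ.differentiableAt.hasFDerivAt)
  have h2 : HasFDerivAt (toC ψ) (Complex.ofRealCLM.comp (fderiv ℝ ψ x)) x := h
  rw [h2.fderiv]
  rfl

lemma sum_coord (x : R3) : x = ∑ k, x k • e k := by
  ext i
  simp [e, Finset.sum_apply, Pi.single_apply]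

lemma integrable_schwartz_mul (φ : 𝓢(R3, ℂ)) (f : L2C) : Integrable (fun x => φ x * f x) :=
  (φ.memLp 2).integrable_mul (Lp.memLp f)

lemma ae_eq_zero_of_integral_schwartz {w : R3 → ℂ} (hw : LocallyIntegrable w)
    (h : ∀ g : 𝓢(R3, ℂ), ∫ ξ, g ξ * w ξ = 0) : ∀ᵐ ξ, w ξ = 0 := by
  apply ae_eq_zero_of_integral_contDiff_smul_eq_zero hw
  intro g g_smooth g_cpt
  have hg₁ : HasCompactSupport (Complex.ofRealCLM ∘ g) := g_cpt.comp_left rfl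
  have hg₂ : ContDiff ℝ ∞ (Complex.ofRealCLM ∘ g) := by fun_prop
  exact h (hg₁.toSchwartzMap hg₂)

/-- A divergence-free field has Fourier transform orthogonal to the frequency. -/
lemma hat_divFree {f : Field3} (hf : IsDivFree f) :
    ∀ᵐ ξ : R3, ∑ k, (ξ k : ℂ) * hatL k f ξ = 0 := by
  set Λ : 𝓢(R3, ℂ) →L[ℂ] ℂ :=
    ∑ k, pairS (component f k) ∘L LineDeriv.lineDerivOpCLM ℂ 𝓢(R3, ℂ) (e k) with hΛ
  have hΛ_apply : ∀ φ, Λ φ = ∑ k, pairL (∂_{e k} φ) (component f k) := by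
    intro φ
    rw [hΛ, sum_apply]
    rfl
  -- The hypothesis tests only real compactly supported functions; density extends it to all complex
  -- Schwartz functions, in particular to Fourier transforms.
  have h0 : Λ = 0 := by
    apply eq_zero_of_real_compactSupport
    intro ψ hψ
    have h1 := hf ψ (ψ.smooth ⊤) hψ
    rw [hΛ_apply]
    have h2 : ∀ k, pairL (∂_{e k} (ψ.postcompCLM Complex.ofRealCLM)) (component f k) =
        ∫ x, (toC (∂_{e k} ψ)) x * component f k x := by
      intro k
      rw [pairL_apply]
      congr with x
      rw [← lineDeriv_toC]
      rfl
    rw [Finset.sum_congr rfl fun k _ => h2 k, ← integral_finsetSum]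
    · have h3 : ∫ x, ((fderiv ℝ ψ x (f x) : ℝ) : ℂ) = 0 := by
        rw [integral_complex_ofReal, h1]
        simp
      rw [← h3]
      refine integral_congr_ae ?_
      filter_upwards [ae_all_iff.mpr fun k => coeFn_component f k] with x hx
      conv_rhs => rw [sum_coord (f x)]
      rw [map_sum]
      push_cast
      refine Finset.sum_congr rfl fun k _ => ?_
      rw [hx, toC_apply, SchwartzMap.lineDerivOp_apply_eq_fderiv, map_smul, smul_eq_mul]
      push_cast
      ring
    · intro k _
      exact integrable_schwartz_mul _ _
  have hloc : LocallyIntegrable (fun ξ : R3 => ∑ k, (ξ k : ℂ) * hatL k f ξ) := by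
    refine locallyIntegrable_finsetSum _ fun k _ => ?_
    have hl : LocallyIntegrable (hatL k f) :=
      (Lp.memLp (hatL k f)).locallyIntegrable (by norm_num)
    have hc : Continuous (fun ξ : R3 => (ξ k : ℂ)) := by fun_prop
    exact hl.continuous_mul hc
  refine ae_eq_zero_of_integral_schwartz hloc fun g => ?_
  have h4 : Λ (𝓕 g) = 0 := by rw [h0]; rfl
  rw [hΛ_apply] at h4
  have h5 : ∀ k, pairL (∂_{e k} (𝓕 g : 𝓢(R3, ℂ))) (component f k) =
      -(2 * Real.pi * Complex.I) * ∫ ξ, g ξ * ((ξ k : ℂ) * hatL k f ξ) := by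
    intro k
    rw [lineDeriv_fourier, ← pairL_fourier, pairL_apply, ← integral_const_mul]
    congr with ξ
    rw [sigS_apply, sig, hatL_apply]
    ring
  rw [Finset.sum_congr rfl fun k _ => h5 k, ← Finset.mul_sum] at h4
  have h6 : (-(2 * Real.pi * Complex.I) : ℂ) ≠ 0 := by
    simp [Real.pi_ne_zero, Complex.I_ne_zero]
  have h7 := (mul_eq_zero.mp h4).resolve_left h6
  rw [← h7, ← integral_finsetSum]
  · congr with ξ
    rw [Finset.mul_sum]
  · intro k _
    have h8 := integrable_schwartz_mul (sigS k g) (hatL k f)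
    have h9 := h8.const_mul (-(2 * Real.pi * Complex.I) : ℂ)⁻¹
    refine h9.congr (Eventually.of_forall fun ξ => ?_)
    dsimp only
    rw [sigS_apply, sig]
    field_simp

end OscNS

end

/-! ### Curl test fields and the weighted vorticity equation. -/

noncomputable section

namespace OscNS

open scoped SchwartzMap LineDeriv ComplexConjugate
open Filter Topology

lemma toC_injective {ψ χ : 𝓢(R3, ℝ)} (h : toC ψ = toC χ) : ψ = χ := by
  ext x
  have := congrArg (fun t : 𝓢(R3, ℂ) => t x) h
  simpa [toC_apply] using this

lemma sigS_comm (k l : Fin 3) (g : 𝓢(R3, ℂ)) : sigS k (sigS l g) = sigS l (sigS k g) := by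
  ext ξ
  simp only [sigS_apply]
  ring

/-- On the Fourier side derivatives are multiplications, which commute. -/
lemma lineDeriv_comm (k l : Fin 3) (ψ : 𝓢(R3, ℝ)) :
    (∂_{e k} (∂_{e l} ψ : 𝓢(R3, ℝ)) : 𝓢(R3, ℝ)) = ∂_{e l} (∂_{e k} ψ : 𝓢(R3, ℝ)) := by
  apply toC_injective
  have h : toC ψ = 𝓕 (𝓕⁻ (toC ψ) : 𝓢(R3, ℂ)) :=
    (FourierTransform.fourier_fourierInv_eq (E := 𝓢(R3, ℂ)) (F := 𝓢(R3, ℂ)) _).symm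
  rw [← lineDeriv_toC, ← lineDeriv_toC, ← lineDeriv_toC, ← lineDeriv_toC, h, lineDeriv_fourier,
    lineDeriv_fourier, lineDeriv_fourier, lineDeriv_fourier, sigS_comm]

/-- The divergence-free test field `∂_kψ e_l - ∂_lψ e_k`. -/
def curlField (k l : Fin 3) (ψ : 𝓢(R3, ℝ)) (x : R3) : R3 :=
  (∂_{e k} ψ : 𝓢(R3, ℝ)) x • e l - (∂_{e l} ψ : 𝓢(R3, ℝ)) x • e k

lemma contDiff_curlField (k l : Fin 3) (ψ : 𝓢(R3, ℝ)) : ContDiff ℝ ∞ (curlField k l ψ) :=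
  (((∂_{e k} ψ : 𝓢(R3, ℝ)).smooth ⊤).smul contDiff_const).sub
    (((∂_{e l} ψ : 𝓢(R3, ℝ)).smooth ⊤).smul contDiff_const)

lemma hasCompactSupport_lineDeriv (v : R3) {ψ : 𝓢(R3, ℝ)} (hψ : HasCompactSupport ψ) :
    HasCompactSupport (∂_{v} ψ : 𝓢(R3, ℝ)) :=
  hψ.mono' ((subset_tsupport _).trans (SchwartzMap.tsupport_lineDerivOp_subset v ψ))

lemma hasCompactSupport_curlField (k l : Fin 3) {ψ : 𝓢(R3, ℝ)} (hψ : HasCompactSupport ψ) :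
    HasCompactSupport (curlField k l ψ) :=
  ((hasCompactSupport_lineDeriv (e k) hψ).smul_right).sub
    ((hasCompactSupport_lineDeriv (e l) hψ).smul_right)

lemma fderiv_curlField (k l : Fin 3) (ψ : 𝓢(R3, ℝ)) (x v : R3) :
    fderiv ℝ (curlField k l ψ) x v =
      (∂_{v} (∂_{e k} ψ : 𝓢(R3, ℝ)) : 𝓢(R3, ℝ)) x • e l -
        (∂_{v} (∂_{e l} ψ : 𝓢(R3, ℝ)) : 𝓢(R3, ℝ)) x • e k := by
  have h := (((∂_{e k} ψ : 𝓢(R3, ℝ)).differentiableAt (x := x)).hasFDerivAt.smul_const (e l)).sub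
    (((∂_{e l} ψ : 𝓢(R3, ℝ)).differentiableAt (x := x)).hasFDerivAt.smul_const (e k))
  have h2 : HasFDerivAt (curlField k l ψ) _ x := h
  rw [h2.fderiv]
  simp [SchwartzMap.lineDerivOp_apply_eq_fderiv]

lemma divergence_curlField (k l : Fin 3) (ψ : 𝓢(R3, ℝ)) (x : R3) :
    divergence (curlField k l ψ) x = 0 := by
  have h : ∀ i, fderiv ℝ (curlField k l ψ) x (EuclideanSpace.single i 1) i =
      (if i = l then (∂_{e l} (∂_{e k} ψ : 𝓢(R3, ℝ)) : 𝓢(R3, ℝ)) x else 0) -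
      (if i = k then (∂_{e k} (∂_{e l} ψ : 𝓢(R3, ℝ)) : 𝓢(R3, ℝ)) x else 0) := by
    intro i
    rw [fderiv_curlField]
    simp only [e, PiLp.sub_apply, PiLp.smul_apply, PiLp.single_apply, smul_eq_mul]
    congr 1 <;> split_ifs with hi <;> simp [hi]
  unfold divergence
  rw [Finset.sum_congr rfl fun i _ => h i, Finset.sum_sub_distrib]
  simp [lineDeriv_comm k l]

lemma laplacian_curlField (k l : Fin 3) (ψ : 𝓢(R3, ℝ)) (x : R3) :
    (Δ (curlField k l ψ)) x = (Δ (∂_{e k} ψ : 𝓢(R3, ℝ)) : 𝓢(R3, ℝ)) x • e l -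
      (Δ (∂_{e l} ψ : 𝓢(R3, ℝ)) : 𝓢(R3, ℝ)) x • e k := by
  have h : ∀ (s : 𝓢(R3, ℝ)) (v : R3), (Δ (fun y => s y • v)) x = (Δ s : 𝓢(R3, ℝ)) x • v := by
    intro s v
    have h1 := ContDiffAt.laplacian_CLM_comp_left (l := ContinuousLinearMap.toSpanSingleton ℝ v)
      (s.contDiffAt (x := x) 2)
    rw [SchwartzMap.laplacian_apply]
    exact h1
  have hs : ∀ (s : 𝓢(R3, ℝ)) (v : R3), ContDiffAt ℝ 2 (fun y => s y • v) x := fun s v =>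
    (s.contDiffAt (x := x) 2).smul contDiffAt_const
  have h2 := ContDiffAt.laplacian_sub (hs (∂_{e k} ψ) (e l)) (hs (∂_{e l} ψ) (e k))
  rw [h, h] at h2
  exact h2

/-- The weight `(1 + |ξ|²)⁻³`. -/
def rhoR (ξ : R3) : ℝ := (1 + ‖ξ‖ ^ 2) ^ (-3 : ℝ)

/-- The weight `(1 + |ξ|²)³`. -/
def rhoInvR (ξ : R3) : ℝ := (1 + ‖ξ‖ ^ 2) ^ (3 : ℝ)

lemma rhoR_pos (ξ : R3) : 0 < rhoR ξ := by unfold rhoR; positivity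

lemma rhoR_mul_rhoInvR (ξ : R3) : rhoR ξ * rhoInvR ξ = 1 := by
  unfold rhoR rhoInvR
  rw [← Real.rpow_add (by positivity)]
  norm_num

lemma rhoR_eq (ξ : R3) : rhoR ξ = ((1 + ‖ξ‖ ^ 2) ^ 3)⁻¹ := by
  rw [rhoR, Real.rpow_neg (by positivity)]
  norm_cast

lemma measurable_rhoR : Measurable rhoR := by
  unfold rhoR
  fun_prop

/-- Multiplication of Schwartz functions by `(1 + |ξ|²)⁻³`. -/
def rhoS : 𝓢(R3, ℂ) →L[ℂ] 𝓢(R3, ℂ) := SchwartzMap.smulLeftCLM ℂ (fun ξ => (rhoR ξ : ℂ))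

/-- Multiplication of Schwartz functions by `(1 + |ξ|²)³`. -/
def rhoInvS : 𝓢(R3, ℂ) →L[ℂ] 𝓢(R3, ℂ) := SchwartzMap.smulLeftCLM ℂ (fun ξ => (rhoInvR ξ : ℂ))

lemma rhoS_apply (h : 𝓢(R3, ℂ)) (ξ : R3) : rhoS h ξ = rhoR ξ * h ξ :=
  SchwartzMap.smulLeftCLM_apply_apply ((Complex.ofRealCLM.hasTemperateGrowth).comp
    (Function.hasTemperateGrowth_one_add_norm_sq_rpow (H := R3) (-3))) h ξ

lemma rhoInvS_apply (h : 𝓢(R3, ℂ)) (ξ : R3) : rhoInvS h ξ = rhoInvR ξ * h ξ :=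
  SchwartzMap.smulLeftCLM_apply_apply ((Complex.ofRealCLM.hasTemperateGrowth).comp
    (Function.hasTemperateGrowth_one_add_norm_sq_rpow (H := R3) 3)) h ξ

lemma rhoS_rhoInvS (h : 𝓢(R3, ℂ)) : rhoS (rhoInvS h) = h := by
  ext ξ
  rw [rhoS_apply, rhoInvS_apply, ← mul_assoc, ← Complex.ofReal_mul, rhoR_mul_rhoInvR]
  simp

lemma rhoInvS_rhoS (h : 𝓢(R3, ℂ)) : rhoInvS (rhoS h) = h := by
  ext ξ
  rw [rhoInvS_apply, rhoS_apply, ← mul_assoc, ← Complex.ofReal_mul, mul_comm (rhoInvR ξ),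
    rhoR_mul_rhoInvR]
  simp

/-- The symbol of the Laplacian. -/
def lam (ξ : R3) : ℂ := ∑ j, sig j ξ * sig j ξ

lemma lam_eq (ξ : R3) : lam ξ = -(4 * Real.pi ^ 2 * ‖ξ‖ ^ 2 : ℝ) := by
  unfold lam sig
  rw [EuclideanSpace.real_norm_sq_eq]
  push_cast
  rw [Finset.mul_sum, ← Finset.sum_neg_distrib]
  refine Finset.sum_congr rfl fun j _ => ?_
  ring_nf
  simp

lemma measurable_sig (k : Fin 3) : Measurable (sig k) := by
  unfold sig
  fun_prop

lemma measurable_lam : Measurable lam := by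
  unfold lam
  have := measurable_sig
  fun_prop

lemma norm_sig_le (k : Fin 3) (ξ : R3) : ‖sig k ξ‖ ≤ 2 * Real.pi * ‖ξ‖ := by
  have h : |ξ k| ≤ ‖ξ‖ := by simpa using PiLp.norm_apply_le ξ k
  rw [sig]
  simp only [norm_mul, norm_neg, Complex.norm_ofNat, Complex.norm_real, Complex.norm_I, mul_one,
    Real.norm_eq_abs, abs_of_pos Real.pi_pos]
  gcongr

lemma norm_lam (ξ : R3) : ‖lam ξ‖ = 4 * Real.pi ^ 2 * ‖ξ‖ ^ 2 := by
  rw [lam_eq, norm_neg, Complex.norm_real, Real.norm_of_nonneg (by positivity)]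

/-- The weighted symbol of a derivative. -/
def rhoSig (k : Fin 3) (ξ : R3) : ℂ := rhoR ξ * sig k ξ

/-- The weighted symbol of a derivative of the Laplacian. -/
def rhoSigLam (k : Fin 3) (ξ : R3) : ℂ := rhoR ξ * sig k ξ * lam ξ

/-- The weighted symbol of a second derivative. -/
def rhoSigSig (j k : Fin 3) (ξ : R3) : ℂ := rhoR ξ * sig j ξ * sig k ξ

lemma memLp_rhoSig (k : Fin 3) : MemLp (rhoSig k) ∞ volume := by
  have := measurable_sig
  have := measurable_rhoR
  refine memLp_infty_of_bound (by unfold rhoSig; fun_prop) (2 * Real.pi) fun ξ => ?_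
  rw [rhoSig, norm_mul, Complex.norm_real, Real.norm_of_nonneg (rhoR_pos ξ).le, rhoR_eq,
    inv_mul_le_iff₀ (by positivity)]
  refine (norm_sig_le k ξ).trans ?_
  have h0 := norm_nonneg ξ
  have : ‖ξ‖ ≤ (1 + ‖ξ‖ ^ 2) ^ 3 := by
    have h1 : ‖ξ‖ ≤ 1 + ‖ξ‖ ^ 2 := by nlinarith [sq_nonneg (‖ξ‖ - 1)]
    exact h1.trans (le_self_pow₀ (by nlinarith) (by norm_num))
  nlinarith [Real.pi_pos]

lemma memLp_rhoSigLam (k : Fin 3) : MemLp (rhoSigLam k) ∞ volume := by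
  have := measurable_sig
  have := measurable_rhoR
  have := measurable_lam
  refine memLp_infty_of_bound (by unfold rhoSigLam; fun_prop) (8 * Real.pi ^ 3) fun ξ => ?_
  rw [rhoSigLam, norm_mul, norm_mul, Complex.norm_real, Real.norm_of_nonneg (rhoR_pos ξ).le,
    rhoR_eq, mul_assoc, inv_mul_le_iff₀ (by positivity), norm_lam]
  have h0 := norm_nonneg ξ
  have h2 : ‖ξ‖ * ‖ξ‖ ^ 2 ≤ (1 + ‖ξ‖ ^ 2) ^ 3 := by
    have h1 : ‖ξ‖ ≤ 1 + ‖ξ‖ ^ 2 := by nlinarith [sq_nonneg (‖ξ‖ - 1)]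
    calc ‖ξ‖ * ‖ξ‖ ^ 2 ≤ (1 + ‖ξ‖ ^ 2) * (1 + ‖ξ‖ ^ 2) ^ 2 := by
          gcongr
      _ = _ := by ring
  calc ‖sig k ξ‖ * (4 * Real.pi ^ 2 * ‖ξ‖ ^ 2)
      ≤ (2 * Real.pi * ‖ξ‖) * (4 * Real.pi ^ 2 * ‖ξ‖ ^ 2) := by
        gcongr
        exact norm_sig_le k ξ
    _ = 8 * Real.pi ^ 3 * (‖ξ‖ * ‖ξ‖ ^ 2) := by ring
    _ ≤ 8 * Real.pi ^ 3 * (1 + ‖ξ‖ ^ 2) ^ 3 := by gcongr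
    _ = _ := by ring

/-- The squared symbol is dominated by (1 + |ξ|²)⁻⁴, integrable in dimension 3. The weight thus
makes the nonlinear symbol square-integrable, as `convOp` needs, and it also keeps the cubic symbol
`rhoSigLam` bounded. -/
lemma memLp_rhoSigSig (j k : Fin 3) : MemLp (rhoSigSig j k) 2 volume := by
  have := measurable_sig
  have := measurable_rhoR
  have hm : Measurable (rhoSigSig j k) := by unfold rhoSigSig; fun_prop
  rw [memLp_two_iff_integrable_sq_norm hm.aestronglyMeasurable]
  have hi := (integrable_rpow_neg_one_add_norm_sq (E := R3) (μ := volume) (r := 8) (by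
    simp; norm_num)).const_mul (16 * Real.pi ^ 4)
  refine hi.mono' (by fun_prop) (Eventually.of_forall fun ξ => ?_)
  have e8 : ((1 : ℝ) + ‖ξ‖ ^ 2) ^ (-(8 : ℝ) / 2) = ((1 + ‖ξ‖ ^ 2) ^ 4)⁻¹ := by
    rw [show (-(8 : ℝ) / 2) = -4 by norm_num, Real.rpow_neg (by positivity)]
    norm_cast
  rw [e8, Real.norm_of_nonneg (by positivity), rhoSigSig, norm_mul, norm_mul, Complex.norm_real,
    Real.norm_of_nonneg (rhoR_pos ξ).le, rhoR_eq]
  have h1 := norm_sig_le j ξ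
  have h2 := norm_sig_le k ξ
  have h3 : ‖sig j ξ‖ * ‖sig k ξ‖ ≤ 4 * Real.pi ^ 2 * (1 + ‖ξ‖ ^ 2) := by
    calc ‖sig j ξ‖ * ‖sig k ξ‖ ≤ (2 * Real.pi * ‖ξ‖) * (2 * Real.pi * ‖ξ‖) := by gcongr
      _ = 4 * Real.pi ^ 2 * ‖ξ‖ ^ 2 := by ring
      _ ≤ _ := by gcongr; linarith
  calc (((1 + ‖ξ‖ ^ 2) ^ 3)⁻¹ * ‖sig j ξ‖ * ‖sig k ξ‖) ^ 2
      = (((1 + ‖ξ‖ ^ 2) ^ 3)⁻¹ * (‖sig j ξ‖ * ‖sig k ξ‖)) ^ 2 := by ring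
    _ ≤ (((1 + ‖ξ‖ ^ 2) ^ 3)⁻¹ * (4 * Real.pi ^ 2 * (1 + ‖ξ‖ ^ 2))) ^ 2 := by gcongr
    _ = 16 * Real.pi ^ 4 * ((1 + ‖ξ‖ ^ 2) ^ 4)⁻¹ := by
        field_simp
        ring

/-- The weighted vorticity `(k, l)`. -/
def vort (k l : Fin 3) (x : Fin 3 → L2C) : L2C :=
  mulOp (rhoSig k) (x l) - mulOp (rhoSig l) (x k)

/-- The Laplacian of the weighted vorticity. -/
def vortLam (k l : Fin 3) (x : Fin 3 → L2C) : L2C :=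
  mulOp (rhoSigLam k) (x l) - mulOp (rhoSigLam l) (x k)

/-- The nonlinear term of the weighted vorticity equation. -/
def vortN (k l : Fin 3) (x : Fin 3 → L2C) : L2C :=
  ∑ j, (convOp (rhoSigSig j k) (x j) (x l) - convOp (rhoSigSig j l) (x j) (x k))

/-- The Fourier transform of a vector field. -/
def hat (f : Field3) (i : Fin 3) : L2C := hatL i f

lemma pairL_mulOp {m : R3 → ℂ} (hm : MemLp m ∞ volume) (g h : 𝓢(R3, ℂ))
    (hg : ∀ ξ, m ξ * h ξ = g ξ) (a : L2C) : pairL h (mulOp m a) = pairL g a := by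
  rw [pairL_apply, pairL_apply]
  refine integral_congr_ae ?_
  filter_upwards [coeFn_mulOp hm a] with ξ hξ
  rw [hξ, ← hg]
  ring

lemma integral_schwartz_mul_coord (s : 𝓢(R3, ℝ)) (g : 𝓢(R3, ℂ)) (hs : toC s = 𝓕 g)
    (f : Field3) (i : Fin 3) : ∫ x, toC s x * component f i x = pairL g (hat f i) := by
  rw [hat, hatL_apply, pairL_fourier, ← hs, pairL_apply]

lemma ofReal_integral_inner_curl (s t : 𝓢(R3, ℝ)) (f : Field3) (k l : Fin 3) :
    ((∫ x, inner ℝ (f x) (s x • e l - t x • e k) : ℝ) : ℂ) =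
      (∫ x, toC s x * component f l x) - ∫ x, toC t x * component f k x := by
  rw [← integral_sub (integrable_schwartz_mul _ _) (integrable_schwartz_mul _ _),
    ← integral_complex_ofReal]
  refine integral_congr_ae ?_
  filter_upwards [coeFn_component f k, coeFn_component f l] with x h1 h2
  rw [h1, h2, inner_sub_right, inner_smul_right, inner_smul_right, inner_e, inner_e, toC_apply,
    toC_apply]
  push_cast
  rfl

/-- With ψ the Fourier transform of the weighted function `rhoS h`, derivatives of ψ become
multiplications of `rhoS h` by symbols, and weight and symbol move together onto the field.
`weak_laplacian` and `weak_nonlinear` treat the other two terms of the weak formulation in the same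
way. -/
lemma weak_time (k l : Fin 3) (ψ : 𝓢(R3, ℝ)) (h : 𝓢(R3, ℂ)) (hψ : toC ψ = 𝓕 (rhoS h))
    (f : Field3) :
    ((∫ x, inner ℝ (f x) (curlField k l ψ x) : ℝ) : ℂ) = pairL h (vort k l (hat f)) := by
  have hd : ∀ k, toC (∂_{e k} ψ) = 𝓕 (sigS k (rhoS h)) := fun k => by
    rw [← lineDeriv_toC, hψ, lineDeriv_fourier]
  have hp : ∀ k i, pairL h (mulOp (rhoSig k) (hat f i)) = pairL (sigS k (rhoS h)) (hat f i) :=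
    fun k i => pairL_mulOp (memLp_rhoSig k) _ _ (fun ξ => by
      rw [sigS_apply, rhoS_apply, rhoSig]; ring) _
  unfold curlField vort
  rw [ofReal_integral_inner_curl, integral_schwartz_mul_coord _ _ (hd k),
    integral_schwartz_mul_coord _ _ (hd l), map_sub, hp, hp]

/-- The Laplacian on the Fourier side. -/
def lamS (g : 𝓢(R3, ℂ)) : 𝓢(R3, ℂ) := ∑ j, sigS j (sigS j g)

lemma lamS_apply (g : 𝓢(R3, ℂ)) (ξ : R3) : lamS g ξ = lam ξ * g ξ := by
  rw [lamS, sum_apply, lam, Finset.sum_mul]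
  refine Finset.sum_congr rfl fun j _ => ?_
  rw [sigS_apply, sigS_apply]
  ring

lemma toC_laplacian (s : 𝓢(R3, ℝ)) (g : 𝓢(R3, ℂ)) (hs : toC s = 𝓕 g) :
    toC (Δ s) = 𝓕 (lamS g) := by
  have hb : ∀ j, EuclideanSpace.basisFun (Fin 3) ℝ j = e j := fun j => by
    simp [e]
  rw [SchwartzMap.laplacian_eq_sum (EuclideanSpace.basisFun (Fin 3) ℝ)]
  have h1 : toC (∑ j, ∂_{e j} (∂_{e j} s)) = ∑ j, toC (∂_{e j} (∂_{e j} s)) :=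
    map_sum (SchwartzMap.postcompCLM (E := R3) Complex.ofRealCLM) _ _
  have h2 : (𝓕 (lamS g) : 𝓢(R3, ℂ)) = ∑ j, 𝓕 (sigS j (sigS j g)) :=
    map_sum (FourierTransform.fourierCLM ℂ 𝓢(R3, ℂ)) _ _
  simp only [hb]
  rw [h1, h2]
  refine Finset.sum_congr rfl fun j _ => ?_
  rw [← lineDeriv_toC, ← lineDeriv_toC, hs, lineDeriv_fourier, lineDeriv_fourier]

lemma weak_laplacian (k l : Fin 3) (ψ : 𝓢(R3, ℝ)) (h : 𝓢(R3, ℂ)) (hψ : toC ψ = 𝓕 (rhoS h))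
    (f : Field3) :
    ((∫ x, inner ℝ (f x) ((Δ (curlField k l ψ)) x) : ℝ) : ℂ) = pairL h (vortLam k l (hat f)) := by
  have hd : ∀ k, toC (Δ (∂_{e k} ψ : 𝓢(R3, ℝ))) = 𝓕 (lamS (sigS k (rhoS h))) := fun k => by
    apply toC_laplacian
    rw [← lineDeriv_toC, hψ, lineDeriv_fourier]
  have hp : ∀ k i, pairL h (mulOp (rhoSigLam k) (hat f i)) =
      pairL (lamS (sigS k (rhoS h))) (hat f i) :=
    fun k i => pairL_mulOp (memLp_rhoSigLam k) _ _ (fun ξ => by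
      rw [lamS_apply, sigS_apply, rhoS_apply, rhoSigLam]; ring) _
  unfold vortLam
  simp only [laplacian_curlField]
  rw [ofReal_integral_inner_curl, integral_schwartz_mul_coord _ _ (hd k),
    integral_schwartz_mul_coord _ _ (hd l), map_sub, hp, hp]

lemma integrable_schwartz_mul_mul (φ : 𝓢(R3, ℂ)) (f₁ f₂ : L2C) :
    Integrable (fun x => φ x * (f₁ x * f₂ x)) :=
  ((Lp.memLp f₁).integrable_mul (Lp.memLp f₂)).bdd_mul φ.continuous.aestronglyMeasurable
    (Eventually.of_forall fun x => SchwartzMap.norm_le_seminorm ℝ φ x)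

lemma weak_nonlinear (k l : Fin 3) (ψ : 𝓢(R3, ℝ)) (h : 𝓢(R3, ℂ)) (hψ : toC ψ = 𝓕 (rhoS h))
    (f : Field3) :
    ((∫ x, inner ℝ (fderiv ℝ (curlField k l ψ) x (f x)) (f x) : ℝ) : ℂ) =
      pairL h (vortN k l (hat f)) := by
  have hd : ∀ j k, toC (∂_{e j} (∂_{e k} ψ : 𝓢(R3, ℝ))) = 𝓕 (sigS j (sigS k (rhoS h))) :=
    fun j k => by
      rw [← lineDeriv_toC, ← lineDeriv_toC, hψ, lineDeriv_fourier, lineDeriv_fourier]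
  have hp : ∀ j k i, pairL h (convOp (rhoSigSig j k) (hat f j) (hat f i)) =
      ∫ x, toC (∂_{e j} (∂_{e k} ψ : 𝓢(R3, ℝ))) x * (component f j x * component f i x) := by
    intro j k i
    rw [hat, hat, hatL_apply, hatL_apply, hd]
    exact pairL_convOp (memLp_rhoSigSig j k) (sigS j (sigS k (rhoS h))) h (fun ξ => by
      rw [sigS_apply, sigS_apply, rhoS_apply, rhoSigSig]; ring) _ _
  have hi := fun j k i => integrable_schwartz_mul_mul
    (toC (∂_{e j} (∂_{e k} ψ : 𝓢(R3, ℝ)))) (component f j) (component f i)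
  unfold vortN
  rw [map_sum]
  simp only [map_sub, hp]
  have hs : ∀ j, Integrable (fun x =>
      toC (∂_{e j} (∂_{e k} ψ : 𝓢(R3, ℝ))) x * (component f j x * component f l x) -
        toC (∂_{e j} (∂_{e l} ψ : 𝓢(R3, ℝ))) x * (component f j x * component f k x)) :=
    fun j => (hi j k l).sub (hi j l k)
  rw [← Finset.sum_congr rfl fun j _ => integral_sub (hi j k l) (hi j l k),
    ← integral_finsetSum _ fun j _ => hs j, ← integral_complex_ofReal]
  refine integral_congr_ae ?_
  filter_upwards [ae_all_iff.mpr fun k => coeFn_component f k] with x hx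
  have hv : ∀ s : 𝓢(R3, ℝ), (∂_{f x} s : 𝓢(R3, ℝ)) x =
      ∑ j, f x j * (∂_{e j} s : 𝓢(R3, ℝ)) x := by
    intro s
    simp only [SchwartzMap.lineDerivOp_apply_eq_fderiv]
    conv_lhs => rw [sum_coord (f x)]
    rw [map_sum]
    simp
  rw [fderiv_curlField, hv, hv, inner_sub_left, real_inner_smul_left, real_inner_smul_left,
    real_inner_comm, inner_e, real_inner_comm, inner_e, Finset.sum_mul, Finset.sum_mul,
    ← Finset.sum_sub_distrib]
  push_cast
  refine Finset.sum_congr rfl fun j _ => ?_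
  rw [hx, hx, hx, toC_apply, toC_apply]
  ring

end OscNS

end

/-! ### The truncated Leray-projected equation and its curl and divergence. -/

noncomputable section

namespace OscNS

open scoped SchwartzMap LineDeriv ComplexConjugate
open Filter Topology

/-- The indicator function of the ball of radius `R`. -/
def chi (R : ℝ) (ξ : R3) : ℂ := if ‖ξ‖ ≤ R then 1 else 0

lemma measurable_chi (R : ℝ) : Measurable (chi R) :=
  Measurable.ite (measurableSet_le measurable_norm measurable_const) measurable_const
    measurable_const

lemma norm_chi_le (R : ℝ) (ξ : R3) : ‖chi R ξ‖ ≤ 1 := by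
  unfold chi
  split_ifs <;> simp

lemma chi_mul_chi (R : ℝ) (ξ : R3) : chi R ξ * chi R ξ = chi R ξ := by
  unfold chi
  split_ifs <;> simp

lemma norm_chi_mul_le {R : ℝ} {m : R3 → ℂ} {C : ℝ} (hC : 0 ≤ C) {ξ : R3}
    (h : ‖ξ‖ ≤ R → ‖m ξ‖ ≤ C) : ‖chi R ξ * m ξ‖ ≤ C := by
  unfold chi
  split_ifs with hξ
  · simpa using h hξ
  · simpa using hC

lemma memLp_chi (R : ℝ) : MemLp (chi R) ∞ volume :=
  memLp_infty_of_bound (measurable_chi R) 1 (norm_chi_le R)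

lemma memLp_chi_two (R : ℝ) : MemLp (chi R) 2 volume := by
  have h : chi R = (Metric.closedBall (0 : R3) R).indicator fun _ => (1 : ℂ) := by
    ext ξ
    simp [chi, Set.indicator]
  rw [h]
  exact memLp_indicator_const 2 measurableSet_closedBall 1
    (Or.inr (measure_closedBall_lt_top).ne)

/-- The symbol of the Leray projection. -/
def leray (i m : Fin 3) (ξ : R3) : ℂ := (if i = m then 1 else 0) - ((ξ i * ξ m / ‖ξ‖ ^ 2 : ℝ) : ℂ)

lemma measurable_leray (i m : Fin 3) : Measurable (leray i m) := by
  unfold leray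
  fun_prop

lemma abs_coord_le (ξ : R3) (k : Fin 3) : |ξ k| ≤ ‖ξ‖ := by
  simpa using PiLp.norm_apply_le ξ k

lemma norm_leray_le (i m : Fin 3) (ξ : R3) : ‖leray i m ξ‖ ≤ 2 := by
  have h1 : ‖(if i = m then (1 : ℂ) else 0)‖ ≤ 1 := by split_ifs <;> simp
  have h2 : ‖((ξ i * ξ m / ‖ξ‖ ^ 2 : ℝ) : ℂ)‖ ≤ 1 := by
    rw [Complex.norm_real, Real.norm_eq_abs, abs_div, abs_mul, abs_of_nonneg (sq_nonneg ‖ξ‖)]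
    refine div_le_one_of_le₀ ?_ (sq_nonneg _)
    rw [sq]
    exact mul_le_mul (abs_coord_le ξ i) (abs_coord_le ξ m) (abs_nonneg _) (norm_nonneg _)
  calc ‖leray i m ξ‖ ≤ 1 + 1 := (norm_sub_le _ _).trans (add_le_add h1 h2)
    _ = 2 := by norm_num

lemma norm_sq_eq_sum (ξ : R3) : ((‖ξ‖ ^ 2 : ℝ) : ℂ) = ∑ k, (ξ k : ℂ) * ξ k := by
  rw [EuclideanSpace.real_norm_sq_eq]
  push_cast
  exact Finset.sum_congr rfl fun k _ => by ring

lemma sum_coord_mul_leray (m : Fin 3) (ξ : R3) : ∑ k, (ξ k : ℂ) * leray k m ξ = 0 := by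
  rcases eq_or_ne ξ 0 with rfl | h
  · simp
  have h2 : ((‖ξ‖ ^ 2 : ℝ) : ℂ) ≠ 0 := by
    simp [h]
  have : ∑ k, (ξ k : ℂ) * leray k m ξ =
      ∑ k, (if k = m then (ξ k : ℂ) else 0) - (∑ k, (ξ k : ℂ) * ξ k) * ξ m / (‖ξ‖ ^ 2 : ℝ) := by
    rw [Finset.sum_mul, Finset.sum_div, ← Finset.sum_sub_distrib]
    refine Finset.sum_congr rfl fun k _ => ?_
    unfold leray
    push_cast
    split_ifs <;> ring
  rw [this, ← norm_sq_eq_sum, mul_div_cancel_left₀ _ h2]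
  simp

lemma sum_sig_mul_leray (m : Fin 3) (ξ : R3) : ∑ k, sig k ξ * leray k m ξ = 0 := by
  have h : ∑ k, sig k ξ * leray k m ξ =
      -(2 * Real.pi * Complex.I) * ∑ k, (ξ k : ℂ) * leray k m ξ := by
    rw [Finset.mul_sum]
    exact Finset.sum_congr rfl fun k _ => by unfold sig; ring
  rw [h, sum_coord_mul_leray, mul_zero]

/-- The truncated symbol of the Laplacian. -/
def chiLam (R : ℝ) (ξ : R3) : ℂ := chi R ξ * lam ξ

/-- The truncated symbol of the nonlinearity. -/
def symN (R : ℝ) (i m j : Fin 3) (ξ : R3) : ℂ := chi R ξ * (sig j ξ * leray i m ξ)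

lemma memLp_chiLam (R : ℝ) : MemLp (chiLam R) ∞ volume := by
  refine memLp_infty_of_bound ((measurable_chi R).mul measurable_lam) (4 * Real.pi ^ 2 * R ^ 2)
    fun ξ => norm_chi_mul_le (by positivity) fun h => ?_
  rw [norm_lam]
  gcongr

lemma memLp_symN (R : ℝ) (i m j : Fin 3) : MemLp (symN R i m j) 2 volume := by
  have hm : Measurable fun ξ => chi R ξ * (sig j ξ * leray i m ξ) :=
    (measurable_chi R).mul ((measurable_sig j).mul (measurable_leray i m))
  have hR : MemLp (fun ξ => chi R ξ * (sig j ξ * leray i m ξ)) ∞ volume := by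
    have hC : 0 ≤ 2 * Real.pi * |R| * 2 := by
      have := abs_nonneg R
      positivity
    refine memLp_infty_of_bound hm (2 * Real.pi * |R| * 2) fun ξ =>
      norm_chi_mul_le (m := fun ξ => sig j ξ * leray i m ξ) hC fun h => ?_
    rw [norm_mul]
    gcongr
    · exact (norm_sig_le j ξ).trans (by gcongr; exact h.trans (le_abs_self R))
    · exact norm_leray_le i m ξ
  -- The cutoff is idempotent, so a second copy may be inserted; it makes the bounded symbol
  -- square-integrable.
  have h2 := MemLp.mul (p := 2) (q := ∞) (r := 2) hR (memLp_chi_two R)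
  refine (memLp_congr_ae (Eventually.of_forall fun ξ => ?_)).mp h2
  simp only [Pi.mul_apply, symN]
  rw [← mul_assoc, chi_mul_chi]

/-- The truncated Navier-Stokes nonlinearity on the Fourier side. -/
def nonlin (R : ℝ) (x : Fin 3 → L2C) (i : Fin 3) : L2C :=
  ∑ m, ∑ j, convOp (symN R i m j) (x j) (x m)

/-- The truncated right-hand side of the Navier-Stokes equations on the Fourier side. -/
def drift (R β : ℝ) (x : Fin 3 → L2C) (i : Fin 3) : L2C :=
  mulOp (chiLam R) (x i) + (β : ℂ) • nonlin R x i

lemma coeFn_nonlin (R : ℝ) (x : Fin 3 → L2C) (i : Fin 3) : ∀ᵐ ξ, nonlin R x i ξ =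
    ∑ m, ∑ j, chi R ξ * (sig j ξ * leray i m ξ) * convFun (x j) (x m) ξ := by
  have h1 := ae_all_iff.mpr fun m => ae_all_iff.mpr fun j =>
    coeFn_convOp (memLp_symN R i m j) (x j) (x m)
  have h2 := ae_all_iff.mpr fun m =>
    Lp.coeFn_finsetSum Finset.univ fun j => convOp (symN R i m j) (x j) (x m)
  filter_upwards [h1, h2, Lp.coeFn_finsetSum Finset.univ fun m =>
    ∑ j, convOp (symN R i m j) (x j) (x m)] with ξ h1 h2 h3
  rw [nonlin, h3, Finset.sum_apply]
  refine Finset.sum_congr rfl fun m _ => ?_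
  rw [h2, Finset.sum_apply]
  refine Finset.sum_congr rfl fun j _ => ?_
  rw [h1, symN]

lemma coeFn_drift (R β : ℝ) (x : Fin 3 → L2C) (i : Fin 3) : ∀ᵐ ξ, drift R β x i ξ =
    chi R ξ * lam ξ * x i ξ + β * ∑ m, ∑ j, chi R ξ * (sig j ξ * leray i m ξ) *
      convFun (x j) (x m) ξ := by
  filter_upwards [Lp.coeFn_add (mulOp (chiLam R) (x i)) ((β : ℂ) • nonlin R x i),
    coeFn_mulOp (memLp_chiLam R) (x i), Lp.coeFn_smul (β : ℂ) (nonlin R x i),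
    coeFn_nonlin R x i] with ξ h1 h2 h3 h4
  rw [drift, h1, Pi.add_apply, h2, h3, Pi.smul_apply, h4, chiLam, smul_eq_mul]

lemma coeFn_vortLam (k l : Fin 3) (x : Fin 3 → L2C) : ∀ᵐ ξ, vortLam k l x ξ =
    rhoR ξ * lam ξ * (sig k ξ * x l ξ - sig l ξ * x k ξ) := by
  filter_upwards [Lp.coeFn_sub (mulOp (rhoSigLam k) (x l)) (mulOp (rhoSigLam l) (x k)),
    coeFn_mulOp (memLp_rhoSigLam k) (x l), coeFn_mulOp (memLp_rhoSigLam l) (x k)] with ξ h1 h2 h3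
  rw [vortLam, h1, Pi.sub_apply, h2, h3, rhoSigLam, rhoSigLam]
  ring

lemma coeFn_vortN (k l : Fin 3) (x : Fin 3 → L2C) : ∀ᵐ ξ, vortN k l x ξ =
    ∑ j, rhoR ξ * sig j ξ *
      (sig k ξ * convFun (x j) (x l) ξ - sig l ξ * convFun (x j) (x k) ξ) := by
  filter_upwards [Lp.coeFn_finsetSum Finset.univ fun j =>
      (convOp (rhoSigSig j k) (x j) (x l) - convOp (rhoSigSig j l) (x j) (x k)),
    ae_all_iff.mpr fun j => Lp.coeFn_sub (convOp (rhoSigSig j k) (x j) (x l))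
      (convOp (rhoSigSig j l) (x j) (x k)),
    ae_all_iff.mpr fun j => coeFn_convOp (memLp_rhoSigSig j k) (x j) (x l),
    ae_all_iff.mpr fun j => coeFn_convOp (memLp_rhoSigSig j l) (x j) (x k)] with ξ h1 h2 h3 h4
  rw [vortN, h1, Finset.sum_apply]
  refine Finset.sum_congr rfl fun j _ => ?_
  rw [h2, Pi.sub_apply, h3, h4, rhoSigSig, rhoSigSig]
  ring

/-- The Leray projection differs from the identity by a gradient, which the curl annihilates. -/
lemma sig_mul_leray_sub (k l m : Fin 3) (ξ : R3) :
    sig k ξ * leray l m ξ - sig l ξ * leray k m ξ =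
      (if l = m then sig k ξ else 0) - if k = m then sig l ξ else 0 := by
  unfold leray sig
  push_cast
  split_ifs <;> ring

/-- The pressure disappears under the curl, so the projected equation and the one tested with curl
fields have the same vorticity. -/
lemma vort_drift (R β : ℝ) (x : Fin 3 → L2C) (k l : Fin 3) :
    mulOp (rhoSig k) (drift R β x l) - mulOp (rhoSig l) (drift R β x k) =
      mulOp (chi R) (vortLam k l x + (β : ℂ) • vortN k l x) := by
  apply Lp.ext
  filter_upwards [Lp.coeFn_sub (mulOp (rhoSig k) (drift R β x l))
      (mulOp (rhoSig l) (drift R β x k)),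
    coeFn_mulOp (memLp_rhoSig k) (drift R β x l), coeFn_mulOp (memLp_rhoSig l) (drift R β x k),
    coeFn_drift R β x l, coeFn_drift R β x k,
    coeFn_mulOp (memLp_chi R) (vortLam k l x + (β : ℂ) • vortN k l x),
    Lp.coeFn_add (vortLam k l x) ((β : ℂ) • vortN k l x), Lp.coeFn_smul (β : ℂ) (vortN k l x),
    coeFn_vortLam k l x, coeFn_vortN k l x] with ξ h1 h2 h3 h4 h5 h6 h7 h8 h9 h10
  rw [h1, Pi.sub_apply, h2, h3, h4, h5, h6, h7, Pi.add_apply, h8, Pi.smul_apply, h9, h10,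
    smul_eq_mul, rhoSig, rhoSig]
  have key : sig k ξ * (∑ m, ∑ j, chi R ξ * (sig j ξ * leray l m ξ) * convFun (x j) (x m) ξ) -
      sig l ξ * (∑ m, ∑ j, chi R ξ * (sig j ξ * leray k m ξ) * convFun (x j) (x m) ξ) =
      chi R ξ * ∑ j, sig j ξ *
        (sig k ξ * convFun (x j) (x l) ξ - sig l ξ * convFun (x j) (x k) ξ) := by
    rw [Finset.sum_comm, Finset.sum_comm (f := fun m j => chi R ξ * (sig j ξ * leray k m ξ) *
      convFun (x j) (x m) ξ), Finset.mul_sum, Finset.mul_sum, Finset.mul_sum,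
      ← Finset.sum_sub_distrib]
    refine Finset.sum_congr rfl fun j _ => ?_
    rw [Finset.mul_sum, Finset.mul_sum, ← Finset.sum_sub_distrib]
    have : ∀ m, sig k ξ * (chi R ξ * (sig j ξ * leray l m ξ) * convFun (x j) (x m) ξ) -
        sig l ξ * (chi R ξ * (sig j ξ * leray k m ξ) * convFun (x j) (x m) ξ) =
        (if l = m then chi R ξ * sig j ξ * sig k ξ * convFun (x j) (x m) ξ else 0) -
        (if k = m then chi R ξ * sig j ξ * sig l ξ * convFun (x j) (x m) ξ else 0) := by
      intro m
      have h := sig_mul_leray_sub k l m ξ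
      calc _ = chi R ξ * sig j ξ * convFun (x j) (x m) ξ *
            (sig k ξ * leray l m ξ - sig l ξ * leray k m ξ) := by ring
        _ = _ := by rw [h]; split_ifs <;> ring
    simp only [this, Finset.sum_sub_distrib, Finset.sum_ite_eq, Finset.mem_univ, if_true]
    ring
  have e1 : ∑ j, (rhoR ξ : ℂ) * sig j ξ *
      (sig k ξ * convFun (x j) (x l) ξ - sig l ξ * convFun (x j) (x k) ξ) =
      rhoR ξ * ∑ j, sig j ξ *
        (sig k ξ * convFun (x j) (x l) ξ - sig l ξ * convFun (x j) (x k) ξ) := by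
    rw [Finset.mul_sum]
    exact Finset.sum_congr rfl fun j _ => by ring
  rw [e1]
  linear_combination (rhoR ξ * β : ℂ) * key

lemma coeFn_sum_mulOp_rhoSig (d : Fin 3 → L2C) :
    ∀ᵐ ξ, (∑ k, mulOp (rhoSig k) (d k) : L2C) ξ = rhoR ξ * ∑ k, sig k ξ * d k ξ := by
  filter_upwards [Lp.coeFn_finsetSum Finset.univ fun k => mulOp (rhoSig k) (d k),
    ae_all_iff.mpr fun k => coeFn_mulOp (memLp_rhoSig k) (d k)] with ξ h1 h2
  rw [h1, Finset.sum_apply, Finset.mul_sum]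
  refine Finset.sum_congr rfl fun k _ => ?_
  rw [h2, rhoSig, mul_assoc]

/-- The divergence-free condition on the Fourier side. -/
def FDivFree (x : Fin 3 → L2C) : Prop := ∀ᵐ ξ : R3, ∑ k, (ξ k : ℂ) * x k ξ = 0

lemma FDivFree.sum_sig {x : Fin 3 → L2C} (h : FDivFree x) : ∀ᵐ ξ, ∑ k, sig k ξ * x k ξ = 0 := by
  filter_upwards [h] with ξ hξ
  have : ∑ k, sig k ξ * x k ξ = -(2 * Real.pi * Complex.I) * ∑ k, (ξ k : ℂ) * x k ξ := by
    rw [Finset.mul_sum]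
    exact Finset.sum_congr rfl fun k _ => by unfold sig; ring
  rw [this, hξ, mul_zero]

lemma sum_mulOp_drift {x : Fin 3 → L2C} (hx : FDivFree x) (R β : ℝ) :
    ∑ k, mulOp (rhoSig k) (drift R β x k) = 0 := by
  apply Lp.ext
  filter_upwards [coeFn_sum_mulOp_rhoSig (drift R β x), hx.sum_sig,
    ae_all_iff.mpr fun k => coeFn_drift R β x k, Lp.coeFn_zero ℂ 2 volume] with ξ h1 h2 h3 h4
  rw [h1, h4, Pi.zero_apply]
  simp only [h3, mul_add, Finset.sum_add_distrib]
  have e1 : ∑ k, sig k ξ * (chi R ξ * lam ξ * x k ξ) = chi R ξ * lam ξ * ∑ k, sig k ξ * x k ξ := by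
    rw [Finset.mul_sum]
    exact Finset.sum_congr rfl fun k _ => by ring
  have e2 : ∑ k, sig k ξ * ((β : ℂ) * ∑ m, ∑ j, chi R ξ * (sig j ξ * leray k m ξ) *
      convFun (x j) (x m) ξ) = β * ∑ m, ∑ j, chi R ξ * sig j ξ * convFun (x j) (x m) ξ *
        ∑ k, sig k ξ * leray k m ξ := by
    simp only [Finset.mul_sum]
    rw [Finset.sum_comm]
    refine Finset.sum_congr rfl fun m _ => ?_
    rw [Finset.sum_comm]
    refine Finset.sum_congr rfl fun j _ => Finset.sum_congr rfl fun k _ => ?_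
    ring
  rw [e1, e2, h2]
  simp [sum_sig_mul_leray]

lemma sum_mulOp_chi {x : Fin 3 → L2C} (hx : FDivFree x) (R : ℝ) :
    ∑ k, mulOp (rhoSig k) (mulOp (chi R) (x k)) = 0 := by
  apply Lp.ext
  filter_upwards [coeFn_sum_mulOp_rhoSig fun k => mulOp (chi R) (x k), hx.sum_sig,
    ae_all_iff.mpr fun k => coeFn_mulOp (memLp_chi R) (x k), Lp.coeFn_zero ℂ 2 volume]
    with ξ h1 h2 h3 h4
  rw [h1, h4, Pi.zero_apply]
  have e1 : ∑ k, sig k ξ * (chi R ξ * x k ξ) = chi R ξ * ∑ k, sig k ξ * x k ξ := by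
    rw [Finset.mul_sum]
    exact Finset.sum_congr rfl fun k _ => by ring
  simp only [h3, e1, h2]
  simp

/-- A field is determined by curl and divergence: σ_k d_l = σ_l d_k and ∑ σ_k d_k = 0 give (∑ σ_j²)
d_l = σ_l ∑ σ_j d_j = 0, and ∑ σ_j² vanishes only at the origin. -/
lemma eq_zero_of_vort_div {d : Fin 3 → L2C}
    (h : ∀ k l, mulOp (rhoSig k) (d l) - mulOp (rhoSig l) (d k) = 0)
    (h' : ∑ k, mulOp (rhoSig k) (d k) = 0) (l : Fin 3) : d l = 0 := by
  apply Lp.ext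
  have h0 : ∀ᵐ ξ : R3, ξ ≠ 0 := by
    rw [ae_iff]
    simp
  have hs := coeFn_sum_mulOp_rhoSig d
  rw [h'] at hs
  filter_upwards [hs, h0, ae_all_iff.mpr fun k => coeFn_mulOp (memLp_rhoSig k) (d l),
    ae_all_iff.mpr fun k => coeFn_mulOp (memLp_rhoSig l) (d k), Lp.coeFn_zero ℂ 2 volume]
    with ξ h1 h2 h3 h4 h5
  rw [h5, Pi.zero_apply] at h1 ⊢
  have hr : (rhoR ξ : ℂ) ≠ 0 := by exact_mod_cast (rhoR_pos ξ).ne'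
  have hl : lam ξ ≠ 0 := by
    rw [← norm_pos_iff, norm_lam]
    have := norm_pos_iff.mpr h2
    have := Real.pi_pos
    positivity
  have hd : ∑ k, sig k ξ * d k ξ = 0 := by
    rcases mul_eq_zero.mp h1.symm with h | h
    · exact absurd h hr
    · exact h
  have hv : ∀ k, sig k ξ * d l ξ = sig l ξ * d k ξ := by
    intro k
    have e1 : rhoSig k ξ * d l ξ = rhoSig l ξ * d k ξ := by
      rw [← h3, ← h4, sub_eq_zero.mp (h k l)]
    rw [rhoSig, rhoSig, mul_assoc, mul_assoc] at e1
    exact mul_left_cancel₀ hr e1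
  have : lam ξ * d l ξ = 0 := by
    rw [lam, Finset.sum_mul]
    calc ∑ j, sig j ξ * sig j ξ * d l ξ = ∑ j, sig l ξ * (sig j ξ * d j ξ) := by
          refine Finset.sum_congr rfl fun j _ => ?_
          rw [mul_assoc, hv]
          ring
      _ = 0 := by rw [← Finset.mul_sum, hd, mul_zero]
  exact (mul_eq_zero.mp this).resolve_left hl

end OscNS

end

/-! ### From the weak formulation to an integrated equation in L². -/

noncomputable section

namespace OscNS

open scoped SchwartzMap LineDeriv ComplexConjugate
open Filter Topology

lemma intervalIntegrable_of_memLp {E : Type*} [NormedAddCommGroup E] {T : ℝ} {f : ℝ → E}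
    (hf : MemLp f ∞ (volume.restrict (Ioo 0 T))) {s t : ℝ} (hs : s ∈ Icc 0 T) (ht : t ∈ Icc 0 T) :
    IntervalIntegrable f volume s t := by
  have h1 : IntegrableOn f (Ioo 0 T) := hf.integrable le_top
  rw [← integrableOn_Icc_iff_integrableOn_Ioo] at h1
  rw [intervalIntegrable_iff]
  exact h1.mono_set (uIoc_subset_uIcc.trans (uIcc_subset_Icc hs ht))

variable {b : ℝ → ℝ} {M N T : ℝ} {u₀ : Field3} {u : ℝ → Field3}

lemma IsOscillating.eLpNorm_le (hb : IsOscillating M b) :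
    eLpNorm b ⊤ (volume.restrict (Ioi 0)) ≤ ENNReal.ofReal M :=
  le_self_add.trans (hb.bound 1 2 one_pos one_lt_two)

lemma quasiMeasurePreserving_mul (hN : 0 < N) :
    Measure.QuasiMeasurePreserving (fun τ : ℝ => N * τ) (volume.restrict (Ioo 0 T))
      (volume.restrict (Ioi 0)) := by
  have h : Measure.QuasiMeasurePreserving (fun τ : ℝ => N * τ) volume volume :=
    ⟨by fun_prop, by
      rw [Real.map_volume_mul_left hN.ne']
      exact Measure.smul_absolutelyContinuous⟩
  exact h.restrict fun τ hτ => mul_pos hN hτ.1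

lemma IsOscillating.ae_le (hb : IsOscillating M b) (hM : 0 < M) (hN : 0 < N) :
    ∀ᵐ τ ∂(volume.restrict (Ioo 0 T)), |b (N * τ)| ≤ M := by
  have h : ∀ᵐ τ ∂(volume.restrict (Ioi 0)), |b τ| ≤ M := by
    have h1 := ae_le_eLpNormEssSup (f := b) (μ := volume.restrict (Ioi 0))
    filter_upwards [h1] with τ hτ
    have h2 := hτ.trans hb.eLpNorm_le
    rw [← ofReal_norm, ENNReal.ofReal_le_ofReal_iff hM.le] at h2
    exact h2
  exact (quasiMeasurePreserving_mul hN).ae h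

lemma IsOscillating.memLp (hb : IsOscillating M b) (hM : 0 < M) (hN : 0 < N) :
    MemLp (fun τ => b (N * τ)) ∞ (volume.restrict (Ioo 0 T)) :=
  memLp_top_of_bound (hb.aestronglyMeasurable.comp_quasiMeasurePreserving
    (quasiMeasurePreserving_mul hN)) M (hb.ae_le hM hN)

lemma one_le_sobolev_weight (k : ℕ) (ξ : R3) :
    1 ≤ ENNReal.ofReal ((1 + (2 * Real.pi * ‖ξ‖) ^ 2) ^ k) := by
  rw [← ENNReal.ofReal_one]
  exact ENNReal.ofReal_le_ofReal (one_le_pow₀ (by nlinarith [sq_nonneg (2 * Real.pi * ‖ξ‖)]))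

lemma enorm_hat_le_sobNorm (k : ℕ) (f : Field3) (i : Fin 3) : ‖hat f i‖ₑ ≤ sobNorm k f := by
  rw [enorm_eq_l2, l2, sobNorm]
  gcongr
  refine le_trans (lintegral_mono fun ξ => ?_) (Finset.single_le_sum
    (f := fun i => ∫⁻ ξ : R3, ENNReal.ofReal ((1 + (2 * Real.pi * ‖ξ‖) ^ 2) ^ k) *
      ‖𝓕 (component f i) ξ‖ₑ ^ 2) (fun _ _ => zero_le) (Finset.mem_univ i))
  exact le_mul_of_one_le_left zero_le (one_le_sobolev_weight k ξ)

lemma IsSolution.memLp_hat (hS : IsSolution b N u₀ T u) (i : Fin 3) :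
    MemLp (fun t => hat (u t) i) ∞ (volume.restrict (Ioo 0 T)) := by
  refine ⟨(hatL i).continuous.comp_aestronglyMeasurable hS.aestronglyMeasurable, ?_⟩
  rw [eLpNorm_exponent_top]
  refine lt_of_le_of_lt (essSup_mono_ae (Eventually.of_forall fun t => ?_)) hS.mem_Linfty_H2
  exact enorm_hat_le_sobNorm 2 (u t) i

lemma IsSolution.fdivFree (hS : IsSolution b N u₀ T u) :
    ∀ᵐ t ∂(volume.restrict (Ioo 0 T)), FDivFree (hat (u t)) := by
  filter_upwards [hS.divFree] with t ht
  exact hat_divFree ht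

lemma memLp_convOp {m : R3 → ℂ} {x y : ℝ → L2C} (hx : MemLp x ∞ (volume.restrict (Ioo 0 T)))
    (hy : MemLp y ∞ (volume.restrict (Ioo 0 T))) :
    MemLp (fun t => convOp m (x t) (y t)) ∞ (volume.restrict (Ioo 0 T)) :=
  (convOp m).memLp_of_bilin ∞ hx hy

lemma memLp_mulOp {m : R3 → ℂ} {x : ℝ → L2C} (hx : MemLp x ∞ (volume.restrict (Ioo 0 T))) :
    MemLp (fun t => mulOp m (x t)) ∞ (volume.restrict (Ioo 0 T)) :=
  (mulOp m).comp_memLp' hx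

lemma memLp_nonlin (R : ℝ) {x : ℝ → Fin 3 → L2C}
    (hx : ∀ i, MemLp (fun t => x t i) ∞ (volume.restrict (Ioo 0 T))) (i : Fin 3) :
    MemLp (fun t => nonlin R (x t) i) ∞ (volume.restrict (Ioo 0 T)) :=
  memLp_finsetSum _ fun m _ => memLp_finsetSum _ fun j _ => memLp_convOp (hx j) (hx m)

lemma memLp_drift (R : ℝ) {β : ℝ → ℝ} {x : ℝ → Fin 3 → L2C}
    (hβ : MemLp β ∞ (volume.restrict (Ioo 0 T)))
    (hx : ∀ i, MemLp (fun t => x t i) ∞ (volume.restrict (Ioo 0 T))) (i : Fin 3) :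
    MemLp (fun t => drift R (β t) (x t) i) ∞ (volume.restrict (Ioo 0 T)) :=
  (memLp_mulOp (hx i)).add (MemLp.smul (memLp_nonlin R hx i) (hβ.ofReal (K := ℂ)))

lemma memLp_vortLam (k l : Fin 3) {x : ℝ → Fin 3 → L2C}
    (hx : ∀ i, MemLp (fun t => x t i) ∞ (volume.restrict (Ioo 0 T))) :
    MemLp (fun t => vortLam k l (x t)) ∞ (volume.restrict (Ioo 0 T)) :=
  (memLp_mulOp (hx l)).sub (memLp_mulOp (hx k))

lemma memLp_vortN (k l : Fin 3) {x : ℝ → Fin 3 → L2C}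
    (hx : ∀ i, MemLp (fun t => x t i) ∞ (volume.restrict (Ioo 0 T))) :
    MemLp (fun t => vortN k l (x t)) ∞ (volume.restrict (Ioo 0 T)) :=
  memLp_finsetSum _ fun j _ => (memLp_convOp (hx j) (hx l)).sub (memLp_convOp (hx j) (hx k))

/-- The right-hand side of the weighted vorticity equation. -/
def vortRhs (k l : Fin 3) (β : ℝ) (x : Fin 3 → L2C) : L2C :=
  vortLam k l x + (β : ℂ) • vortN k l x

lemma memLp_vortRhs (k l : Fin 3) {β : ℝ → ℝ} {x : ℝ → Fin 3 → L2C}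
    (hβ : MemLp β ∞ (volume.restrict (Ioo 0 T)))
    (hx : ∀ i, MemLp (fun t => x t i) ∞ (volume.restrict (Ioo 0 T))) :
    MemLp (fun t => vortRhs k l (β t) (x t)) ∞ (volume.restrict (Ioo 0 T)) :=
  (memLp_vortLam k l hx).add (MemLp.smul (memLp_vortN k l hx) (hβ.ofReal (K := ℂ)))

/-- The residual of the weighted vorticity equation. -/
def vortRes (b : ℝ → ℝ) (N : ℝ) (u₀ : Field3) (u : ℝ → Field3) (k l : Fin 3) (t : ℝ) : L2C :=
  vort k l (hat (u t)) - vort k l (hat u₀) -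
    ∫ τ in (0 : ℝ)..t, vortRhs k l (b (N * τ)) (hat (u τ))

lemma pairL_vortRes (hb : IsOscillating M b) (hM : 0 < M) (hN : 0 < N)
    (hS : IsSolution b N u₀ T u) (k l : Fin 3) {ψ : 𝓢(R3, ℝ)} (hψ : HasCompactSupport ψ)
    {h : 𝓢(R3, ℂ)} (hh : toC ψ = 𝓕 (rhoS h)) :
    ∀ᵐ t ∂(volume.restrict (Ioo 0 T)), pairL h (vortRes b N u₀ u k l t) = 0 := by
  filter_upwards [hS.equation (curlField k l ψ) (contDiff_curlField k l ψ)
    (hasCompactSupport_curlField k l hψ) (divergence_curlField k l ψ),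
    ae_restrict_mem measurableSet_Ioo] with t ht htT
  have hi := intervalIntegrable_of_memLp (memLp_vortRhs k l (hb.memLp hM hN) hS.memLp_hat)
    ⟨le_rfl, (htT.1.trans htT.2).le⟩ ⟨htT.1.le, htT.2.le⟩
  have h1 := congrArg (fun r : ℝ => (r : ℂ)) ht
  simp only [Complex.ofReal_add, ← intervalIntegral.integral_ofReal, Complex.ofReal_mul,
    weak_time k l ψ h hh, weak_laplacian k l ψ h hh, weak_nonlinear k l ψ h hh] at h1
  rw [vortRes, map_sub, map_sub, h1, ← ContinuousLinearMap.intervalIntegral_comp_comm _ hi]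
  simp only [vortRhs, map_add, map_smul, smul_eq_mul]
  ring

/-- Each test function comes with its own exceptional null set of times. Since L² is separable,
countably many admissible tests are dense among all of them, and one null set suffices. -/
lemma vortRes_eq_zero (hb : IsOscillating M b) (hM : 0 < M) (hN : 0 < N)
    (hS : IsSolution b N u₀ T u) (k l : Fin 3) :
    ∀ᵐ t ∂(volume.restrict (Ioo 0 T)), vortRes b N u₀ u k l t = 0 := by
  let S : Set L2C := {g | ∃ h : 𝓢(R3, ℂ), h.toLp 2 = g ∧
    ∃ ψ : 𝓢(R3, ℝ), HasCompactSupport ψ ∧ toC ψ = 𝓕 (rhoS h)}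
  have : Fact ((2 : ℝ≥0∞) ≠ ⊤) := ⟨by norm_num⟩
  have : SecondCountableTopology L2C := Lp.SecondCountableTopology
  obtain ⟨D, hD, hDd⟩ := TopologicalSpace.exists_countable_dense S
  let B := (ContinuousLinearMap.mul ℂ ℂ).lpPairing (volume : Measure R3) 2 2
  have h1 : ∀ᵐ t ∂(volume.restrict (Ioo 0 T)), ∀ g ∈ D,
      B (g : L2C) (vortRes b N u₀ u k l t) = 0 := by
    rw [ae_ball_iff hD]
    rintro ⟨g, hg⟩ _
    obtain ⟨h, he, ψ, hψ, hh⟩ := hg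
    change ∀ᵐ t ∂(volume.restrict (Ioo 0 T)), B g (vortRes b N u₀ u k l t) = 0
    rw [← he]
    exact pairL_vortRes hb hM hN hS k l hψ hh
  filter_upwards [h1] with t ht
  set V := vortRes b N u₀ u k l t
  have h2 : ∀ g : S, B (g : L2C) V = 0 := by
    intro g
    have hc : Continuous fun g : S => B (g : L2C) V :=
      ((B.flip V).continuous).comp continuous_subtype_val
    have : (fun g : S => B (g : L2C) V) = fun _ => 0 :=
      Continuous.ext_on hDd hc continuous_const fun g hg => ht g hg
    exact congrFun this g
  -- Every real compactly supported ψ is the Fourier transform of `rhoS h` with h = `rhoInvS` (𝓕⁻ ψ)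
  -- Schwartz, hence admissible. So this functional vanishes on such ψ, and by density everywhere.
  have h3 : pairS V ∘L rhoInvS ∘L (FourierTransform.fourierInvCLM ℂ 𝓢(R3, ℂ)) = 0 := by
    refine eq_zero_of_real_compactSupport _ fun ψ hψ => ?_
    refine h2 ⟨_, rhoInvS (𝓕⁻ (toC ψ)), rfl, ψ, hψ, ?_⟩
    rw [rhoS_rhoInvS]
    exact (FourierTransform.fourier_fourierInv_eq (E := 𝓢(R3, ℂ)) (F := 𝓢(R3, ℂ)) _).symm
  refine eq_zero_of_pairL_eq_zero fun h => ?_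
  have h4 := DFunLike.congr_fun h3 (𝓕 (rhoS h) : 𝓢(R3, ℂ))
  have h5 : (FourierTransform.fourierInvCLM ℂ 𝓢(R3, ℂ)) (𝓕 (rhoS h) : 𝓢(R3, ℂ)) = rhoS h :=
    FourierTransform.fourierInv_fourier_eq (E := 𝓢(R3, ℂ)) (F := 𝓢(R3, ℂ)) _
  rw [ContinuousLinearMap.comp_apply, ContinuousLinearMap.comp_apply, h5, rhoInvS_rhoS,
    pairS_apply] at h4
  simpa using h4

/-- The Duhamel path of the truncated equation. -/
def path (b : ℝ → ℝ) (N : ℝ) (u₀ : Field3) (u : ℝ → Field3) (R : ℝ) (i : Fin 3) (t : ℝ) : L2C :=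
  mulOp (chi R) (hat u₀ i) + ∫ τ in (0 : ℝ)..t, drift R (b (N * τ)) (hat (u τ)) i

/-- On the Fourier side the solution satisfies the projected equation. -/
theorem mulOp_chi_eq_path (hb : IsOscillating M b) (hM : 0 < M) (hN : 0 < N)
    (hS : IsSolution b N u₀ T u) (R : ℝ) :
    ∀ᵐ t ∂(volume.restrict (Ioo 0 T)), ∀ i, mulOp (chi R) (hat (u t) i) = path b N u₀ u R i t := by
  have hV := ae_all_iff.mpr fun k => ae_all_iff.mpr fun l => vortRes_eq_zero hb hM hN hS k l
  filter_upwards [hV, hS.fdivFree, ae_restrict_mem measurableSet_Ioo] with t ht hdiv htT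
  have hsub : ∀ {E : Type} [NormedAddCommGroup E] [NormedSpace ℝ E] {f : ℝ → E},
      (∀ᵐ τ ∂(volume.restrict (Ioo 0 T)), f τ = 0) → ∫ τ in (0 : ℝ)..t, f τ = 0 := by
    intro E _ _ f hf
    rw [intervalIntegral.integral_of_le htT.1.le]
    refine integral_eq_zero_of_ae ?_
    exact ae_restrict_of_ae_restrict_of_subset (Ioc_subset_Ioo_right htT.2) hf
  have hi : ∀ i, IntervalIntegrable (fun τ => drift R (b (N * τ)) (hat (u τ)) i) volume 0 t :=
    fun i => intervalIntegrable_of_memLp (memLp_drift R (hb.memLp hM hN) hS.memLp_hat i)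
      ⟨le_rfl, (htT.1.trans htT.2).le⟩ ⟨htT.1.le, htT.2.le⟩
  have hiD : ∀ k i, IntervalIntegrable
      (fun τ => mulOp (rhoSig k) (drift R (b (N * τ)) (hat (u τ)) i)) volume 0 t :=
    fun k i => intervalIntegrable_of_memLp
      (memLp_mulOp (memLp_drift R (hb.memLp hM hN) hS.memLp_hat i))
      ⟨le_rfl, (htT.1.trans htT.2).le⟩ ⟨htT.1.le, htT.2.le⟩
  have hiV : ∀ k l, IntervalIntegrable (fun τ => vortRhs k l (b (N * τ)) (hat (u τ))) volume 0 t :=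
    fun k l => intervalIntegrable_of_memLp (memLp_vortRhs k l (hb.memLp hM hN) hS.memLp_hat)
      ⟨le_rfl, (htT.1.trans htT.2).le⟩ ⟨htT.1.le, htT.2.le⟩
  have hcomm : ∀ k (y : L2C), mulOp (rhoSig k) (mulOp (chi R) y) =
      mulOp (chi R) (mulOp (rhoSig k) y) := by
    intro k y
    rw [mulOp_mulOp (memLp_rhoSig k) (memLp_chi R), mulOp_mulOp (memLp_chi R) (memLp_rhoSig k)]
    simp only [mul_comm]
  intro i
  rw [← sub_eq_zero]
  -- The difference of the truncated solution and the path has no curl, by the vorticity equation,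
  -- and no divergence, since datum, solution and drift are solenoidal.
  refine eq_zero_of_vort_div (d := fun i => mulOp (chi R) (hat (u t) i) - path b N u₀ u R i t)
    (fun k l => ?_) ?_ i
  · have h1 : (∫ τ in (0 : ℝ)..t, mulOp (rhoSig k) (drift R (b (N * τ)) (hat (u τ)) l)) -
        (∫ τ in (0 : ℝ)..t, mulOp (rhoSig l) (drift R (b (N * τ)) (hat (u τ)) k)) =
        mulOp (chi R) (∫ τ in (0 : ℝ)..t, vortRhs k l (b (N * τ)) (hat (u τ))) := by
      rw [← intervalIntegral.integral_sub (hiD k l) (hiD l k),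
        ← ContinuousLinearMap.intervalIntegral_comp_comm _ (hiV k l)]
      exact intervalIntegral.integral_congr fun τ _ => vort_drift R _ _ k l
    have h2 := congrArg (mulOp (chi R)) (ht k l)
    simp only [path, map_sub, map_add, hcomm]
    rw [← ContinuousLinearMap.intervalIntegral_comp_comm _ (hi l),
      ← ContinuousLinearMap.intervalIntegral_comp_comm _ (hi k)]
    rw [vortRes, vort, vort] at h2
    simp only [map_sub, map_zero] at h2
    rw [← h1] at h2
    rw [← h2]
    abel
  · have h1 : ∑ k, ∫ τ in (0 : ℝ)..t, mulOp (rhoSig k) (drift R (b (N * τ)) (hat (u τ)) k) = 0 := by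
      rw [← intervalIntegral.integral_finsetSum fun k _ => hiD k k]
      refine hsub ?_
      filter_upwards [hS.fdivFree] with τ hτ
      exact sum_mulOp_drift hτ R _
    have h0 : FDivFree (hat u₀) := hat_divFree hS.initial_divFree
    simp only [path, map_sub, map_add, Finset.sum_sub_distrib, Finset.sum_add_distrib,
      sum_mulOp_chi hdiv, sum_mulOp_chi h0]
    rw [Finset.sum_congr rfl fun k _ =>
      (ContinuousLinearMap.intervalIntegral_comp_comm (mulOp (rhoSig k)) (hi k)).symm, h1]
    simp

end OscNS

end

/-! ### Calculus of Lipschitz paths, and the primitive of the oscillation. -/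

noncomputable section

namespace OscNS

open scoped SchwartzMap LineDeriv ComplexConjugate
open Filter Topology

lemma exists_bound_of_memLp {E : Type*} [NormedAddCommGroup E] {T : ℝ} {f : ℝ → E} (hf : MemLp f ∞ (volume.restrict (Ioo 0 T))) :
    ∃ C : ℝ≥0, ∀ᵐ τ ∂(volume.restrict (Ioo 0 T)), ‖f τ‖ ≤ C := by
  refine ⟨(eLpNorm f ∞ (volume.restrict (Ioo 0 T))).toNNReal, ?_⟩
  rw [eLpNorm_exponent_top]
  filter_upwards [ae_le_eLpNormEssSup (f := f) (μ := volume.restrict (Ioo 0 T))] with τ hτ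
  have h := hf.2.ne
  rw [eLpNorm_exponent_top] at h
  rw [← coe_nnnorm, NNReal.coe_le_coe, ← ENNReal.coe_le_coe, ENNReal.coe_toNNReal h]
  exact hτ

/-- `x` is a primitive of the bounded function `x'` on `[0, T]`. -/
structure IsPrim {E : Type*} [NormedAddCommGroup E] [NormedSpace ℝ E] (T : ℝ) (x x' : ℝ → E) :
    Prop where
  memLp : MemLp x' ∞ (volume.restrict (Ioo 0 T))
  eq : ∀ t ∈ Icc 0 T, x t = x 0 + ∫ τ in (0 : ℝ)..t, x' τ

section IsPrim

variable {E F G : Type*} [NormedAddCommGroup E] [NormedSpace ℝ E] [NormedAddCommGroup F]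
  [NormedSpace ℝ F] [NormedAddCommGroup G] [NormedSpace ℝ G] {T : ℝ}

lemma ae_uIoc_of_ae_Ioo {p : ℝ → Prop} (h : ∀ᵐ τ ∂(volume.restrict (Ioo 0 T)), p τ) {s t : ℝ}
    (hs : s ∈ Icc 0 T) (ht : t ∈ Icc 0 T) : ∀ᵐ τ, τ ∈ uIoc s t → p τ := by
  have h1 : ∀ᵐ τ ∂(volume.restrict (Icc 0 T)), p τ := by
    rwa [← Measure.restrict_congr_set Ioo_ae_eq_Icc]
  rw [ae_restrict_iff' measurableSet_Icc] at h1
  filter_upwards [h1] with τ hτ hm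
  exact hτ ((uIoc_subset_uIcc.trans (uIcc_subset_Icc hs ht)) hm)

lemma IsPrim.sub_eq {x x' : ℝ → E} (h : IsPrim T x x') {s t : ℝ} (hs : s ∈ Icc 0 T)
    (ht : t ∈ Icc 0 T) : x t - x s = ∫ τ in s..t, x' τ := by
  have h0 : (0 : ℝ) ∈ Icc 0 T := ⟨le_rfl, hs.1.trans hs.2⟩
  rw [h.eq t ht, h.eq s hs, add_sub_add_left_eq_sub, intervalIntegral.integral_interval_sub_left
    (intervalIntegrable_of_memLp h.memLp h0 ht) (intervalIntegrable_of_memLp h.memLp h0 hs)]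

lemma IsPrim.exists_lipschitz {x x' : ℝ → E} (h : IsPrim T x x') :
    ∃ K : ℝ≥0, LipschitzOnWith K x (Icc 0 T) := by
  obtain ⟨C, hC⟩ := exists_bound_of_memLp h.memLp
  refine ⟨C, LipschitzOnWith.of_dist_le_mul fun t ht s hs => ?_⟩
  rw [dist_eq_norm, h.sub_eq hs ht, Real.dist_eq]
  exact intervalIntegral.norm_integral_le_of_norm_le_const_ae (ae_uIoc_of_ae_Ioo hC hs ht)

lemma IsPrim.continuousOn {x x' : ℝ → E} (h : IsPrim T x x') : ContinuousOn x (Icc 0 T) := by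
  obtain ⟨K, hK⟩ := h.exists_lipschitz
  exact hK.continuousOn

lemma IsPrim.exists_bound {x x' : ℝ → E} (h : IsPrim T x x') :
    ∃ C : ℝ≥0, ∀ t ∈ Icc 0 T, ‖x t‖ ≤ C := by
  obtain ⟨C, hC⟩ := isCompact_Icc.exists_bound_of_continuousOn h.continuousOn
  exact ⟨C.toNNReal, fun t ht => (hC t ht).trans (Real.le_coe_toNNReal C)⟩

lemma IsPrim.memLp_self {x x' : ℝ → E} (h : IsPrim T x x') :
    MemLp x ∞ (volume.restrict (Ioo 0 T)) := by
  obtain ⟨C, hC⟩ := h.exists_bound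
  refine memLp_top_of_bound ((h.continuousOn.mono Ioo_subset_Icc_self).aestronglyMeasurable
    measurableSet_Ioo) C ?_
  filter_upwards [ae_restrict_mem measurableSet_Ioo] with t ht
  exact hC t (Ioo_subset_Icc_self ht)

lemma IsPrim.ae_hasDerivAt [CompleteSpace E] {x x' : ℝ → E} (h : IsPrim T x x') :
    ∀ᵐ t ∂(volume.restrict (Ioo 0 T)), HasDerivAt x (x' t) t := by
  rcases le_or_gt T 0 with hT | hT
  · simp [Ioo_eq_empty_of_le hT]
  have hi := intervalIntegrable_of_memLp h.memLp (left_mem_Icc.mpr hT.le) (right_mem_Icc.mpr hT.le)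
  rw [ae_restrict_iff' measurableSet_Ioo]
  filter_upwards [hi.ae_hasDerivAt_integral] with t ht hm
  have h1 := ht (by rw [uIcc_of_le hT.le]; exact Ioo_subset_Icc_self hm) 0 left_mem_uIcc
  refine (h1.const_add (x 0)).congr_of_eventuallyEq ?_
  filter_upwards [isOpen_Ioo.mem_nhds hm] with s hs
  exact h.eq s (Ioo_subset_Icc_self hs)

lemma isPrim_integral {f : ℝ → E} (hf : MemLp f ∞ (volume.restrict (Ioo 0 T))) (c : E) :
    IsPrim T (fun t => c + ∫ τ in (0 : ℝ)..t, f τ) f :=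
  ⟨hf, fun t _ => by simp⟩

/-- The difference of x and the integral of x' is absolutely continuous with derivative zero almost
everywhere, hence constant. -/
lemma IsPrim.of_lipschitz [CompleteSpace E] {x x' : ℝ → E} {K : ℝ≥0}
    (hx : LipschitzOnWith K x (Icc 0 T)) (hx' : MemLp x' ∞ (volume.restrict (Ioo 0 T)))
    (hd : ∀ᵐ t ∂(volume.restrict (Ioo 0 T)), HasDerivAt x (x' t) t) : IsPrim T x x' := by
  refine ⟨hx', fun t ht => ?_⟩
  have hT : 0 ≤ T := ht.1.trans ht.2
  have hp := isPrim_integral hx' 0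
  obtain ⟨L, hL⟩ := hp.exists_lipschitz
  have hac : AbsolutelyContinuousOnInterval (fun t => x t - (0 + ∫ τ in (0 : ℝ)..t, x' τ)) 0 T := by
    refine AbsolutelyContinuousOnInterval.sub ?_ ?_
    · exact LipschitzOnWith.absolutelyContinuousOnInterval (by rwa [uIcc_of_le hT])
    · exact LipschitzOnWith.absolutelyContinuousOnInterval (by rwa [uIcc_of_le hT])
  have h0 : ∀ᵐ t, t ∈ uIcc 0 T →
      HasDerivAt (fun t => x t - (0 + ∫ τ in (0 : ℝ)..t, x' τ)) 0 t := by
    rw [uIcc_of_le hT, ← ae_restrict_iff' measurableSet_Icc,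
      ← Measure.restrict_congr_set Ioo_ae_eq_Icc]
    filter_upwards [hd, hp.ae_hasDerivAt] with s h1 h2
    have h3 := h1.sub h2
    rw [sub_self] at h3
    exact h3
  obtain ⟨C, hC⟩ := hac.const_of_ae_hasDerivAt_zero h0
  rw [uIcc_of_le hT] at hC
  have h1 := hC t ht
  rw [← hC 0 ⟨le_rfl, hT⟩] at h1
  simp only [zero_add, intervalIntegral.integral_same, sub_zero] at h1
  rw [← h1]
  abel

/-- Product rule: bounded Lipschitz factors have a Lipschitz product, so the almost-everywhere
derivative determines it. Energies, trilinear forms and the integration by parts in time all rest on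
this. -/
lemma IsPrim.bilin [CompleteSpace E] [CompleteSpace F] [CompleteSpace G] (B : E →L[ℝ] F →L[ℝ] G)
    {x x' : ℝ → E} {y y' : ℝ → F} (hx : IsPrim T x x') (hy : IsPrim T y y') :
    IsPrim T (fun t => B (x t) (y t)) (fun t => B (x t) (y' t) + B (x' t) (y t)) := by
  obtain ⟨K, hK⟩ := hx.exists_lipschitz
  obtain ⟨L, hL⟩ := hy.exists_lipschitz
  obtain ⟨C, hC⟩ := hx.exists_bound
  obtain ⟨D, hD⟩ := hy.exists_bound
  refine IsPrim.of_lipschitz (K := ‖B‖₊ * (C * L + K * D)) ?_ ?_ ?_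
  · refine LipschitzOnWith.of_dist_le_mul fun t ht s hs => ?_
    have h1 : B (x t) (y t) - B (x s) (y s) = B (x t) (y t - y s) + B (x t - x s) (y s) := by
      simp only [map_sub, sub_apply]
      abel
    have h2 := hK.dist_le_mul t ht s hs
    have h3 := hL.dist_le_mul t ht s hs
    rw [dist_eq_norm] at h2 h3
    rw [dist_eq_norm, h1]
    refine (norm_add_le _ _).trans ?_
    calc ‖B (x t) (y t - y s)‖ + ‖B (x t - x s) (y s)‖
        ≤ ‖B‖ * ‖x t‖ * ‖y t - y s‖ + ‖B‖ * ‖x t - x s‖ * ‖y s‖ :=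
          add_le_add (B.le_opNorm₂ _ _) (B.le_opNorm₂ _ _)
      _ ≤ ‖B‖ * C * (L * dist t s) + ‖B‖ * (K * dist t s) * D := by
          gcongr
          · exact hC t ht
          · exact hD s hs
      _ = _ := by
          push_cast
          ring
  · exact (B.memLp_of_bilin ∞ hx.memLp_self hy.memLp).add (B.memLp_of_bilin ∞ hx.memLp hy.memLp_self)
  · filter_upwards [hx.ae_hasDerivAt, hy.ae_hasDerivAt] with t h1 h2
    exact B.hasDerivAt_of_bilinear (fun _ => h1) (fun _ => h2)

lemma IsPrim.clm [CompleteSpace E] [CompleteSpace F] (A : E →L[ℝ] F) {x x' : ℝ → E}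
    (hx : IsPrim T x x') : IsPrim T (fun t => A (x t)) (fun t => A (x' t)) := by
  refine ⟨A.comp_memLp' hx.memLp, fun t ht => ?_⟩
  rw [hx.eq t ht, map_add, ContinuousLinearMap.intervalIntegral_comp_comm]
  exact intervalIntegrable_of_memLp hx.memLp ⟨le_rfl, ht.1.trans ht.2⟩ ht

lemma IsPrim.sum {ι : Type*} {s : Finset ι} {x x' : ι → ℝ → E} (hx : ∀ i, IsPrim T (x i) (x' i)) :
    IsPrim T (fun t => ∑ i ∈ s, x i t) (fun t => ∑ i ∈ s, x' i t) := by
  refine ⟨memLp_finsetSum _ fun i _ => (hx i).memLp, fun t ht => ?_⟩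
  rw [intervalIntegral.integral_finsetSum fun i _ =>
    intervalIntegrable_of_memLp (hx i).memLp ⟨le_rfl, ht.1.trans ht.2⟩ ht,
    ← Finset.sum_add_distrib]
  exact Finset.sum_congr rfl fun i _ => (hx i).eq t ht

lemma integral_congr_of_ae {f g : ℝ → E} (h : ∀ᵐ t ∂(volume.restrict (Ioo 0 T)), f t = g t)
    {s t : ℝ} (hs : s ∈ Icc 0 T) (ht : t ∈ Icc 0 T) : ∫ τ in s..t, f τ = ∫ τ in s..t, g τ :=
  intervalIntegral.integral_congr_ae (ae_uIoc_of_ae_Ioo h hs ht)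

lemma IsPrim.congr_deriv {x x' y' : ℝ → E} (hx : IsPrim T x x')
    (h : ∀ᵐ t ∂(volume.restrict (Ioo 0 T)), x' t = y' t) : IsPrim T x y' := by
  refine ⟨hx.memLp.ae_eq h, fun t ht => ?_⟩
  rw [hx.eq t ht, integral_congr_of_ae h ⟨le_rfl, ht.1.trans ht.2⟩ ht]

end IsPrim

lemma isPrim_path {b : ℝ → ℝ} {M N T : ℝ} {u₀ : Field3} {u : ℝ → Field3}
    (hb : IsOscillating M b) (hM : 0 < M) (hN : 0 < N) (hS : IsSolution b N u₀ T u) (R : ℝ)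
    (i : Fin 3) :
    IsPrim T (path b N u₀ u R i) (fun τ => drift R (b (N * τ)) (hat (u τ)) i) :=
  isPrim_integral (memLp_drift R (hb.memLp hM hN) hS.memLp_hat i) _

/-- The primitive `∫₀ᵗ b(Nτ) dτ` of the oscillation. -/
def oscPrim (b : ℝ → ℝ) (N : ℝ) (t : ℝ) : ℝ := 0 + ∫ τ in (0 : ℝ)..t, b (N * τ)

lemma isPrim_oscPrim {b : ℝ → ℝ} {M N T : ℝ} (hb : IsOscillating M b) (hM : 0 < M) (hN : 0 < N) :
    IsPrim T (oscPrim b N) (fun τ => b (N * τ)) :=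
  isPrim_integral (hb.memLp hM hN) 0

/-- The substitution σ = Nτ produces 1/N. The hypothesis on b concerns intervals with positive left
endpoint, so the bound is proved on (s, t) and s tends to 0. -/
lemma abs_oscPrim_le {b : ℝ → ℝ} {M N t : ℝ} (hb : IsOscillating M b) (hM : 0 < M) (hN : 0 < N)
    (ht : 0 ≤ t) : |oscPrim b N t| ≤ M / N := by
  have hp := isPrim_oscPrim (T := t) hb hM hN
  have h0 : oscPrim b N 0 = 0 := by simp [oscPrim]
  rcases ht.eq_or_lt with rfl | ht
  · rw [h0, abs_zero]
    positivity
  have key : ∀ s ∈ Ioo 0 t, |oscPrim b N t - oscPrim b N s| ≤ M / N := by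
    intro s hs
    rw [hp.sub_eq ⟨hs.1.le, hs.2.le⟩ ⟨ht.le, le_rfl⟩,
      intervalIntegral.integral_comp_mul_left _ hN.ne', smul_eq_mul, abs_mul,
      abs_of_pos (inv_pos.mpr hN), inv_mul_eq_div]
    gcongr
    have h1 := le_add_self.trans (hb.bound (N * s) (N * t) (mul_pos hN hs.1)
      (mul_lt_mul_of_pos_left hs.2 hN))
    rwa [← ofReal_norm, ENNReal.ofReal_le_ofReal_iff hM.le] at h1
  have hc : Tendsto (fun s => |oscPrim b N t - oscPrim b N s|) (𝓝[>] 0)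
      (𝓝 |oscPrim b N t - oscPrim b N 0|) := by
    have := (hp.continuousOn 0 ⟨le_rfl, ht.le⟩).mono_left
      (nhdsWithin_le_of_mem (Icc_mem_nhdsGT ht))
    exact (tendsto_const_nhds.sub this).abs
  rw [h0, sub_zero] at hc
  refine le_of_tendsto hc ?_
  filter_upwards [Ioo_mem_nhdsGT ht] with s hs
  exact key s hs

end OscNS

end

/-! ### The trilinear form and the derivative of the truncated energy. -/

noncomputable section

namespace OscNS

open scoped SchwartzMap LineDeriv ComplexConjugate
open Filter Topology

/-- The real part of the inner product of `L²`, as a real bilinear form. -/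
def reInner : L2C →L[ℝ] L2C →L[ℝ] ℝ :=
  LinearMap.mkContinuous₂ (LinearMap.mk₂ ℝ (fun f g : L2C => (inner ℂ f g).re)
    (fun f f' g => by simp [inner_add_left])
    (fun c f g => by
      rw [RCLike.real_smul_eq_coe_smul (K := ℂ), inner_smul_left]
      simp)
    (fun f g g' => by simp [inner_add_right])
    (fun c f g => by
      rw [RCLike.real_smul_eq_coe_smul (K := ℂ), inner_smul_right]
      simp)) 1
    (fun f g => by
      rw [one_mul]
      exact (Complex.abs_re_le_norm _).trans (norm_inner_le_norm f g))

lemma reInner_apply (f g : L2C) : reInner f g = (inner ℂ f g).re := rfl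

lemma reInner_self (f : L2C) : reInner f f = ‖f‖ ^ 2 := by
  rw [reInner_apply]
  exact inner_self_eq_norm_sq (𝕜 := ℂ) f

lemma reInner_comm (f g : L2C) : reInner f g = reInner g f := by
  rw [reInner_apply, reInner_apply]
  exact inner_re_symm (𝕜 := ℂ) f g

lemma reInner_ofReal_smul (c : ℝ) (f g : L2C) : reInner f ((c : ℂ) • g) = c * reInner f g := by
  rw [reInner_apply, inner_smul_right, reInner_apply, Complex.re_ofReal_mul]

lemma inner_mulOp {m : R3 → ℂ} (hm : MemLp m ∞ volume) (hr : ∀ ξ, conj (m ξ) = m ξ) (f g : L2C) :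
    inner ℂ (mulOp m f) g = inner ℂ f (mulOp m g) := by
  rw [L2.inner_def, L2.inner_def]
  refine integral_congr_ae ?_
  filter_upwards [coeFn_mulOp hm f, coeFn_mulOp hm g] with ξ h1 h2
  rw [h1, h2, RCLike.inner_apply, RCLike.inner_apply, map_mul, hr]
  ring

lemma mulOp_const_mul {m : R3 → ℂ} (hm : MemLp m ∞ volume) (c : ℂ) (f : L2C) :
    mulOp (fun ξ => c * m ξ) f = c • mulOp m f := by
  apply Lp.ext
  filter_upwards [coeFn_mulOp (hm.const_mul c) f, coeFn_mulOp hm f,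
    Lp.coeFn_smul c (mulOp m f)] with ξ h1 h2 h3
  rw [h1, h3, Pi.smul_apply, h2, smul_eq_mul, mul_assoc]

/-- The truncated weight `|ξ|^s` on the ball of radius `R`. -/
def wt (R : ℝ) (s : ℕ) (ξ : R3) : ℂ := chi R ξ * ((‖ξ‖ ^ s : ℝ) : ℂ)

lemma memLp_wt (R : ℝ) (s : ℕ) : MemLp (wt R s) ∞ volume := by
  have hC : 0 ≤ |R| ^ s := pow_nonneg (abs_nonneg R) s
  refine memLp_infty_of_bound ((measurable_chi R).mul (by fun_prop)) (|R| ^ s) fun ξ =>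
    norm_chi_mul_le (m := fun ξ => ((‖ξ‖ ^ s : ℝ) : ℂ)) hC fun h => ?_
  rw [Complex.norm_real, Real.norm_of_nonneg (by positivity)]
  gcongr
  exact h.trans (le_abs_self R)

lemma conj_chi (R : ℝ) (ξ : R3) : conj (chi R ξ) = chi R ξ := by
  unfold chi
  split_ifs <;> simp

lemma conj_wt (R : ℝ) (s : ℕ) (ξ : R3) : conj (wt R s ξ) = wt R s ξ := by
  rw [wt, map_mul, conj_chi, Complex.conj_ofReal]

lemma wt_mul_wt (R : ℝ) (s r : ℕ) : (fun ξ => wt R s ξ * wt R r ξ) = wt R (s + r) := by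
  ext ξ
  have h := chi_mul_chi R ξ
  unfold wt
  rw [pow_add]
  push_cast
  linear_combination (‖ξ‖ : ℂ) ^ s * ‖ξ‖ ^ r * h

lemma mulOp_wt_mulOp_wt (R : ℝ) (s r : ℕ) (f : L2C) :
    mulOp (wt R s) (mulOp (wt R r) f) = mulOp (wt R (s + r)) f := by
  rw [mulOp_mulOp (memLp_wt R s) (memLp_wt R r), wt_mul_wt]

lemma mulOp_wt_mulOp_chi (R : ℝ) (s : ℕ) (f : L2C) :
    mulOp (wt R s) (mulOp (chi R) f) = mulOp (wt R s) f := by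
  have h : (fun ξ => wt R s ξ * chi R ξ) = wt R s := by
    ext ξ
    rw [wt, mul_assoc, mul_comm _ (chi R ξ), ← mul_assoc, chi_mul_chi]
  rw [mulOp_mulOp (memLp_wt R s) (memLp_chi R), h]

lemma mulOp_chiLam_eq (R : ℝ) (f : L2C) :
    mulOp (chiLam R) f = ((-(4 * Real.pi ^ 2) : ℝ) : ℂ) • mulOp (wt R 2) f := by
  have h : chiLam R = fun ξ => ((-(4 * Real.pi ^ 2) : ℝ) : ℂ) * wt R 2 ξ := by
    ext ξ
    rw [chiLam, lam_eq, wt]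
    push_cast
    ring
  rw [← mulOp_const_mul (memLp_wt R 2), ← h]

/-- The weights are real, hence self-adjoint and movable between slots. The Laplacian symbol
-4π²|ξ|² adds one derivative to each factor and yields the dissipation. -/
lemma reInner_wt_drift (R β : ℝ) (s : ℕ) (x : Fin 3 → L2C) (i : Fin 3) :
    reInner (mulOp (wt R s) (x i)) (mulOp (wt R s) (drift R β x i)) =
      -(4 * Real.pi ^ 2) * ‖mulOp (wt R (s + 1)) (x i)‖ ^ 2 +
        β * reInner (mulOp (wt R (2 * s)) (x i)) (nonlin R x i) := by
  have hadj : ∀ (r : ℕ) (f g : L2C), reInner (mulOp (wt R r) f) g = reInner f (mulOp (wt R r) g) :=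
    fun r f g => by
      rw [reInner_apply, reInner_apply, inner_mulOp (memLp_wt R r) (conj_wt R r)]
  rw [hadj, mulOp_wt_mulOp_wt, drift, map_add, map_add, map_smul, reInner_ofReal_smul,
    mulOp_chiLam_eq, map_smul, reInner_ofReal_smul, ← reInner_self, hadj, mulOp_wt_mulOp_wt,
    mulOp_wt_mulOp_wt, hadj, ← two_mul, show s + 1 + (s + 1) = 2 * s + 2 by ring]

/-- The convolution operator as a real bilinear map. -/
def convR (m : R3 → ℂ) : L2C →L[ℝ] L2C →L[ℝ] L2C := (convOp m).bilinearRestrictScalars ℝ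

lemma convR_apply (m : R3 → ℂ) (f g : L2C) : convR m f g = convOp m f g := rfl

/-- The truncated trilinear form of the energy estimate of order `s`. -/
def T3 (K : ℝ) (s : ℕ) (x y z : Fin 3 → L2C) : ℝ :=
  ∑ i, ∑ m, ∑ j, reInner (mulOp (wt K (2 * s)) (x i)) (convR (symN K i m j) (y j) (z m))

lemma T3_self (K : ℝ) (s : ℕ) (x y : Fin 3 → L2C) :
    T3 K s x y y = ∑ i, reInner (mulOp (wt K (2 * s)) (x i)) (nonlin K y i) := by
  simp only [T3, nonlin, map_sum, convR_apply]

lemma T3_sub_left (K : ℝ) (s : ℕ) (x x' y z : Fin 3 → L2C) :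
    T3 K s (x - x') y z = T3 K s x y z - T3 K s x' y z := by
  simp only [T3, Pi.sub_apply, map_sub, sub_apply, Finset.sum_sub_distrib]

lemma T3_sub_mid (K : ℝ) (s : ℕ) (x y y' z : Fin 3 → L2C) :
    T3 K s x (y - y') z = T3 K s x y z - T3 K s x y' z := by
  simp only [T3, Pi.sub_apply, map_sub, sub_apply, Finset.sum_sub_distrib]

lemma T3_sub_right (K : ℝ) (s : ℕ) (x y z z' : Fin 3 → L2C) :
    T3 K s x y (z - z') = T3 K s x y z - T3 K s x y z' := by
  simp only [T3, Pi.sub_apply, map_sub, Finset.sum_sub_distrib]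

lemma IsPrim.T3 {T : ℝ} (K : ℝ) (s : ℕ) {x x' y y' z z' : ℝ → Fin 3 → L2C}
    (hx : ∀ i, IsPrim T (fun t => x t i) (fun t => x' t i))
    (hy : ∀ i, IsPrim T (fun t => y t i) (fun t => y' t i))
    (hz : ∀ i, IsPrim T (fun t => z t i) (fun t => z' t i)) :
    IsPrim T (fun t => T3 K s (x t) (y t) (z t))
      (fun t => T3 K s (x t) (y t) (z' t) + T3 K s (x t) (y' t) (z t) +
        T3 K s (x' t) (y t) (z t)) := by
  have h : ∀ i m j, IsPrim T
      (fun t => reInner (mulOp (wt K (2 * s)) (x t i)) (convR (symN K i m j) (y t j) (z t m)))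
      (fun t => reInner (mulOp (wt K (2 * s)) (x t i)) (convR (symN K i m j) (y t j) (z' t m) +
        convR (symN K i m j) (y' t j) (z t m)) +
        reInner (mulOp (wt K (2 * s)) (x' t i)) (convR (symN K i m j) (y t j) (z t m))) :=
    fun i m j => IsPrim.bilin reInner
      ((hx i).clm ((mulOp (wt K (2 * s))).restrictScalars ℝ))
      (IsPrim.bilin (convR (symN K i m j)) (hy j) (hz m))
  have h2 := IsPrim.sum (s := Finset.univ) fun i => IsPrim.sum (s := Finset.univ) fun m =>
    IsPrim.sum (s := Finset.univ) fun j => h i m j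
  refine h2.congr_deriv (Eventually.of_forall fun t => ?_)
  simp only [OscNS.T3, map_add, Finset.sum_add_distrib]

/-- The truncated energy of order `s`. -/
def energy (R : ℝ) (s : ℕ) (x : Fin 3 → L2C) : ℝ := ∑ i, ‖mulOp (wt R s) (x i)‖ ^ 2

lemma energy_nonneg (R : ℝ) (s : ℕ) (x : Fin 3 → L2C) : 0 ≤ energy R s x :=
  Finset.sum_nonneg fun _ _ => sq_nonneg _

section

variable {b : ℝ → ℝ} {M N T : ℝ} {u₀ : Field3} {u : ℝ → Field3}

lemma path_zero (R : ℝ) (i : Fin 3) : path b N u₀ u R i 0 = mulOp (chi R) (hat u₀ i) := by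
  simp [path]

/-- The energy is taken along the path, which is Lipschitz in time, while its derivative is
expressed through u, with which the path agrees almost everywhere after truncation. Only the output
frequency is truncated; the fields inside the nonlinearity are not. -/
lemma isPrim_energy (hb : IsOscillating M b) (hM : 0 < M) (hN : 0 < N)
    (hS : IsSolution b N u₀ T u) (R : ℝ) (s : ℕ) :
    IsPrim T (fun t => energy R s fun i => path b N u₀ u R i t)
      (fun t => -(8 * Real.pi ^ 2) * energy R (s + 1) (hat (u t)) +
        2 * (b (N * t) * T3 R s (hat (u t)) (hat (u t)) (hat (u t)))) := by
  have h : ∀ i, IsPrim T (fun t => ‖mulOp (wt R s) (path b N u₀ u R i t)‖ ^ 2)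
      (fun t => 2 * reInner (mulOp (wt R s) (path b N u₀ u R i t))
        (mulOp (wt R s) (drift R (b (N * t)) (hat (u t)) i))) := by
    intro i
    have h1 := (isPrim_path hb hM hN hS R i).clm ((mulOp (wt R s)).restrictScalars ℝ)
    have h2 := (IsPrim.bilin reInner h1 h1).congr_deriv (y' := fun t =>
        2 * reInner (mulOp (wt R s) (path b N u₀ u R i t))
          (mulOp (wt R s) (drift R (b (N * t)) (hat (u t)) i)))
      (Eventually.of_forall fun t => by
        dsimp only [ContinuousLinearMap.coe_restrictScalars']
        rw [reInner_comm (mulOp (wt R s) (drift R (b (N * t)) (hat (u t)) i)), ← two_mul])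
    simpa only [ContinuousLinearMap.coe_restrictScalars', reInner_self] using h2
  refine (IsPrim.sum (s := Finset.univ) h).congr_deriv ?_
  filter_upwards [mulOp_chi_eq_path hb hM hN hS R] with t ht
  simp only [← ht, mulOp_wt_mulOp_chi, reInner_wt_drift, energy, T3_self, Finset.mul_sum,
    ← Finset.sum_add_distrib]
  refine Finset.sum_congr rfl fun i _ => ?_
  ring

lemma energy_path_zero (R : ℝ) (s : ℕ) :
    (energy R s fun i => path b N u₀ u R i 0) = energy R s (hat u₀) := by
  simp only [energy, path_zero, mulOp_wt_mulOp_chi]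

end

end OscNS

end

/-! ### Bounds for the trilinear form and the low–high frequency splitting. -/

noncomputable section

namespace OscNS

open scoped SchwartzMap LineDeriv ComplexConjugate
open Filter Topology

/-- The amplitude `∑ᵢ |xᵢ(ξ)|`. -/
def dens (x : Fin 3 → L2C) (ξ : R3) : ℝ≥0∞ := ∑ i, ‖x i ξ‖ₑ

lemma measurable_dens (x : Fin 3 → L2C) : Measurable (dens x) :=
  Finset.measurable_fun_sum _ fun i _ => measurable_enorm_coe (x i)

lemma enorm_le_dens (x : Fin 3 → L2C) (i : Fin 3) (ξ : R3) : ‖x i ξ‖ₑ ≤ dens x ξ :=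
  Finset.single_le_sum (f := fun i => ‖x i ξ‖ₑ) (fun _ _ => zero_le) (Finset.mem_univ i)

/-- The frequency truncation. -/
def low (K : ℝ) (x : Fin 3 → L2C) (i : Fin 3) : L2C := mulOp (chi K) (x i)

lemma coeFn_low (K : ℝ) (x : Fin 3 → L2C) (i : Fin 3) :
    ∀ᵐ ξ, low K x i ξ = chi K ξ * x i ξ := coeFn_mulOp (memLp_chi K) (x i)

/-- The low-frequency part of the amplitude. -/
def densLow (K : ℝ) (x : Fin 3 → L2C) (ξ : R3) : ℝ≥0∞ := if ‖ξ‖ ≤ K then dens x ξ else 0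

/-- The high-frequency part of the amplitude. -/
def densHigh (K : ℝ) (x : Fin 3 → L2C) (ξ : R3) : ℝ≥0∞ := if ‖ξ‖ ≤ K then 0 else dens x ξ

lemma measurable_densLow (K : ℝ) (x : Fin 3 → L2C) : Measurable (densLow K x) :=
  Measurable.ite (measurableSet_le measurable_norm measurable_const) (measurable_dens x)
    measurable_const

lemma measurable_densHigh (K : ℝ) (x : Fin 3 → L2C) : Measurable (densHigh K x) :=
  Measurable.ite (measurableSet_le measurable_norm measurable_const) measurable_const
    (measurable_dens x)

lemma densLow_le (K : ℝ) (x : Fin 3 → L2C) (ξ : R3) : densLow K x ξ ≤ dens x ξ := by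
  unfold densLow
  split_ifs <;> simp

lemma densHigh_le (K : ℝ) (x : Fin 3 → L2C) (ξ : R3) : densHigh K x ξ ≤ dens x ξ := by
  unfold densHigh
  split_ifs <;> simp

lemma enorm_chi_mul_le (K : ℝ) (z : ℂ) (ξ : R3) : ‖chi K ξ * z‖ₑ ≤ ‖z‖ₑ := by
  unfold chi
  split_ifs <;> simp

lemma enorm_low_le (K : ℝ) (x : Fin 3 → L2C) (i : Fin 3) :
    ∀ᵐ ξ, ‖low K x i ξ‖ₑ ≤ densLow K x ξ := by
  filter_upwards [coeFn_low K x i] with ξ h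
  rw [h, chi, densLow]
  split_ifs
  · simpa using enorm_le_dens x i ξ
  · simp

lemma enorm_low_le' (K : ℝ) (x : Fin 3 → L2C) (i : Fin 3) :
    ∀ᵐ ξ, ‖low K x i ξ‖ₑ ≤ dens x ξ := by
  filter_upwards [enorm_low_le K x i] with ξ h
  exact h.trans (densLow_le K x ξ)

lemma enorm_sub_low_le (K : ℝ) (x : Fin 3 → L2C) (i : Fin 3) :
    ∀ᵐ ξ, ‖(x - low K x) i ξ‖ₑ ≤ densHigh K x ξ := by
  filter_upwards [coeFn_low K x i, Lp.coeFn_sub (x i) (low K x i)] with ξ h h'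
  rw [Pi.sub_apply, h', Pi.sub_apply, h, chi, densHigh]
  split_ifs
  · simp
  · simpa using enorm_le_dens x i ξ

/-- The numerical constant in the bound of the trilinear form. -/
def c0 : ℝ≥0 := 27 * (4 * Real.pi).toNNReal

lemma enorm_wt_mul_symN_le (K : ℝ) (s : ℕ) (i m j : Fin 3) (z : ℂ) (ξ : R3) :
    ‖wt K (2 * s) ξ * z‖ₑ * ‖symN K i m j ξ‖ₑ ≤
      ((4 * Real.pi).toNNReal : ℝ≥0∞) * (‖ξ‖ₑ ^ (2 * s + 1) * ‖chi K ξ * z‖ₑ) := by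
  have h : ‖wt K (2 * s) ξ * z‖ * ‖symN K i m j ξ‖ ≤
      4 * Real.pi * (‖ξ‖ ^ (2 * s + 1) * ‖chi K ξ * z‖) := by
    have h1 : ‖symN K i m j ξ‖ ≤ 1 * (2 * Real.pi * ‖ξ‖ * 2) := by
      rw [symN, norm_mul, norm_mul]
      gcongr
      · exact norm_chi_le K ξ
      · exact norm_sig_le j ξ
      · exact norm_leray_le i m ξ
    have h2 : ‖wt K (2 * s) ξ * z‖ = ‖ξ‖ ^ (2 * s) * ‖chi K ξ * z‖ := by
      rw [wt, norm_mul, norm_mul, norm_mul, Complex.norm_real, Real.norm_of_nonneg (by positivity)]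
      ring
    rw [h2]
    calc ‖ξ‖ ^ (2 * s) * ‖chi K ξ * z‖ * ‖symN K i m j ξ‖
        ≤ ‖ξ‖ ^ (2 * s) * ‖chi K ξ * z‖ * (1 * (2 * Real.pi * ‖ξ‖ * 2)) := by gcongr
      _ = _ := by ring
  have h3 := ENNReal.ofReal_le_ofReal h
  rw [ENNReal.ofReal_mul (norm_nonneg _), ENNReal.ofReal_mul (p := 4 * Real.pi) (by positivity),
    ENNReal.ofReal_mul (p := ‖ξ‖ ^ (2 * s + 1)) (by positivity),
    ENNReal.ofReal_pow (norm_nonneg _)] at h3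
  simp only [ofReal_norm] at h3
  exact h3

lemma enorm_reInner_le (f g : L2C) : ‖reInner f g‖ₑ ≤ ‖inner ℂ f g‖ₑ := by
  rw [reInner_apply, ← ofReal_norm, ← ofReal_norm]
  exact ENNReal.ofReal_le_ofReal (Complex.abs_re_le_norm _)

/-- Each of the 27 index triples is bounded by the same positive form. The weight has order 2s, and
the divergence in the nonlinearity adds one derivative. -/
lemma enorm_T3_le (K : ℝ) (s : ℕ) {x y z : Fin 3 → L2C} {F G H : R3 → ℝ≥0∞} (hF : Measurable F)
    (hG : Measurable G) (hH : Measurable H) (hx : ∀ i, ∀ᵐ ξ, ‖chi K ξ * x i ξ‖ₑ ≤ F ξ)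
    (hy : ∀ i, ∀ᵐ ξ, ‖y i ξ‖ₑ ≤ G ξ) (hz : ∀ i, ∀ᵐ ξ, ‖z i ξ‖ₑ ≤ H ξ) :
    ‖T3 K s x y z‖ₑ ≤ c0 * tri (fun ξ => ‖ξ‖ₑ ^ (2 * s + 1) * F ξ) G H := by
  have h : ∀ i m j, ‖reInner (mulOp (wt K (2 * s)) (x i)) (convR (symN K i m j) (y j) (z m))‖ₑ ≤
      ((4 * Real.pi).toNNReal : ℝ≥0∞) * tri (fun ξ => ‖ξ‖ₑ ^ (2 * s + 1) * F ξ) G H := by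
    intro i m j
    rw [← tri_const_mul _ (by fun_prop) hG hH]
    refine (enorm_reInner_le _ _).trans (enorm_inner_convOp_le (memLp_symN K i m j) _ _ _ ?_
      (hy j) (hz m))
    filter_upwards [coeFn_mulOp (memLp_wt K (2 * s)) (x i), hx i] with ξ h1 h2
    rw [h1]
    refine (enorm_wt_mul_symN_le K s i m j _ ξ).trans ?_
    gcongr
  unfold T3
  calc _ ≤ ∑ i : Fin 3, ∑ m : Fin 3, ∑ j : Fin 3,
        ‖reInner (mulOp (wt K (2 * s)) (x i)) (convR (symN K i m j) (y j) (z m))‖ₑ :=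
      (enorm_sum_le _ _).trans (Finset.sum_le_sum fun i _ => (enorm_sum_le _ _).trans
        (Finset.sum_le_sum fun m _ => enorm_sum_le _ _))
    _ ≤ ∑ i : Fin 3, ∑ m : Fin 3, ∑ j : Fin 3,
        ((4 * Real.pi).toNNReal : ℝ≥0∞) * tri (fun ξ => ‖ξ‖ₑ ^ (2 * s + 1) * F ξ) G H :=
      Finset.sum_le_sum fun i _ => Finset.sum_le_sum fun m _ => Finset.sum_le_sum fun j _ => h i m j
    _ = _ := by
      simp only [Finset.sum_const, Finset.card_univ, Fintype.card_fin, nsmul_eq_mul, c0]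
      push_cast
      ring

/-- The first slot lives in the ball of radius K, so the output cutoff acts only there, where both
radii give the same. -/
lemma T3_low_eq {K R : ℝ} (hKR : K ≤ R) (s : ℕ) (x y z : Fin 3 → L2C) :
    T3 K s (low K x) y z = T3 R s (low K x) y z := by
  have hchi : ∀ ξ, chi K ξ * chi R ξ = chi K ξ := by
    intro ξ
    unfold chi
    split_ifs with h1 h2 <;> simp
    exact h2 (h1.trans hKR)
  unfold T3
  refine Finset.sum_congr rfl fun i _ => Finset.sum_congr rfl fun m _ =>
    Finset.sum_congr rfl fun j _ => ?_
  have h1 : symN K i m j = fun ξ => chi K ξ * symN R i m j ξ := by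
    ext ξ
    rw [symN, symN, ← mul_assoc (chi K ξ) (chi R ξ), hchi]
  rw [reInner_apply, reInner_apply, convR_apply, convR_apply, h1,
    ← mulOp_convOp (memLp_chi K) (memLp_symN R i m j), ← inner_mulOp (memLp_chi K) (conj_chi K),
    low, mulOp_mulOp (memLp_wt K _) (memLp_chi K), mulOp_mulOp (memLp_wt R _) (memLp_chi K),
    mulOp_mulOp (m := fun ξ => wt K (2 * s) ξ * chi K ξ) (memLp_chi K)
      ((memLp_chi K).mul (r := ∞) (memLp_wt K (2 * s)))]
  have h2 : (fun ξ => chi K ξ * (wt K (2 * s) ξ * chi K ξ)) = fun ξ => wt R (2 * s) ξ * chi K ξ := by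
    ext ξ
    have h3 := chi_mul_chi K ξ
    have h4 := hchi ξ
    unfold wt
    linear_combination (chi K ξ * ((‖ξ‖ ^ (2 * s) : ℝ) : ℂ) + ((‖ξ‖ ^ (2 * s) : ℝ) : ℂ)) * h3 -
      ((‖ξ‖ ^ (2 * s) : ℝ) : ℂ) * h4
  rw [h2]

lemma ofReal_le_enorm_of_densHigh_ne_zero {K : ℝ} {x : Fin 3 → L2C} {ξ : R3}
    (h : densHigh K x ξ ≠ 0) : ENNReal.ofReal K ≤ ‖ξ‖ₑ := by
  unfold densHigh at h
  split_ifs at h with hξ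
  · exact absurd rfl h
  · rw [← ofReal_norm]
    exact ENNReal.ofReal_le_ofReal (not_le.mp hξ).le

lemma enorm_le_ofReal_of_densLow_ne_zero {K : ℝ} {x : Fin 3 → L2C} {ξ : R3}
    (h : densLow K x ξ ≠ 0) : ‖ξ‖ₑ ≤ ENNReal.ofReal K := by
  unfold densLow at h
  split_ifs at h with hξ
  · rw [← ofReal_norm]
    exact ENNReal.ofReal_le_ofReal hξ
  · exact absurd rfl h

/-- Replacing a field by its truncation in the trilinear form. -/
lemma enorm_T3_sub_low_le (K R : ℝ) (s : ℕ) (x : Fin 3 → L2C) {D : ℝ≥0∞}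
    (hD : ∀ F G H : R3 → ℝ≥0∞, Measurable F → Measurable G → Measurable H →
      (∀ ξ, F ξ ≤ dens x ξ) → (∀ ξ, G ξ ≤ dens x ξ) → (∀ ξ, H ξ ≤ dens x ξ) →
      (∀ ζ η, F (ζ + η) ≠ 0 → G ζ ≠ 0 → H η ≠ 0 → ENNReal.ofReal K ≤ ‖ζ‖ₑ + ‖η‖ₑ) →
      ENNReal.ofReal K * tri (fun ξ => ‖ξ‖ₑ ^ (2 * s + 1) * F ξ) G H ≤ D) :
    ENNReal.ofReal K * ‖T3 R s x x x - T3 R s (low K x) (low K x) (low K x)‖ₑ ≤ 3 * c0 * D := by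
  have hx : ∀ i, ∀ᵐ ξ, ‖x i ξ‖ₑ ≤ dens x ξ := fun i => Eventually.of_forall (enorm_le_dens x i)
  have hchi : ∀ {y : Fin 3 → L2C} {F : R3 → ℝ≥0∞}, (∀ i, ∀ᵐ ξ, ‖y i ξ‖ₑ ≤ F ξ) →
      ∀ i, ∀ᵐ ξ, ‖chi R ξ * y i ξ‖ₑ ≤ F ξ := by
    intro y F h i
    filter_upwards [h i] with ξ hξ
    exact (enorm_chi_mul_le R _ ξ).trans hξ
  have hm := measurable_dens x
  have hmh := measurable_densHigh K x
  -- Telescoping: each of the three terms has one slot supported above K, which forces |ζ| + |η| ≥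
  -- K.
  have e : T3 R s x x x - T3 R s (low K x) (low K x) (low K x) = T3 R s (x - low K x) x x +
      T3 R s (low K x) (x - low K x) x + T3 R s (low K x) (low K x) (x - low K x) := by
    rw [T3_sub_left, T3_sub_mid, T3_sub_right]
    ring
  have h1 := enorm_T3_le R s hmh hm hm (hchi (enorm_sub_low_le K x)) hx hx
  have h2 := enorm_T3_le R s hm hmh hm (hchi (enorm_low_le' K x)) (enorm_sub_low_le K x) hx
  have h3 := enorm_T3_le R s hm hm hmh (hchi (enorm_low_le' K x)) (enorm_low_le' K x)
    (enorm_sub_low_le K x)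
  have d1 := hD _ _ _ hmh hm hm (densHigh_le K x) (fun _ => le_rfl) (fun _ => le_rfl)
    fun ζ η h _ _ => (ofReal_le_enorm_of_densHigh_ne_zero h).trans (enorm_add_le _ _)
  have d2 := hD _ _ _ hm hmh hm (fun _ => le_rfl) (densHigh_le K x) (fun _ => le_rfl)
    fun ζ η _ h _ => (ofReal_le_enorm_of_densHigh_ne_zero h).trans le_self_add
  have d3 := hD _ _ _ hm hm hmh (fun _ => le_rfl) (fun _ => le_rfl) (densHigh_le K x)
    fun ζ η _ _ h => (ofReal_le_enorm_of_densHigh_ne_zero h).trans le_add_self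
  rw [e]
  calc ENNReal.ofReal K * ‖T3 R s (x - low K x) x x +
      T3 R s (low K x) (x - low K x) x + T3 R s (low K x) (low K x) (x - low K x)‖ₑ
      ≤ ENNReal.ofReal K * (c0 * tri (fun ξ => ‖ξ‖ₑ ^ (2 * s + 1) * densHigh K x ξ) (dens x)
          (dens x) + c0 * tri (fun ξ => ‖ξ‖ₑ ^ (2 * s + 1) * dens x ξ) (densHigh K x) (dens x) +
          c0 * tri (fun ξ => ‖ξ‖ₑ ^ (2 * s + 1) * dens x ξ) (dens x) (densHigh K x)) := by
        gcongr
        exact (enorm_add_le _ _).trans (add_le_add ((enorm_add_le _ _).trans (add_le_add h1 h2)) h3)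
    _ = c0 * (ENNReal.ofReal K * tri (fun ξ => ‖ξ‖ₑ ^ (2 * s + 1) * densHigh K x ξ) (dens x)
          (dens x)) + c0 * (ENNReal.ofReal K * tri (fun ξ => ‖ξ‖ₑ ^ (2 * s + 1) * dens x ξ)
          (densHigh K x) (dens x)) + c0 * (ENNReal.ofReal K *
            tri (fun ξ => ‖ξ‖ₑ ^ (2 * s + 1) * dens x ξ) (dens x) (densHigh K x)) := by ring
    _ ≤ c0 * D + c0 * D + c0 * D := by gcongr
    _ = _ := by ring

lemma enorm_T3_two_sub_low_le (K R : ℝ) (x : Fin 3 → L2C) :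
    ENNReal.ofReal K * ‖T3 R 2 x x x - T3 R 2 (low K x) (low K x) (low K x)‖ₑ ≤
      3 * c0 * (8 * (mom 3 (dens x) ^ 2 * ∫⁻ ξ, dens x ξ)) :=
  enorm_T3_sub_low_le K R 2 x fun _ _ _ hF hG hH h1 h2 h3 hK =>
    tri_five_high_le (measurable_dens x) hF hG hH h1 h2 h3 _ hK

lemma enorm_T3_zero_sub_low_le (K R : ℝ) (x : Fin 3 → L2C) :
    ENNReal.ofReal K * ‖T3 R 0 x x x - T3 R 0 (low K x) (low K x) (low K x)‖ₑ ≤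
      3 * c0 * (2 * (mom 1 (dens x) ^ 2 * ∫⁻ ξ, dens x ξ)) :=
  enorm_T3_sub_low_le K R 0 x fun _ _ _ hF hG hH h1 h2 h3 hK =>
    tri_one_high_le (measurable_dens x) hF hG hH h1 h2 h3 _ hK

/-- Bound of the low-frequency trilinear form. -/
lemma enorm_T3_low_le (K : ℝ) (x : Fin 3 → L2C) :
    ‖T3 K 2 (low K x) (low K x) (low K x)‖ₑ ≤ c0 * (2 * ENNReal.ofReal K ^ 2 *
      (mom 2 (dens x) * mom 1 (dens x) * ∫⁻ ξ, dens x ξ)) := by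
  have hm := measurable_dens x
  refine (enorm_T3_le K 2 (measurable_densLow K x) hm hm (fun i => ?_) (enorm_low_le' K x)
    (enorm_low_le' K x)).trans ?_
  · filter_upwards [enorm_low_le K x i] with ξ hξ
    exact (enorm_chi_mul_le K _ ξ).trans hξ
  · gcongr
    exact tri_five_low_le hm (measurable_densLow K x) (densLow_le K x) _
      fun ξ h => enorm_le_ofReal_of_densLow_ne_zero h

end OscNS

end

/-! ### The low-frequency form differentiated along the equation. -/

noncomputable section

namespace OscNS

open scoped SchwartzMap LineDeriv ComplexConjugate
open Filter Topology

lemma tri_const_mul_right (c : ℝ≥0∞) {F G H : R3 → ℝ≥0∞} (hF : Measurable F) (hG : Measurable G)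
    (hH : Measurable H) : tri F G (fun ξ => c * H ξ) = c * tri F G H := by
  have h : ∀ ξ, lconv G (fun ξ => c * H ξ) ξ = c * lconv G H ξ := by
    intro ξ
    unfold lconv
    rw [← lintegral_const_mul _ (by fun_prop)]
    congr with η
    ring
  have hm := measurable_lconv hG hH
  unfold tri
  rw [← lintegral_const_mul _ (by fun_prop)]
  congr with ξ
  rw [h]
  ring

lemma tri_const_mul_mid (c : ℝ≥0∞) {F G H : R3 → ℝ≥0∞} (hF : Measurable F) (hG : Measurable G)
    (hH : Measurable H) : tri F (fun ξ => c * G ξ) H = c * tri F G H := by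
  rw [tri_comm, tri_const_mul_right c hF hH hG, tri_comm]

lemma T3_add_left (K : ℝ) (s : ℕ) (x x' y z : Fin 3 → L2C) :
    T3 K s (x + x') y z = T3 K s x y z + T3 K s x' y z := by
  simp only [T3, Pi.add_apply, map_add, add_apply, Finset.sum_add_distrib]

lemma T3_add_mid (K : ℝ) (s : ℕ) (x y y' z : Fin 3 → L2C) :
    T3 K s x (y + y') z = T3 K s x y z + T3 K s x y' z := by
  simp only [T3, Pi.add_apply, map_add, add_apply, Finset.sum_add_distrib]

lemma T3_add_right (K : ℝ) (s : ℕ) (x y z z' : Fin 3 → L2C) :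
    T3 K s x y (z + z') = T3 K s x y z + T3 K s x y z' := by
  simp only [T3, Pi.add_apply, map_add, Finset.sum_add_distrib]

/-- The linear part of the drift. -/
def driftLin (R : ℝ) (x : Fin 3 → L2C) (i : Fin 3) : L2C := mulOp (chiLam R) (x i)

/-- The nonlinear part of the drift. -/
def driftNon (R β : ℝ) (x : Fin 3 → L2C) (i : Fin 3) : L2C := (β : ℂ) • nonlin R x i

lemma drift_eq (R β : ℝ) (x : Fin 3 → L2C) : drift R β x = driftLin R x + driftNon R β x := rfl

/-- The numerical constant in the bound of the linear part of the drift. -/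
def cLin : ℝ≥0 := (4 * Real.pi ^ 2).toNNReal

/-- The numerical constant in the bound of the nonlinear part of the drift. -/
def cNon : ℝ≥0 := 9 * (4 * Real.pi).toNNReal

lemma enorm_driftLin_le (K : ℝ) (x : Fin 3 → L2C) (i : Fin 3) :
    ∀ᵐ ξ, ‖driftLin K x i ξ‖ₑ ≤ cLin * ENNReal.ofReal K ^ 2 * densLow K x ξ := by
  filter_upwards [coeFn_mulOp (memLp_chiLam K) (x i)] with ξ h
  rw [driftLin, h, enorm_mul, densLow, chiLam, chi]
  split_ifs with hξ
  · rw [one_mul]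
    gcongr
    · rw [← ofReal_norm, norm_lam, ENNReal.ofReal_mul (by positivity)]
      change (cLin : ℝ≥0∞) * _ ≤ _
      gcongr
      rw [ENNReal.ofReal_pow (norm_nonneg _)]
      gcongr
    · exact enorm_le_dens x i ξ
  · simp

lemma enorm_driftNon_le {K β M : ℝ} (hβ : |β| ≤ M) (x : Fin 3 → L2C) (i : Fin 3) :
    ∀ᵐ ξ, ‖driftNon K β x i ξ‖ₑ ≤ cNon * ENNReal.ofReal M *
      (‖ξ‖ₑ * if ‖ξ‖ ≤ K then lconv (dens x) (dens x) ξ else 0) := by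
  filter_upwards [Lp.coeFn_smul (β : ℂ) (nonlin K x i), coeFn_nonlin K x i] with ξ h h'
  rw [driftNon, h, Pi.smul_apply, h', smul_eq_mul, enorm_mul]
  have hb : ‖(β : ℂ)‖ₑ ≤ ENNReal.ofReal M := by
    rw [← ofReal_norm, Complex.norm_real]
    exact ENNReal.ofReal_le_ofReal hβ
  by_cases hξ : ‖ξ‖ ≤ K
  · rw [if_pos hξ]
    have hterm : ∀ m j, ‖chi K ξ * (sig j ξ * leray i m ξ) * convFun (x j) (x m) ξ‖ₑ ≤
        ((4 * Real.pi).toNNReal : ℝ≥0∞) * ‖ξ‖ₑ * lconv (dens x) (dens x) ξ := by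
      intro m j
      rw [enorm_mul]
      gcongr
      · have h1 : ‖chi K ξ * (sig j ξ * leray i m ξ)‖ ≤ 4 * Real.pi * ‖ξ‖ := by
          rw [norm_mul, norm_mul]
          calc ‖chi K ξ‖ * (‖sig j ξ‖ * ‖leray i m ξ‖) ≤ 1 * (2 * Real.pi * ‖ξ‖ * 2) := by
                gcongr
                · exact norm_chi_le K ξ
                · exact norm_sig_le j ξ
                · exact norm_leray_le i m ξ
            _ = _ := by ring
        have h2 := ENNReal.ofReal_le_ofReal h1
        rw [ENNReal.ofReal_mul (p := 4 * Real.pi) (by positivity), ofReal_norm, ofReal_norm] at h2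
        exact h2
      · refine (enorm_convFun_le (x j) (x m) ξ).trans ?_
        unfold lconv
        gcongr
        · exact enorm_le_dens x j _
        · exact enorm_le_dens x m _
    calc ‖(β : ℂ)‖ₑ * ‖∑ m, ∑ j, chi K ξ * (sig j ξ * leray i m ξ) * convFun (x j) (x m) ξ‖ₑ
        ≤ ENNReal.ofReal M * ∑ m : Fin 3, ∑ j : Fin 3,
          ((4 * Real.pi).toNNReal : ℝ≥0∞) * ‖ξ‖ₑ * lconv (dens x) (dens x) ξ := by
          gcongr
          exact (enorm_sum_le _ _).trans (Finset.sum_le_sum fun m _ => (enorm_sum_le _ _).trans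
            (Finset.sum_le_sum fun j _ => hterm m j))
      _ = _ := by
          simp only [Finset.sum_const, Finset.card_univ, Fintype.card_fin, nsmul_eq_mul, cNon]
          push_cast
          ring
  · simp [chi, hξ]

lemma chi_bound_of_bound {R : ℝ} {y : Fin 3 → L2C} {F : R3 → ℝ≥0∞}
    (h : ∀ i, ∀ᵐ ξ, ‖y i ξ‖ₑ ≤ F ξ) (i : Fin 3) : ∀ᵐ ξ, ‖chi R ξ * y i ξ‖ₑ ≤ F ξ := by
  filter_upwards [h i] with ξ hξ
  exact (enorm_chi_mul_le R _ ξ).trans hξ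

/-- The derivative of the low-frequency trilinear form along the equation. -/
def dT3 (K β : ℝ) (x : Fin 3 → L2C) : ℝ :=
  T3 K 2 (low K x) (low K x) (drift K β x) + T3 K 2 (low K x) (drift K β x) (low K x) +
    T3 K 2 (drift K β x) (low K x) (low K x)

/-- Bound of the derivative of the low-frequency trilinear form. -/
lemma enorm_dT3_le {K β M : ℝ} (hβ : |β| ≤ M) (x : Fin 3 → L2C) :
    ‖dT3 K β x‖ₑ ≤ ENNReal.ofReal K ^ 2 *
      (12 * c0 * cLin * (mom 3 (dens x) * mom 2 (dens x) * ∫⁻ ξ, dens x ξ) +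
        36 * c0 * cNon * ENNReal.ofReal M * (mom 2 (dens x) ^ 2 * (∫⁻ ξ, dens x ξ) ^ 2)) := by
  have hm := measurable_dens x
  have hml := measurable_densLow K x
  have hq := measurable_lconv hm hm
  set α := dens x with hα
  set W := ∫⁻ ξ, α ξ with hW
  set q : R3 → ℝ≥0∞ := fun ξ => if ‖ξ‖ ≤ K then lconv α α ξ else 0 with hq_def
  have hqm : Measurable q :=
    Measurable.ite (measurableSet_le measurable_norm measurable_const) hq measurable_const
  have hqle : ∀ ξ, q ξ ≤ lconv α α ξ := fun ξ => by
    simp only [hq_def]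
    split_ifs <;> simp
  have hl := enorm_low_le K x
  have hl' := enorm_low_le' K x
  have hL := enorm_driftLin_le K x
  have hN := enorm_driftNon_le (K := K) hβ x
  have hL' : ∀ i, ∀ᵐ ξ, ‖driftLin K x i ξ‖ₑ ≤ cLin * ENNReal.ofReal K ^ 2 * α ξ := fun i => by
    filter_upwards [hL i] with ξ hξ
    refine hξ.trans ?_
    gcongr
    exact densLow_le K x ξ
  have hN' : ∀ i, ∀ᵐ ξ, ‖driftNon K β x i ξ‖ₑ ≤
      cNon * ENNReal.ofReal M * (‖ξ‖ₑ * lconv α α ξ) := fun i => by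
    filter_upwards [hN i] with ξ hξ
    refine hξ.trans ?_
    gcongr
    exact hqle ξ
  have five := tri_five_le hm
  have quart := tri_quartic_second_le hm hml (densLow_le K x) (ENNReal.ofReal K)
    fun ξ h => enorm_le_ofReal_of_densLow_ne_zero h
  have quart1 := tri_quartic_first_le (Q := q) hm hqle (ENNReal.ofReal K) fun ξ h => by
    simp only [hq_def] at h
    split_ifs at h with hξ
    · rw [← ofReal_norm]
      exact ENNReal.ofReal_le_ofReal hξ
    · exact absurd rfl h
  -- In the linear terms the truncated Laplacian costs at most a constant times K² in whichever slot
  -- it stands, and the five-derivative form remains.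
  have a1 : ‖T3 K 2 (low K x) (low K x) (driftLin K x)‖ₑ ≤
      c0 * (cLin * ENNReal.ofReal K ^ 2 * (4 * (mom 3 α * mom 2 α * W))) := by
    refine (enorm_T3_le K 2 hm hm (by fun_prop) (chi_bound_of_bound hl') hl' hL').trans ?_
    rw [tri_const_mul_right _ (by fun_prop) hm hm]
    gcongr
  have a2 : ‖T3 K 2 (low K x) (driftLin K x) (low K x)‖ₑ ≤
      c0 * (cLin * ENNReal.ofReal K ^ 2 * (4 * (mom 3 α * mom 2 α * W))) := by
    refine (enorm_T3_le K 2 hm (by fun_prop) hm (chi_bound_of_bound hl') hL' hl').trans ?_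
    rw [tri_const_mul_mid _ (by fun_prop) hm hm]
    gcongr
  have a3 : ‖T3 K 2 (driftLin K x) (low K x) (low K x)‖ₑ ≤
      c0 * (cLin * ENNReal.ofReal K ^ 2 * (4 * (mom 3 α * mom 2 α * W))) := by
    refine (enorm_T3_le K 2 (by fun_prop) hm hm (chi_bound_of_bound hL') hl' hl').trans ?_
    have e : (fun ξ : R3 => ‖ξ‖ₑ ^ (2 * 2 + 1) * (cLin * ENNReal.ofReal K ^ 2 * α ξ)) =
        fun ξ => cLin * ENNReal.ofReal K ^ 2 * (‖ξ‖ₑ ^ 5 * α ξ) := by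
      ext ξ
      ring
    rw [e, tri_const_mul _ (by fun_prop) hm hm]
    gcongr
  -- With the nonlinearity in the second or third slot, K² comes from the support of the first slot;
  -- with the nonlinearity in the first slot, from its own cutoff, which is therefore kept in q.
  have b1 : ‖T3 K 2 (low K x) (low K x) (driftNon K β x)‖ₑ ≤
      c0 * (cNon * ENNReal.ofReal M * (10 * ENNReal.ofReal K ^ 2 * (mom 2 α ^ 2 * W ^ 2))) := by
    refine (enorm_T3_le K 2 hml hm (by fun_prop) (chi_bound_of_bound hl) hl' hN').trans ?_
    rw [tri_const_mul_right _ (by fun_prop) hm (by fun_prop), tri_comm]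
    gcongr
  have b2 : ‖T3 K 2 (low K x) (driftNon K β x) (low K x)‖ₑ ≤
      c0 * (cNon * ENNReal.ofReal M * (10 * ENNReal.ofReal K ^ 2 * (mom 2 α ^ 2 * W ^ 2))) := by
    refine (enorm_T3_le K 2 hml (by fun_prop) hm (chi_bound_of_bound hl) hN' hl').trans ?_
    rw [tri_const_mul_mid _ (by fun_prop) (by fun_prop) hm]
    gcongr
  have b3 : ‖T3 K 2 (driftNon K β x) (low K x) (low K x)‖ₑ ≤
      c0 * (cNon * ENNReal.ofReal M * (16 * ENNReal.ofReal K ^ 2 * (mom 2 α ^ 2 * W ^ 2))) := by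
    refine (enorm_T3_le K 2 (F := fun ξ => cNon * ENNReal.ofReal M * (‖ξ‖ₑ * q ξ)) (by fun_prop)
      hm hm (chi_bound_of_bound hN) hl' hl').trans ?_
    have e : (fun ξ : R3 => ‖ξ‖ₑ ^ (2 * 2 + 1) * (cNon * ENNReal.ofReal M * (‖ξ‖ₑ * q ξ))) =
        fun ξ => cNon * ENNReal.ofReal M * (‖ξ‖ₑ ^ 6 * q ξ) := by
      ext ξ
      ring
    rw [e, tri_const_mul _ (by fun_prop) hm hm]
    gcongr
  have hsum : dT3 K β x = (T3 K 2 (low K x) (low K x) (driftLin K x) +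
      T3 K 2 (low K x) (low K x) (driftNon K β x)) +
      (T3 K 2 (low K x) (driftLin K x) (low K x) + T3 K 2 (low K x) (driftNon K β x) (low K x)) +
      (T3 K 2 (driftLin K x) (low K x) (low K x) + T3 K 2 (driftNon K β x) (low K x) (low K x)) := by
    rw [dT3, drift_eq, T3_add_left, T3_add_mid, T3_add_right]
  rw [hsum]
  refine (enorm_add_le _ _).trans ((add_le_add ((enorm_add_le _ _).trans (add_le_add
    ((enorm_add_le _ _).trans (add_le_add a1 b1)) ((enorm_add_le _ _).trans (add_le_add a2 b2))))
    ((enorm_add_le _ _).trans (add_le_add a3 b3))).trans (le_of_eq ?_))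
  ring

end OscNS

end

/-! ### Cancellation of the energy flux of truncated fields. -/

noncomputable section

namespace OscNS

open scoped SchwartzMap LineDeriv ComplexConjugate
open Filter Topology

/-- The symmetry of Fourier transforms of real fields. -/
def FHerm (x : Fin 3 → L2C) : Prop := ∀ i, ∀ᵐ ξ, x i (-ξ) = conj (x i ξ)

lemma FDivFree.low {x : Fin 3 → L2C} (h : FDivFree x) (K : ℝ) : FDivFree (low K x) := by
  filter_upwards [h, ae_all_iff.mpr fun i => coeFn_low K x i] with ξ h1 h2
  have : ∑ k, (ξ k : ℂ) * OscNS.low K x k ξ = chi K ξ * ∑ k, (ξ k : ℂ) * x k ξ := by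
    rw [Finset.mul_sum]
    refine Finset.sum_congr rfl fun k _ => ?_
    rw [h2]
    ring
  rw [this, h1, mul_zero]

lemma FHerm.low {x : Fin 3 → L2C} (h : FHerm x) (K : ℝ) : FHerm (low K x) := by
  intro i
  filter_upwards [h i, coeFn_low K x i,
    (Measure.measurePreserving_neg (volume : Measure R3)).quasiMeasurePreserving.ae
      (coeFn_low K x i)] with ξ h1 h2 h3
  rw [h3, h2, map_mul, conj_chi, h1]
  simp [chi]

lemma integrable_low (K : ℝ) (x : Fin 3 → L2C) (i : Fin 3) : Integrable (low K x i) := by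
  refine ((memLp_chi_two K).integrable_mul (Lp.memLp (x i))).congr ?_
  filter_upwards [coeFn_low K x i] with ξ h
  rw [h, Pi.mul_apply]

/-- The integrand of the energy flux. -/
def flux (c : Fin 3 → L2C) (m j : Fin 3) (ξ η : R3) : ℂ :=
  conj (c m ξ) * sig j ξ * (c j (ξ - η) * c m η)

/-- The integrand of the energy flux, with the derivative on the transported field. -/
def flux' (c : Fin 3 → L2C) (m j : Fin 3) (ξ η : R3) : ℂ :=
  conj (c m ξ) * sig j η * (c j (ξ - η) * c m η)

lemma stronglyMeasurable_flux (c : Fin 3 → L2C) (m j : Fin 3) :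
    StronglyMeasurable (fun p : R3 × R3 => flux c m j p.1 p.2) := by
  have hs : ∀ i, StronglyMeasurable (c i) := fun i => Lp.stronglyMeasurable (c i)
  have h1 : StronglyMeasurable fun p : R3 × R3 => conj (c m p.1) :=
    RCLike.continuous_conj.comp_stronglyMeasurable ((hs m).comp_measurable measurable_fst)
  have h2 : StronglyMeasurable fun p : R3 × R3 => sig j p.1 :=
    (measurable_sig j).stronglyMeasurable.comp_measurable measurable_fst
  exact (h1.mul h2).mul (((hs j).comp_measurable (measurable_fst.sub measurable_snd)).mul
    ((hs m).comp_measurable measurable_snd))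

/-- Truncation makes the field integrable and the derivative bounded, so the flux is absolutely
integrable and the order of integration may be exchanged. -/
lemma integrable_flux (K : ℝ) (x : Fin 3 → L2C) (m j : Fin 3) :
    Integrable (fun p : R3 × R3 => flux (low K x) m j p.1 p.2) (volume.prod volume) := by
  refine ⟨(stronglyMeasurable_flux _ m j).aestronglyMeasurable, ?_⟩
  have hmeas := (stronglyMeasurable_flux (low K x) m j).measurable.enorm
  rw [hasFiniteIntegral_iff_enorm, lintegral_prod _ hmeas.aemeasurable]
  set c := low K x with hc
  have e : ∫⁻ ξ, ∫⁻ η, ‖flux c m j ξ η‖ₑ =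
      tri (fun ξ => ‖c m ξ‖ₑ * ‖sig j ξ‖ₑ) (fun ξ => ‖c j ξ‖ₑ) (fun ξ => ‖c m ξ‖ₑ) := by
    unfold tri lconv
    congr with ξ
    have h := measurable_enorm_coe (c j)
    have h' := measurable_enorm_coe (c m)
    rw [← lintegral_const_mul _ (by fun_prop)]
    congr with η
    simp only [flux, enorm_mul, RCLike.enorm_conj]
  rw [e]
  have hsig := (measurable_sig j).enorm
  have hcm := measurable_enorm_coe (c m)
  have hcj := measurable_enorm_coe (c j)
  refine (tri_le (by fun_prop) hcj hcm).trans_lt ?_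
  have h1 : l2 (fun ξ => ‖c m ξ‖ₑ * ‖sig j ξ‖ₑ) < ⊤ := by
    have hmem : MemLp (fun ξ => chi K ξ * sig j ξ) ∞ volume := by
      have hC : 0 ≤ 2 * Real.pi * |K| := by
        have := abs_nonneg K
        positivity
      refine memLp_infty_of_bound ((measurable_chi K).mul (measurable_sig j))
        (2 * Real.pi * |K|) fun ξ => norm_chi_mul_le hC fun h => ?_
      exact (norm_sig_le j ξ).trans (by gcongr; exact h.trans (le_abs_self K))
    have : l2 (fun ξ => ‖c m ξ‖ₑ * ‖sig j ξ‖ₑ) = ‖mulOp (fun ξ => chi K ξ * sig j ξ) (x m)‖ₑ := by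
      rw [enorm_eq_l2]
      unfold l2
      congr 1
      refine lintegral_congr_ae ?_
      filter_upwards [coeFn_mulOp hmem (x m), coeFn_low K x m] with ξ h1 h2
      rw [h1, h2, enorm_mul, enorm_mul, enorm_mul]
      ring
    rw [this]
    exact enorm_lt_top
  have h2 : l2 (fun ξ => ‖c j ξ‖ₑ) < ⊤ := by
    rw [← enorm_eq_l2]
    exact enorm_lt_top
  exact ENNReal.mul_lt_top (ENNReal.mul_lt_top h1 h2) (integrable_low K x m).2

lemma conj_sig (j : Fin 3) (ξ : R3) : conj (sig j ξ) = -sig j ξ := by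
  have h : conj (2 : ℂ) = 2 := map_ofNat (starRingEnd ℂ) 2
  simp [sig, h]

lemma sig_sub (j : Fin 3) (ξ η : R3) : sig j (ξ - η) = sig j ξ - sig j η := by
  simp only [sig, PiLp.sub_apply]
  push_cast
  ring

/-- Exchanging the two frequencies reflects the transporting field, which Hermitian symmetry turns
into a conjugation; the sign comes from the imaginary symbol. -/
lemma flux'_swap {c : Fin 3 → L2C} (hc : FHerm c) (η : R3) :
    ∀ᵐ ξ, ∀ m j, flux' c m j η ξ = -conj (flux c m j ξ η) := by
  have h : ∀ᵐ ξ, ∀ j, c j (η - ξ) = conj (c j (ξ - η)) := by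
    have h1 := ae_all_iff.mpr fun j => hc j
    have h2 := (measurePreserving_sub_right (volume : Measure R3) η).quasiMeasurePreserving.ae h1
    filter_upwards [h2] with ξ hξ j
    rw [← hξ j, neg_sub]
  filter_upwards [h] with ξ hξ m j
  simp only [flux', flux, hξ, map_mul, conj_sig, Complex.conj_conj]
  ring

/-- The two integrands differ by the symbol at ξ - η contracted with c(ξ - η), that is, by the
divergence of the transporting field. -/
lemma sum_flux_eq {c : Fin 3 → L2C} (hc : FDivFree c) (m : Fin 3) (ξ : R3) :
    ∀ᵐ η, ∑ j, flux c m j ξ η = ∑ j, flux' c m j ξ η := by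
  filter_upwards [(measurePreserving_const_sub ξ).quasiMeasurePreserving.ae hc.sum_sig] with η h
  simp only [sig_sub] at h
  rw [← sub_eq_zero, ← Finset.sum_sub_distrib]
  have e : ∀ j, flux c m j ξ η - flux' c m j ξ η =
      conj (c m ξ) * c m η * ((sig j ξ - sig j η) * c j (ξ - η)) := fun j => by
    unfold flux flux'
    ring
  simp only [e]
  rw [← Finset.mul_sum, h, mul_zero]

/-- The total energy flux of a band-limited solenoidal field is purely imaginary. -/
lemma re_integral_flux_eq_zero (K : ℝ) {x : Fin 3 → L2C} (hd : FDivFree x) (hh : FHerm x) :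
    (∫ ξ, ∫ η, ∑ m, ∑ j, flux (low K x) m j ξ η).re = 0 := by
  set c := low K x with hc
  have hd' : FDivFree c := hd.low K
  have hh' : FHerm c := hh.low K
  have hint : Integrable (fun p : R3 × R3 => ∑ m, ∑ j, flux c m j p.1 p.2)
      (volume.prod volume) :=
    integrable_finsetSum _ fun m _ => integrable_finsetSum _ fun j _ => integrable_flux K x m j
  have h1 : ∫ ξ, ∫ η, ∑ m, ∑ j, flux c m j ξ η = ∫ ξ, ∫ η, ∑ m, ∑ j, flux' c m j ξ η := by
    refine integral_congr_ae (Eventually.of_forall fun ξ => integral_congr_ae ?_)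
    filter_upwards [ae_all_iff.mpr fun m => sum_flux_eq hd' m ξ] with η h
    exact Finset.sum_congr rfl fun m _ => h m
  have h2 : ∫ η, ∫ ξ, ∑ m, ∑ j, flux' c m j η ξ =
      -conj (∫ ξ, ∫ η, ∑ m, ∑ j, flux c m j ξ η) := by
    conv_rhs => rw [integral_integral_swap hint, ← integral_conj, ← integral_neg]
    refine integral_congr_ae (Eventually.of_forall fun η => ?_)
    dsimp only
    rw [← integral_conj, ← integral_neg]
    refine integral_congr_ae ?_
    filter_upwards [flux'_swap hh' η] with ξ h
    simp only [h, map_sum, Finset.sum_neg_distrib]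
  -- The flux I satisfies I = -conj I.
  have h3 := congrArg Complex.re (h1.trans h2)
  simp only [Complex.neg_re, Complex.conj_re] at h3
  linarith

lemma sum_conj_mul_leray {c : Fin 3 → ℂ} {ξ : R3} (h : ∑ k, (ξ k : ℂ) * c k = 0) (m : Fin 3) :
    ∑ i, conj (c i) * leray i m ξ = conj (c m) := by
  have h' := congrArg conj h
  simp only [map_sum, map_mul, Complex.conj_ofReal, map_zero] at h'
  have e : ∀ i, conj (c i) * leray i m ξ =
      (if i = m then conj (c i) else 0) - (ξ m / ‖ξ‖ ^ 2 : ℝ) * ((ξ i : ℂ) * conj (c i)) := by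
    intro i
    unfold leray
    push_cast
    split_ifs <;> ring
  simp only [e, Finset.sum_sub_distrib]
  rw [← Finset.mul_sum, h']
  simp

/-- Against a divergence-free field the Leray projection acts as the identity, so the form of order
zero is the real part of the total flux. -/
lemma T3_zero_low_eq_zero (K : ℝ) {x : Fin 3 → L2C} (hd : FDivFree x) (hh : FHerm x) :
    T3 K 0 (low K x) (low K x) (low K x) = 0 := by
  rw [← re_integral_flux_eq_zero K hd hh, T3_self]
  set c := low K x with hc
  have hd' : FDivFree c := hd.low K
  simp only [reInner_apply, ← Complex.re_sum]
  congr 1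
  simp only [L2.inner_def]
  rw [← integral_finsetSum _ fun i _ => L2.integrable_inner _ _]
  refine integral_congr_ae ?_
  filter_upwards [hd', ae_all_iff.mpr fun i => coeFn_mulOp (memLp_wt K (2 * 0)) (c i),
    ae_all_iff.mpr fun i => coeFn_nonlin K c i, ae_all_iff.mpr fun i => coeFn_low K x i]
    with ξ h1 h2 h3 h4
  have hchi : ∀ i, chi K ξ * c i ξ = c i ξ := fun i => by
    rw [hc, h4, ← mul_assoc, chi_mul_chi]
  have hflux : ∫ η, ∑ m, ∑ j, flux c m j ξ η =
      ∑ m, ∑ j, conj (c m ξ) * sig j ξ * convFun (c j) (c m) ξ := by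
    have hi : ∀ m j, Integrable (fun η => flux c m j ξ η) := fun m j =>
      (integrable_conv (c j) (c m) ξ).const_mul _
    rw [integral_finsetSum _ fun m _ => integrable_finsetSum _ fun j _ => hi m j]
    refine Finset.sum_congr rfl fun m _ => ?_
    rw [integral_finsetSum _ fun j _ => hi m j]
    exact Finset.sum_congr rfl fun j _ => integral_const_mul _ _
  rw [hflux]
  simp only [RCLike.inner_apply, h2, h3, map_mul, conj_wt]
  have hw : wt K (2 * 0) ξ = chi K ξ := by simp [wt]
  have hterm : ∀ i, (∑ m, ∑ j, chi K ξ * (sig j ξ * leray i m ξ) * convFun (c j) (c m) ξ) *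
      (wt K (2 * 0) ξ * conj (c i ξ)) =
      ∑ m, ∑ j, chi K ξ * (sig j ξ * convFun (c j) (c m) ξ) * (conj (c i ξ) * leray i m ξ) := by
    intro i
    rw [Finset.sum_mul]
    refine Finset.sum_congr rfl fun m _ => ?_
    rw [Finset.sum_mul]
    refine Finset.sum_congr rfl fun j _ => ?_
    have := chi_mul_chi K ξ
    rw [hw]
    linear_combination (sig j ξ * leray i m ξ * convFun (c j) (c m) ξ * conj (c i ξ)) * this
  simp only [hterm]
  rw [Finset.sum_comm]
  refine Finset.sum_congr rfl fun m _ => ?_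
  rw [Finset.sum_comm]
  refine Finset.sum_congr rfl fun j _ => ?_
  rw [← Finset.mul_sum, sum_conj_mul_leray h1]
  have h5 := congrArg conj (hchi m)
  rw [map_mul, conj_chi] at h5
  linear_combination (sig j ξ * convFun (c j) (c m) ξ) * h5

lemma hat_fherm (f : Field3) : FHerm (hat f) := fun i => hat_neg f i

end OscNS

end

/-! ### Homogeneous norms and removal of the truncation. -/

noncomputable section

namespace OscNS

open scoped SchwartzMap LineDeriv ComplexConjugate
open Filter Topology

/-- The squared homogeneous norm `∑ᵢ ∫ |ξ|^{2k} |xᵢ(ξ)|² dξ`. -/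
def hsq (k : ℕ) (x : Fin 3 → L2C) : ℝ≥0∞ := ∑ i, ∫⁻ ξ : R3, ‖ξ‖ₑ ^ (2 * k) * ‖x i ξ‖ₑ ^ 2

lemma homNorm_sq (k : ℕ) (f : Field3) :
    homNorm k f ^ 2 = ENNReal.ofReal ((2 * Real.pi) ^ (2 * k)) * hsq k (hat f) := by
  rw [homNorm, ← ENNReal.rpow_natCast, ← ENNReal.rpow_mul]
  norm_num
  rw [hsq, Finset.mul_sum]
  refine Finset.sum_congr rfl fun i _ => ?_
  rw [← lintegral_const_mul' _ _ ENNReal.ofReal_ne_top]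
  congr with ξ
  rw [mul_pow, ENNReal.ofReal_mul (by positivity), ENNReal.ofReal_pow (norm_nonneg ξ), ofReal_norm,
    mul_assoc]
  rfl

lemma hsq_le_homNorm_sq (k : ℕ) (f : Field3) : hsq k (hat f) ≤ homNorm k f ^ 2 := by
  rw [homNorm_sq]
  refine le_mul_of_one_le_left zero_le ?_
  rw [← ENNReal.ofReal_one]
  refine ENNReal.ofReal_le_ofReal (one_le_pow₀ ?_)
  linarith [Real.pi_gt_three]

lemma homNorm_le_sobNorm (k : ℕ) (f : Field3) : homNorm k f ≤ sobNorm k f := by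
  unfold homNorm sobNorm
  gcongr with i _ ξ
  rw [pow_mul]
  gcongr
  linarith

lemma hsq_eq_lintegral (k : ℕ) (x : Fin 3 → L2C) :
    hsq k x = ∫⁻ ξ : R3, ‖ξ‖ₑ ^ (2 * k) * ∑ i, ‖x i ξ‖ₑ ^ 2 := by
  have := fun i => measurable_enorm_coe (x i)
  simp only [Finset.mul_sum]
  rw [lintegral_finsetSum _ fun i _ => by fun_prop, hsq]

lemma mom_dens_sq_le (k : ℕ) (x : Fin 3 → L2C) : mom k (dens x) ^ 2 ≤ 3 * hsq k x := by
  rw [mom_sq, hsq_eq_lintegral, ← lintegral_const_mul' _ _ (by norm_num)]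
  refine lintegral_mono fun ξ => ?_
  have h : dens x ξ ^ 2 ≤ 3 * ∑ i, ‖x i ξ‖ₑ ^ 2 := by
    have h1 := ENNReal.inner_le_Lp_mul_Lq (s := Finset.univ) (fun i : Fin 3 => ‖x i ξ‖ₑ)
      (fun _ => 1) Real.HolderConjugate.two_two
    simp only [mul_one, ENNReal.one_rpow, Finset.sum_const, Finset.card_univ, Fintype.card_fin,
      nsmul_eq_mul] at h1
    have h2 := pow_le_pow_left' h1 2
    rw [mul_pow, ← ENNReal.rpow_natCast, ← ENNReal.rpow_natCast, ← ENNReal.rpow_natCast,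
      ← ENNReal.rpow_mul, ← ENNReal.rpow_mul] at h2
    norm_num at h2
    rw [mul_comm]
    exact h2
  calc ‖ξ‖ₑ ^ (2 * k) * dens x ξ ^ 2 ≤ ‖ξ‖ₑ ^ (2 * k) * (3 * ∑ i, ‖x i ξ‖ₑ ^ 2) := by gcongr
    _ = _ := by ring

lemma hsq_le_mom_dens_sq (k : ℕ) (x : Fin 3 → L2C) : hsq k x ≤ mom k (dens x) ^ 2 := by
  rw [mom_sq, hsq_eq_lintegral]
  refine lintegral_mono fun ξ => ?_
  dsimp only
  gcongr
  rw [sq, dens, Finset.sum_mul]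
  refine Finset.sum_le_sum fun i _ => ?_
  rw [sq]
  gcongr
  exact enorm_le_dens x i ξ

lemma ofReal_energy (R : ℝ) (k : ℕ) (x : Fin 3 → L2C) : ENNReal.ofReal (energy R k x) =
    ∑ i, ∫⁻ ξ : R3, if ‖ξ‖ ≤ R then ‖ξ‖ₑ ^ (2 * k) * ‖x i ξ‖ₑ ^ 2 else 0 := by
  rw [energy, ENNReal.ofReal_sum_of_nonneg fun _ _ => sq_nonneg _]
  refine Finset.sum_congr rfl fun i _ => ?_
  rw [ENNReal.ofReal_pow (norm_nonneg _), ofReal_norm, enorm_eq_l2, l2_sq]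
  refine lintegral_congr_ae ?_
  filter_upwards [coeFn_mulOp (memLp_wt R k) (x i)] with ξ h
  rw [h, wt, chi]
  split_ifs with hξ
  · rw [one_mul, enorm_mul, mul_pow, ← ofReal_norm ((‖ξ‖ ^ k : ℝ) : ℂ), Complex.norm_real,
      norm_pow, norm_norm, ENNReal.ofReal_pow (norm_nonneg _), ofReal_norm, ← pow_mul, mul_comm k]
  · simp

lemma measurable_energy_integrand (R : ℝ) (k : ℕ) (x : Fin 3 → L2C) (i : Fin 3) :
    Measurable fun ξ : R3 => if ‖ξ‖ ≤ R then ‖ξ‖ₑ ^ (2 * k) * ‖x i ξ‖ₑ ^ 2 else 0 := by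
  have := measurable_enorm_coe (x i)
  exact Measurable.ite (measurableSet_le measurable_norm measurable_const) (by fun_prop)
    measurable_const

lemma ofReal_energy_le (R : ℝ) (k : ℕ) (x : Fin 3 → L2C) :
    ENNReal.ofReal (energy R k x) ≤ hsq k x := by
  rw [ofReal_energy]
  refine Finset.sum_le_sum fun i _ => lintegral_mono fun ξ => ?_
  dsimp only
  split_ifs <;> simp

lemma ofReal_energy_mono {R S : ℝ} (h : R ≤ S) (k : ℕ) (x : Fin 3 → L2C) :
    ENNReal.ofReal (energy R k x) ≤ ENNReal.ofReal (energy S k x) := by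
  rw [ofReal_energy, ofReal_energy]
  refine Finset.sum_le_sum fun i _ => lintegral_mono fun ξ => ?_
  dsimp only
  split_ifs with h1 h2
  · rfl
  · exact absurd (h1.trans h) h2
  · exact zero_le
  · rfl

lemma tendsto_energy (k : ℕ) (x : Fin 3 → L2C) :
    Tendsto (fun n : ℕ => ENNReal.ofReal (energy n k x)) atTop (𝓝 (hsq k x)) := by
  simp only [ofReal_energy]
  refine tendsto_finsetSum _ fun i _ => ?_
  refine lintegral_tendsto_of_tendsto_of_monotone
    (fun n => (measurable_energy_integrand n k x i).aemeasurable) ?_ ?_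
  · refine Eventually.of_forall fun ξ n m hnm => ?_
    dsimp only
    split_ifs with h1 h2
    · rfl
    · exact absurd (h1.trans (by exact_mod_cast hnm)) h2
    · exact zero_le
    · rfl
  · refine Eventually.of_forall fun ξ => ?_
    obtain ⟨n, hn⟩ := exists_nat_ge ‖ξ‖
    refine tendsto_const_nhds.congr' ?_
    filter_upwards [eventually_ge_atTop n] with m hm
    rw [if_pos (hn.trans (by exact_mod_cast hm))]

section

variable {b : ℝ → ℝ} {M N T : ℝ} {u₀ : Field3} {u : ℝ → Field3}

lemma aemeasurable_energy (hS : IsSolution b N u₀ T u) (R : ℝ) (k : ℕ) :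
    AEMeasurable (fun t => ENNReal.ofReal (energy R k (hat (u t))))
      (volume.restrict (Ioo 0 T)) := by
  refine AEMeasurable.ennreal_ofReal ?_
  unfold energy
  refine Finset.aemeasurable_fun_sum _ fun i _ => ?_
  have h := ((mulOp (wt R k)).continuous.comp_aestronglyMeasurable (hS.memLp_hat i).1).norm
  exact h.aemeasurable.pow_const 2

lemma aemeasurable_hsq (hS : IsSolution b N u₀ T u) (k : ℕ) :
    AEMeasurable (fun t => hsq k (hat (u t))) (volume.restrict (Ioo 0 T)) :=
  aemeasurable_of_tendsto_metrizable_ae atTop (fun n : ℕ => aemeasurable_energy hS n k)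
    (Eventually.of_forall fun t => tendsto_energy k (hat (u t)))

/-- The energy inequality at a fixed truncation. -/
lemma energy_add_integral_le (hb : IsOscillating M b) (hM : 0 < M) (hN : 0 < N)
    (hS : IsSolution b N u₀ T u) (R : ℝ) (s : ℕ) {t : ℝ} (ht : t ∈ Icc 0 T) {Q : ℝ≥0∞}
    (hQ : ‖∫ τ in (0 : ℝ)..t, b (N * τ) * T3 R s (hat (u τ)) (hat (u τ)) (hat (u τ))‖ₑ ≤ Q) :
    ENNReal.ofReal (energy R s fun i => path b N u₀ u R i t) +
      ∫⁻ τ in Ioc 0 t, ENNReal.ofReal (energy R (s + 1) (hat (u τ))) ≤ hsq s (hat u₀) + 2 * Q := by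
  have hp := isPrim_energy hb hM hN hS R s
  have h1 := hp.eq t ht
  rw [energy_path_zero] at h1
  have h0 : (0 : ℝ) ∈ Icc 0 T := ⟨le_rfl, ht.1.trans ht.2⟩
  have hE : MemLp (fun t => energy R (s + 1) (hat (u t))) ∞ (volume.restrict (Ioo 0 T)) := by
    unfold energy
    refine memLp_finsetSum _ fun i _ => ?_
    have := memLp_mulOp (m := wt R (s + 1)) (hS.memLp_hat i)
    simpa only [reInner_self] using reInner.memLp_of_bilin ∞ this this
  have hiE := intervalIntegrable_of_memLp (hE.const_mul (-(8 * Real.pi ^ 2))) h0 ht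
  have hiT : IntervalIntegrable (fun τ => 2 *
      (b (N * τ) * T3 R s (hat (u τ)) (hat (u τ)) (hat (u τ)))) volume 0 t := by
    have := intervalIntegrable_of_memLp (hp.memLp.sub (hE.const_mul (-(8 * Real.pi ^ 2)))) h0 ht
    refine this.congr fun τ _ => ?_
    simp only [Pi.sub_apply, add_sub_cancel_left]
  rw [intervalIntegral.integral_add hiE hiT, intervalIntegral.integral_const_mul,
    intervalIntegral.integral_const_mul] at h1
  set J := ∫ τ in (0 : ℝ)..t, b (N * τ) * T3 R s (hat (u τ)) (hat (u τ)) (hat (u τ)) with hJ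
  have hD : ∫⁻ τ in Ioc 0 t, ENNReal.ofReal (energy R (s + 1) (hat (u τ))) =
      ENNReal.ofReal (∫ τ in (0 : ℝ)..t, energy R (s + 1) (hat (u τ))) := by
    rw [intervalIntegral.integral_of_le ht.1, ofReal_integral_eq_lintegral_ofReal]
    · exact (intervalIntegrable_iff_integrableOn_Ioc_of_le ht.1).mp
        (intervalIntegrable_of_memLp hE h0 ht)
    · exact Eventually.of_forall fun τ => energy_nonneg _ _ _
  have hD0 : 0 ≤ ∫ τ in (0 : ℝ)..t, energy R (s + 1) (hat (u τ)) :=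
    intervalIntegral.integral_nonneg ht.1 fun τ _ => energy_nonneg _ _ _
  rw [hD, ← ENNReal.ofReal_add (energy_nonneg _ _ _) hD0]
  have hle : energy R s (fun i => path b N u₀ u R i t) +
      ∫ τ in (0 : ℝ)..t, energy R (s + 1) (hat (u τ)) ≤ energy R s (hat u₀) + 2 * ‖J‖ := by
    have h2 : J ≤ ‖J‖ := Real.le_norm_self J
    -- The dissipation constant 8π² is lowered to 1; only an upper bound is sought.
    have h3 : 1 ≤ 8 * Real.pi ^ 2 := by nlinarith [Real.pi_gt_three]
    have h4 := mul_le_mul_of_nonneg_right h3 hD0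
    linarith
  refine (ENNReal.ofReal_le_ofReal hle).trans ?_
  rw [ENNReal.ofReal_add (energy_nonneg _ _ _) (by positivity), ENNReal.ofReal_mul zero_le_two,
    ofReal_norm]
  refine add_le_add (ofReal_energy_le R s _) ?_
  rw [ENNReal.ofReal_ofNat]
  gcongr

/-- The energy inequality, after removal of the truncation. -/
theorem hsq_bounds (hb : IsOscillating M b) (hM : 0 < M) (hN : 0 < N) (hT : 0 < T)
    (hS : IsSolution b N u₀ T u) (s : ℕ) {Q : ℕ → ℝ≥0∞} {A : ℝ≥0∞}
    (hQA : Tendsto Q atTop (𝓝 A))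
    (hQ : ∀ᶠ n : ℕ in atTop, ∀ t ∈ Icc 0 T,
      ‖∫ τ in (0 : ℝ)..t, b (N * τ) * T3 n s (hat (u τ)) (hat (u τ)) (hat (u τ))‖ₑ ≤ Q n) :
    (∀ᵐ t ∂(volume.restrict (Ioo 0 T)), hsq s (hat (u t)) ≤ hsq s (hat u₀) + 2 * A) ∧
      ∫⁻ t in Ioo 0 T, hsq (s + 1) (hat (u t)) ≤ hsq s (hat u₀) + 2 * A := by
  have hlim : Tendsto (fun n => hsq s (hat u₀) + 2 * Q n) atTop (𝓝 (hsq s (hat u₀) + 2 * A)) :=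
    tendsto_const_nhds.add (ENNReal.Tendsto.const_mul hQA (Or.inr (by norm_num)))
  constructor
  · filter_upwards [ae_all_iff.mpr fun n : ℕ => mulOp_chi_eq_path hb hM hN hS n,
      ae_restrict_mem measurableSet_Ioo] with t ht htT
    refine le_of_tendsto_of_tendsto (tendsto_energy s (hat (u t))) hlim ?_
    filter_upwards [hQ] with n hn
    have h := energy_add_integral_le hb hM hN hS n s (Ioo_subset_Icc_self htT)
      (hn t (Ioo_subset_Icc_self htT))
    simp only [← ht n] at h
    refine le_trans (le_of_eq ?_) (le_self_add.trans h)
    simp only [energy, mulOp_wt_mulOp_chi]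
  · have h1 : Tendsto (fun n : ℕ => ∫⁻ t in Ioo 0 T, ENNReal.ofReal (energy n (s + 1) (hat (u t))))
        atTop (𝓝 (∫⁻ t in Ioo 0 T, hsq (s + 1) (hat (u t)))) :=
      lintegral_tendsto_of_tendsto_of_monotone (fun n => aemeasurable_energy hS n (s + 1))
        (Eventually.of_forall fun t n m hnm => ofReal_energy_mono (by exact_mod_cast hnm) _ _)
        (Eventually.of_forall fun t => tendsto_energy _ _)
    refine le_of_tendsto_of_tendsto h1 hlim ?_
    filter_upwards [hQ] with n hn
    have h := energy_add_integral_le hb hM hN hS n s (right_mem_Icc.mpr hT.le)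
      (hn T (right_mem_Icc.mpr hT.le))
    rw [← Measure.restrict_congr_set Ioo_ae_eq_Ioc] at h
    exact le_add_self.trans h

end

end OscNS

end

/-! ### Integration by parts in time and the basic energy inequality. -/

noncomputable section

namespace OscNS

open scoped SchwartzMap LineDeriv ComplexConjugate
open Filter Topology

lemma enorm_intervalIntegral_le {T t : ℝ} (ht : t ∈ Icc 0 T) (f : ℝ → ℝ) :
    ‖∫ τ in (0 : ℝ)..t, f τ‖ₑ ≤ ∫⁻ τ in Ioo 0 T, ‖f τ‖ₑ := by
  rw [intervalIntegral.integral_of_le ht.1, Measure.restrict_congr_set Ioo_ae_eq_Ioc]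
  exact (enorm_integral_le_lintegral_enorm _).trans
    (lintegral_mono_set (Ioc_subset_Ioc_right ht.2))

/-- An a.e. bound of a continuous function holds everywhere. -/
lemma enorm_le_of_ae_le {T : ℝ} (hT : 0 < T) {g : ℝ → ℝ} (hg : ContinuousOn g (Icc 0 T))
    {C : ℝ≥0∞} (h : ∀ᵐ t ∂(volume.restrict (Ioo 0 T)), ‖g t‖ₑ ≤ C) {t : ℝ} (ht : t ∈ Icc 0 T) :
    ‖g t‖ₑ ≤ C := by
  rw [ae_restrict_iff' measurableSet_Ioo] at h
  have hd := Measure.dense_of_ae h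
  have h1 : Ioo 0 T ⊆ closure (Ioo 0 T ∩ {t | t ∈ Ioo 0 T → ‖g t‖ₑ ≤ C}) :=
    hd.open_subset_closure_inter isOpen_Ioo
  have h2 : IsClosed (Icc 0 T ∩ g ⁻¹' {r | ‖r‖ₑ ≤ C}) :=
    hg.preimage_isClosed_of_isClosed isClosed_Icc
      (isClosed_le continuous_enorm continuous_const)
  have h3 : closure (Ioo 0 T) ⊆ Icc 0 T ∩ g ⁻¹' {r | ‖r‖ₑ ≤ C} := by
    refine (closure_minimal h1 isClosed_closure).trans (closure_minimal ?_ h2)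
    exact fun s hs => ⟨Ioo_subset_Icc_self hs.1, hs.2 hs.1⟩
  rw [closure_Ioo hT.ne] at h3
  exact (h3 ht).2

section

variable {b : ℝ → ℝ} {M N T : ℝ} {u₀ : Field3} {u : ℝ → Field3}

lemma memLp_T3 (K : ℝ) (s : ℕ) {x y z : ℝ → Fin 3 → L2C}
    (hx : ∀ i, MemLp (fun t => x t i) ∞ (volume.restrict (Ioo 0 T)))
    (hy : ∀ i, MemLp (fun t => y t i) ∞ (volume.restrict (Ioo 0 T)))
    (hz : ∀ i, MemLp (fun t => z t i) ∞ (volume.restrict (Ioo 0 T))) :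
    MemLp (fun t => T3 K s (x t) (y t) (z t)) ∞ (volume.restrict (Ioo 0 T)) :=
  memLp_finsetSum _ fun i _ => memLp_finsetSum _ fun m _ => memLp_finsetSum _ fun j _ =>
    reInner.memLp_of_bilin ∞ (memLp_mulOp (hx i)) (memLp_convOp (hy j) (hz m))

/-- The time integral of the oscillating low-frequency form, after integration by parts. -/
lemma enorm_integral_osc_low_le (hb : IsOscillating M b) (hM : 0 < M) (hN : 0 < N) (hT : 0 < T)
    (hS : IsSolution b N u₀ T u) (K : ℝ) {P : ℝ≥0∞}
    (hP : ∀ᵐ t ∂(volume.restrict (Ioo 0 T)),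
      ‖T3 K 2 (low K (hat (u t))) (low K (hat (u t))) (low K (hat (u t)))‖ₑ ≤ P)
    {t : ℝ} (ht : t ∈ Icc 0 T) :
    ‖∫ τ in (0 : ℝ)..t, b (N * τ) *
        T3 K 2 (low K (hat (u τ))) (low K (hat (u τ))) (low K (hat (u τ)))‖ₑ ≤
      ENNReal.ofReal (M / N) * (P + ∫⁻ τ in Ioo 0 T, ‖dT3 K (b (N * τ)) (hat (u τ))‖ₑ) := by
  set c : ℝ → Fin 3 → L2C := fun t i => path b N u₀ u K i t with hc
  have hae : ∀ᵐ t ∂(volume.restrict (Ioo 0 T)), low K (hat (u t)) = c t := by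
    filter_upwards [mulOp_chi_eq_path hb hM hN hS K] with t h
    exact funext h
  have hpath : ∀ i, IsPrim T (fun t => c t i) (fun t => drift K (b (N * t)) (hat (u t)) i) :=
    isPrim_path hb hM hN hS K
  have hF : IsPrim T (fun t => T3 K 2 (c t) (c t) (c t)) (fun t => dT3 K (b (N * t)) (hat (u t))) :=
    (IsPrim.T3 K 2 hpath hpath hpath).congr_deriv (by
      filter_upwards [hae] with t h
      rw [dT3, h])
  have hB := isPrim_oscPrim (T := T) hb hM hN
  -- Integration by parts of b(Nτ) against the low-frequency form along the path; the boundary term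
  -- at 0 vanishes with the primitive.
  have hBF := IsPrim.bilin (ContinuousLinearMap.mul ℝ ℝ) hB hF
  have h0 : (0 : ℝ) ∈ Icc 0 T := ⟨le_rfl, hT.le⟩
  have hB0 : oscPrim b N 0 = 0 := by simp [oscPrim]
  have hi1 : IntervalIntegrable (fun τ => oscPrim b N τ * dT3 K (b (N * τ)) (hat (u τ)))
      volume 0 t := intervalIntegrable_of_memLp (hF.memLp.mul hB.memLp_self) h0 ht
  have hi2 : IntervalIntegrable (fun τ => b (N * τ) * T3 K 2 (c τ) (c τ) (c τ)) volume 0 t :=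
    intervalIntegrable_of_memLp (hF.memLp_self.mul hB.memLp) h0 ht
  have h1 := hBF.eq t ht
  simp only [ContinuousLinearMap.mul_apply', hB0, zero_mul, zero_add] at h1
  rw [intervalIntegral.integral_add hi1 hi2] at h1
  have h2 : ∫ τ in (0 : ℝ)..t, b (N * τ) *
      T3 K 2 (low K (hat (u τ))) (low K (hat (u τ))) (low K (hat (u τ))) =
      oscPrim b N t * T3 K 2 (c t) (c t) (c t) -
        ∫ τ in (0 : ℝ)..t, oscPrim b N τ * dT3 K (b (N * τ)) (hat (u τ)) := by
    rw [h1, add_sub_cancel_left]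
    refine integral_congr_of_ae ?_ h0 ht
    filter_upwards [hae] with τ h
    rw [h]
  have hbound : ∀ s, 0 ≤ s → ‖oscPrim b N s‖ₑ ≤ ENNReal.ofReal (M / N) := fun s hs => by
    rw [← ofReal_norm]
    exact ENNReal.ofReal_le_ofReal (abs_oscPrim_le hb hM hN hs)
  rw [h2, mul_add]
  refine (enorm_sub_le).trans (add_le_add ?_ ?_)
  · rw [enorm_mul]
    -- The bound P is known for almost every time; continuity along the path gives it at t.
    refine mul_le_mul' (hbound t ht.1) (enorm_le_of_ae_le hT hF.continuousOn ?_ ht)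
    filter_upwards [hae, hP] with s h h'
    rwa [← h]
  · refine (enorm_intervalIntegral_le ht _).trans ?_
    rw [← lintegral_const_mul' _ _ ENNReal.ofReal_ne_top]
    refine lintegral_mono_ae ?_
    filter_upwards [ae_restrict_mem measurableSet_Ioo] with τ hτ
    rw [enorm_mul]
    gcongr
    exact hbound τ hτ.1.le

/-- The time integral of the oscillating trilinear form. -/
lemma enorm_integral_osc_le (hb : IsOscillating M b) (hM : 0 < M) (hN : 0 < N) (hT : 0 < T)
    (hS : IsSolution b N u₀ T u) (K R : ℝ) (hKR : K ≤ R) {P : ℝ≥0∞}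
    (hP : ∀ᵐ t ∂(volume.restrict (Ioo 0 T)),
      ‖T3 K 2 (low K (hat (u t))) (low K (hat (u t))) (low K (hat (u t)))‖ₑ ≤ P)
    {t : ℝ} (ht : t ∈ Icc 0 T) :
    ‖∫ τ in (0 : ℝ)..t, b (N * τ) * T3 R 2 (hat (u τ)) (hat (u τ)) (hat (u τ))‖ₑ ≤
      ENNReal.ofReal M * (∫⁻ τ in Ioo 0 T, ‖T3 R 2 (hat (u τ)) (hat (u τ)) (hat (u τ)) -
        T3 R 2 (low K (hat (u τ))) (low K (hat (u τ))) (low K (hat (u τ)))‖ₑ) +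
      ENNReal.ofReal (M / N) * (P + ∫⁻ τ in Ioo 0 T, ‖dT3 K (b (N * τ)) (hat (u τ))‖ₑ) := by
  have h0 : (0 : ℝ) ∈ Icc 0 T := ⟨le_rfl, hT.le⟩
  have hlow : ∀ i, MemLp (fun t => low K (hat (u t)) i) ∞ (volume.restrict (Ioo 0 T)) :=
    fun i => memLp_mulOp (hS.memLp_hat i)
  have hbm := hb.memLp (T := T) hM hN
  have hi1 : IntervalIntegrable (fun τ => b (N * τ) *
      T3 R 2 (hat (u τ)) (hat (u τ)) (hat (u τ))) volume 0 t :=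
    intervalIntegrable_of_memLp ((memLp_T3 R 2 hS.memLp_hat hS.memLp_hat hS.memLp_hat).mul hbm)
      h0 ht
  have hi2 : IntervalIntegrable (fun τ => b (N * τ) *
      T3 R 2 (low K (hat (u τ))) (low K (hat (u τ))) (low K (hat (u τ)))) volume 0 t :=
    intervalIntegrable_of_memLp ((memLp_T3 R 2 hlow hlow hlow).mul hbm) h0 ht
  have e : ∫ τ in (0 : ℝ)..t, b (N * τ) * T3 R 2 (hat (u τ)) (hat (u τ)) (hat (u τ)) =
      (∫ τ in (0 : ℝ)..t, b (N * τ) * (T3 R 2 (hat (u τ)) (hat (u τ)) (hat (u τ)) -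
        T3 R 2 (low K (hat (u τ))) (low K (hat (u τ))) (low K (hat (u τ))))) +
      ∫ τ in (0 : ℝ)..t, b (N * τ) *
        T3 K 2 (low K (hat (u τ))) (low K (hat (u τ))) (low K (hat (u τ))) := by
    simp only [T3_low_eq hKR, mul_sub]
    rw [intervalIntegral.integral_sub hi1 hi2]
    ring
  rw [e]
  refine (enorm_add_le _ _).trans (add_le_add ?_
    (enorm_integral_osc_low_le hb hM hN hT hS K hP ht))
  refine (enorm_intervalIntegral_le ht _).trans ?_
  rw [← lintegral_const_mul' _ _ ENNReal.ofReal_ne_top]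
  refine lintegral_mono_ae ?_
  filter_upwards [hb.ae_le hM hN] with τ hτ
  rw [enorm_mul]
  gcongr
  rw [← ofReal_norm]
  exact ENNReal.ofReal_le_ofReal hτ

lemma hsq_zero_hat_le (f : Field3) : hsq 0 (hat f) ≤ 3 * ‖f‖ₑ ^ 2 := by
  have h : ∀ i, ∫⁻ ξ : R3, ‖ξ‖ₑ ^ (2 * 0) * ‖hat f i ξ‖ₑ ^ 2 ≤ ‖f‖ₑ ^ 2 := by
    intro i
    have h1 : ∫⁻ ξ : R3, ‖ξ‖ₑ ^ (2 * 0) * ‖hat f i ξ‖ₑ ^ 2 = ‖hat f i‖ₑ ^ 2 := by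
      rw [enorm_eq_l2, l2_sq]
      simp
    have h2 : ‖hat f i‖ = ‖component f i‖ := by
      rw [hat, hatL_apply]
      exact (Lp.fourierTransformₗᵢ R3 ℂ).norm_map (component f i)
    have h3 : ‖component f i‖ ≤ ‖f‖ := by
      refine Lp.norm_le_norm_of_ae_le ?_
      filter_upwards [coeFn_component f i] with x hx
      rw [hx, Complex.norm_real]
      exact abs_coord_le _ i
    rw [h1]
    gcongr
    rw [← ofReal_norm, ← ofReal_norm, h2]
    exact ENNReal.ofReal_le_ofReal h3
  calc hsq 0 (hat f) ≤ ∑ _i : Fin 3, ‖f‖ₑ ^ 2 := Finset.sum_le_sum fun i _ => h i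
    _ = _ := by simp

lemma homNorm_zero_le_sobNorm (k : ℕ) (f : Field3) : homNorm 0 f ≤ sobNorm k f := by
  unfold homNorm sobNorm
  gcongr with i _ ξ
  rw [mul_zero, pow_zero]
  exact one_le_pow₀ (by nlinarith [sq_nonneg (2 * Real.pi * ‖ξ‖)])

lemma mom_dens_hat_le (k : ℕ) (f : Field3) : mom k (dens (hat f)) ≤ 2 * homNorm k f := by
  apply le_l2_of_sq_le
  calc mom k (dens (hat f)) ^ 2 ≤ 3 * hsq k (hat f) := mom_dens_sq_le k _
    _ ≤ 4 * homNorm k f ^ 2 := by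
        gcongr
        · norm_num
        · exact hsq_le_homNorm_sq k f
    _ = (2 * homNorm k f) ^ 2 := by ring

/-- The basic energy inequality. -/
lemma energy_inequality (hb : IsOscillating M b) (hM : 0 < M) (hN : 0 < N) (hT : 0 < T)
    (hS : IsSolution b N u₀ T u) :
    (∀ᵐ t ∂(volume.restrict (Ioo 0 T)), hsq 0 (hat (u t)) ≤ 3 * ‖u₀‖ₑ ^ 2) ∧
      ∫⁻ t in Ioo 0 T, hsq 1 (hat (u t)) ≤ 3 * ‖u₀‖ₑ ^ 2 := by
  obtain ⟨Cw, hCw⟩ := exists_wiener_interpolation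
  -- Only the finiteness of S and D matters: they multiply 1/n and disappear in the limit.
  set S := 2 * essSup (fun t => sobNorm 2 (u t)) (volume.restrict (Ioo 0 T)) with hSdef
  have hStop : S ≠ ⊤ := ENNReal.mul_ne_top (by norm_num) hS.mem_Linfty_H2.ne
  set D : ℝ≥0∞ := ENNReal.ofReal M *
    (3 * c0 * (2 * (S * S * (Cw * S ^ (1 / 4 : ℝ) * S ^ (3 / 4 : ℝ))))) with hD
  have hDtop : D ≠ ⊤ := by
    have h1 : S ^ (1 / 4 : ℝ) ≠ ⊤ := ENNReal.rpow_ne_top_of_nonneg (by norm_num) hStop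
    have h2 : S ^ (3 / 4 : ℝ) ≠ ⊤ := ENNReal.rpow_ne_top_of_nonneg (by norm_num) hStop
    finiteness
  -- The flux of the field truncated at n is zero, so the form equals its high-frequency part, which
  -- is O(1/n) because u is bounded in H².
  have key : ∀ n : ℕ, 0 < n → ∀ᵐ t ∂(volume.restrict (Ioo 0 T)),
      ‖b (N * t) * T3 n 0 (hat (u t)) (hat (u t)) (hat (u t))‖ₑ ≤ D * (n : ℝ≥0∞)⁻¹ := by
    intro n hn
    filter_upwards [hS.fdivFree, hb.ae_le hM hN,
      ae_le_essSup (f := fun t => sobNorm 2 (u t)) (μ := volume.restrict (Ioo 0 T))]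
      with t hd hbt hs
    have m0 : mom 0 (dens (hat (u t))) ≤ S := (mom_dens_hat_le 0 _).trans (by
      rw [hSdef]; gcongr; exact (homNorm_zero_le_sobNorm 2 _).trans hs)
    have m2 : mom 2 (dens (hat (u t))) ≤ S := (mom_dens_hat_le 2 _).trans (by
      rw [hSdef]; gcongr; exact (homNorm_le_sobNorm 2 _).trans hs)
    have hm := measurable_dens (hat (u t))
    have m1 := mom_succ_sq_le 0 hm
    have w := hCw _ hm (ne_top_of_le_ne_top hStop m0) (ne_top_of_le_ne_top hStop m2)
    have h := enorm_T3_zero_sub_low_le n n (hat (u t))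
    rw [T3_zero_low_eq_zero n hd (hat_fherm _), sub_zero, ENNReal.ofReal_natCast] at h
    rw [← div_eq_mul_inv, ENNReal.le_div_iff_mul_le (Or.inl (by exact_mod_cast hn.ne'))
      (Or.inl (by finiteness)), enorm_mul, mul_assoc, mul_comm _ (n : ℝ≥0∞), hD]
    refine mul_le_mul' ?_ (h.trans ?_)
    · rw [← ofReal_norm]
      exact ENNReal.ofReal_le_ofReal hbt
    · gcongr
      · exact m1.trans (by gcongr)
      · exact w.trans (by gcongr)
  have hlim : Tendsto (fun n : ℕ => D * (n : ℝ≥0∞)⁻¹ * ENNReal.ofReal T) atTop (𝓝 0) := by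
    have h1 := ENNReal.Tendsto.const_mul ENNReal.tendsto_inv_nat_nhds_zero
      (Or.inr hDtop)
    have h2 := ENNReal.Tendsto.mul_const h1 (Or.inr (ENNReal.ofReal_ne_top (r := T)))
    simpa using h2
  have h := hsq_bounds hb hM hN hT hS 0 hlim (by
    filter_upwards [eventually_gt_atTop 0] with n hn t ht
    refine (enorm_intervalIntegral_le ht _).trans ((lintegral_mono_ae (key n hn)).trans ?_)
    rw [setLIntegral_const, Real.volume_Ioo, sub_zero])
  rw [mul_zero, add_zero] at h
  exact ⟨h.1.mono fun t ht => ht.trans (hsq_zero_hat_le u₀), h.2.trans (hsq_zero_hat_le u₀)⟩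

end

end OscNS

end

/-! ### The a priori estimate with a frequency cutoff. -/

noncomputable section

namespace OscNS

open scoped SchwartzMap LineDeriv ComplexConjugate
open Filter Topology

lemma sq_rpow_half (z : ℝ≥0∞) : (z ^ 2) ^ (1 / 2 : ℝ) = z := by
  rw [← ENNReal.rpow_natCast, ← ENNReal.rpow_mul]
  norm_num

lemma rpow_half_sq (z : ℝ≥0∞) : (z ^ (1 / 2 : ℝ)) ^ 2 = z := by
  rw [← ENNReal.rpow_natCast, ← ENNReal.rpow_mul]
  norm_num

lemma lintegral_sqrt_mul_sqrt_le {μ : Measure ℝ} {f g : ℝ → ℝ≥0∞} (hf : AEMeasurable f μ)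
    (hg : AEMeasurable g μ) : ∫⁻ t, f t ^ (1 / 2 : ℝ) * g t ^ (1 / 2 : ℝ) ∂μ ≤
      (∫⁻ t, f t ∂μ) ^ (1 / 2 : ℝ) * (∫⁻ t, g t ∂μ) ^ (1 / 2 : ℝ) := by
  have h := ENNReal.lintegral_mul_le_Lp_mul_Lq μ Real.HolderConjugate.two_two
    (hf.pow_const (1 / 2 : ℝ)) (hg.pow_const (1 / 2 : ℝ))
  have hs : ∀ z : ℝ≥0∞, (z ^ (1 / 2 : ℝ)) ^ (2 : ℝ) = z := fun z => by
    rw [← ENNReal.rpow_mul]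
    norm_num
  simp only [hs] at h
  exact h

lemma mom_dens_le_sqrt (k : ℕ) (x : Fin 3 → L2C) :
    mom k (dens x) ≤ 2 * hsq k x ^ (1 / 2 : ℝ) := by
  apply le_l2_of_sq_le
  rw [mul_pow, rpow_half_sq]
  refine (mom_dens_sq_le k x).trans ?_
  gcongr
  norm_num

lemma hsq_two_le (x : Fin 3 → L2C) :
    hsq 2 x ≤ 4 * (hsq 1 x ^ (1 / 2 : ℝ) * hsq 3 x ^ (1 / 2 : ℝ)) :=
  calc hsq 2 x ≤ mom 2 (dens x) ^ 2 := hsq_le_mom_dens_sq 2 x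
    _ ≤ mom 1 (dens x) * mom 3 (dens x) := mom_succ_sq_le 1 (measurable_dens x)
    _ ≤ (2 * hsq 1 x ^ (1 / 2 : ℝ)) * (2 * hsq 3 x ^ (1 / 2 : ℝ)) :=
        mul_le_mul' (mom_dens_le_sqrt 1 x) (mom_dens_le_sqrt 3 x)
    _ = _ := by ring

section

variable {b : ℝ → ℝ} {M N T : ℝ} {u₀ : Field3} {u : ℝ → Field3}

lemma hsq_two_le_XT (T : ℝ) (u : ℝ → Field3) :
    ∀ᵐ t ∂(volume.restrict (Ioo 0 T)), hsq 2 (hat (u t)) ≤ XT T u := by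
  filter_upwards [ae_le_essSup (f := fun t => homNorm 2 (u t)) (μ := volume.restrict (Ioo 0 T))]
    with t ht
  calc hsq 2 (hat (u t)) ≤ homNorm 2 (u t) ^ 2 := hsq_le_homNorm_sq 2 _
    _ ≤ essSup (fun t => homNorm 2 (u t)) (volume.restrict (Ioo 0 T)) ^ 2 := by gcongr
    _ ≤ XT T u := le_self_add

lemma lintegral_hsq_three_le_XT (T : ℝ) (u : ℝ → Field3) :
    ∫⁻ t in Ioo 0 T, hsq 3 (hat (u t)) ≤ XT T u :=
  (lintegral_mono fun t => hsq_le_homNorm_sq 3 (u t)).trans le_add_self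

lemma XT_lt_top (hS : IsSolution b N u₀ T u) : XT T u < ⊤ := by
  refine ENNReal.add_lt_top.mpr ⟨ENNReal.pow_lt_top ?_, ?_⟩
  · exact lt_of_le_of_lt (essSup_mono_ae (Eventually.of_forall fun t => homNorm_le_sobNorm 2 (u t)))
      hS.mem_Linfty_H2
  · refine lt_of_le_of_lt (lintegral_mono fun t => ?_) hS.mem_L2_H3
    have := homNorm_le_sobNorm 3 (u t)
    gcongr

/-- Restores the powers of 2π omitted in `hsq`: orders two and three carry (2π)⁴ and (2π)⁶, both at
most (2π)⁶, and the factor 2 counts the two parts of X_T. -/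
lemma XT_le_of_hsq_le {B : ℝ≥0∞}
    (h1 : ∀ᵐ t ∂(volume.restrict (Ioo 0 T)), hsq 2 (hat (u t)) ≤ B)
    (h2 : ∫⁻ t in Ioo 0 T, hsq 3 (hat (u t)) ≤ B) :
    XT T u ≤ 2 * ENNReal.ofReal ((2 * Real.pi) ^ 6) * B := by
  have hpi : 1 ≤ 2 * Real.pi := by linarith [Real.pi_gt_three]
  have e1 : essSup (fun t => homNorm 2 (u t)) (volume.restrict (Ioo 0 T)) ≤
      (ENNReal.ofReal ((2 * Real.pi) ^ 6) * B) ^ (1 / 2 : ℝ) := by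
    refine essSup_le_of_ae_le _ ?_
    filter_upwards [h1] with t ht
    apply le_l2_of_sq_le
    rw [rpow_half_sq, homNorm_sq]
    gcongr
    norm_num
  have e2 : ∫⁻ t in Ioo 0 T, homNorm 3 (u t) ^ 2 ≤ ENNReal.ofReal ((2 * Real.pi) ^ 6) * B := by
    simp only [homNorm_sq]
    rw [lintegral_const_mul' _ _ ENNReal.ofReal_ne_top]
    gcongr
  calc XT T u ≤ ((ENNReal.ofReal ((2 * Real.pi) ^ 6) * B) ^ (1 / 2 : ℝ)) ^ 2 +
        ENNReal.ofReal ((2 * Real.pi) ^ 6) * B := by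
        unfold XT
        gcongr
    _ = _ := by rw [rpow_half_sq]; ring

lemma pow_four_rpow_quarter (z : ℝ≥0∞) : (z ^ 4) ^ (1 / 4 : ℝ) = z := by
  rw [← ENNReal.rpow_natCast, ← ENNReal.rpow_mul]
  norm_num

lemma pow_four_rpow_three_quarter (z : ℝ≥0∞) : (z ^ 4) ^ (3 / 4 : ℝ) = z ^ 3 := by
  rw [← ENNReal.rpow_natCast, ← ENNReal.rpow_natCast, ← ENNReal.rpow_mul]
  norm_num

/-- The a priori estimate with a free frequency cut-off `K`. -/
theorem exists_XT_le_cutoff (M : ℝ) (hM : 0 < M) :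
    ∃ C : ℝ≥0, ∀ (b : ℝ → ℝ) (N T : ℝ) (u₀ : Field3) (u : ℝ → Field3) (p y : ℝ≥0) (K : ℝ),
      IsOscillating M b → 0 < N → 0 < T → IsSolution b N u₀ T u →
      ‖u₀‖ₑ = (p : ℝ≥0∞) ^ 4 → XT T u = (y : ℝ≥0∞) ^ 8 → 0 < K →
      XT T u ≤ C * (homNorm 2 u₀ ^ 2 + ((ENNReal.ofReal K)⁻¹ * (p * y ^ 11) +
        ENNReal.ofReal N⁻¹ * (ENNReal.ofReal K ^ 2 * (p ^ 3 * y ^ 9 + p ^ 6 * y ^ 10)))) := by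
  obtain ⟨Cw, hCw⟩ := exists_wiener_interpolation
  set μ : ℝ≥0 := M.toNNReal with hμ
  -- The sum of all coefficients below, after inserting w: 72·24, 12·24, 144·24 and 864·24².
  set CA : ℝ≥0 := μ * (1728 * c0 * Cw + 288 * c0 * Cw + 3456 * c0 * cLin * Cw +
    497664 * c0 * cNon * μ * Cw ^ 2) with hCA
  refine ⟨2 * ((2 * Real.pi) ^ 6).toNNReal * (1 + 2 * CA), ?_⟩
  intro b N T u₀ u p y K hb hN hT hS hp hy hK
  obtain ⟨hE0, hE1⟩ := energy_inequality hb hM hN hT hS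
  have hE2 := hsq_two_le_XT T u
  have hE3 := lintegral_hsq_three_le_XT T u
  rw [hp] at hE0 hE1
  rw [hy] at hE2 hE3
  set κ := ENNReal.ofReal K with hκ
  have hκ0 : κ ≠ 0 := by simpa [hκ] using hK
  have hκt : κ ≠ ⊤ := ENNReal.ofReal_ne_top
  -- The interpolation bound for the L¹ norm of the amplitude, with 24 = 3·2³. Fourth and eighth
  -- roots were taken as p and y so that all exponents become integers.
  set w : ℝ≥0∞ := 24 * Cw * (p * y ^ 3) with hw
  have hwt : w ≠ ⊤ := by rw [hw]; finiteness
  have hfix : ∀ᵐ t ∂(volume.restrict (Ioo 0 T)),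
      mom 2 (dens (hat (u t))) ≤ 2 * y ^ 4 ∧ mom 1 (dens (hat (u t))) ≤ 3 * (p ^ 2 * y ^ 2) ∧
        ∫⁻ ξ, dens (hat (u t)) ξ ≤ w := by
    filter_upwards [hE0, hE2] with t h0 h2
    have hm := measurable_dens (hat (u t))
    have m0 : mom 0 (dens (hat (u t))) ≤ 3 * p ^ 4 := by
      apply le_l2_of_sq_le
      calc _ ≤ 3 * hsq 0 (hat (u t)) := mom_dens_sq_le 0 _
        _ ≤ 3 * (3 * ((p : ℝ≥0∞) ^ 4) ^ 2) := by gcongr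
        _ = _ := by ring
    have m2 : mom 2 (dens (hat (u t))) ≤ 2 * y ^ 4 := by
      apply le_l2_of_sq_le
      calc _ ≤ 3 * hsq 2 (hat (u t)) := mom_dens_sq_le 2 _
        _ ≤ 4 * (y : ℝ≥0∞) ^ 8 := by gcongr; norm_num
        _ = _ := by ring
    refine ⟨m2, ?_, ?_⟩
    · apply le_l2_of_sq_le
      calc _ ≤ mom 0 (dens (hat (u t))) * mom 2 (dens (hat (u t))) := mom_succ_sq_le 0 hm
        _ ≤ (3 * p ^ 4) * (2 * y ^ 4) := mul_le_mul' m0 m2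
        _ = 6 * (p ^ 4 * y ^ 4) := by ring
        _ ≤ 9 * (p ^ 4 * y ^ 4) := by gcongr; norm_num
        _ = _ := by ring
    · have n0 : mom 0 (dens (hat (u t))) ≤ (3 * p) ^ 4 := m0.trans (by
        rw [mul_pow]
        gcongr
        norm_num)
      have n2 : mom 2 (dens (hat (u t))) ≤ (2 * y) ^ 4 := m2.trans (by
        rw [mul_pow]
        gcongr
        norm_num)
      have h := hCw _ hm (ne_top_of_le_ne_top (by finiteness) m0)
        (ne_top_of_le_ne_top (by finiteness) m2)
      calc _ ≤ _ := h
        _ ≤ Cw * ((3 * p) ^ 4) ^ (1 / 4 : ℝ) * ((2 * y) ^ 4) ^ (3 / 4 : ℝ) := by gcongr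
        _ = w := by
          rw [pow_four_rpow_quarter, pow_four_rpow_three_quarter, hw]
          ring
  -- Interpolation of Ḣ² between Ḣ¹ and Ḣ³ and Cauchy–Schwarz in time, the Ḣ¹ part coming from the
  -- basic energy inequality. No power of T enters.
  have hD2 : ∫⁻ t in Ioo 0 T, hsq 2 (hat (u t)) ≤ 8 * (p ^ 4 * y ^ 4) := by
    calc ∫⁻ t in Ioo 0 T, hsq 2 (hat (u t))
        ≤ ∫⁻ t in Ioo 0 T, 4 * (hsq 1 (hat (u t)) ^ (1 / 2 : ℝ) *
          hsq 3 (hat (u t)) ^ (1 / 2 : ℝ)) := lintegral_mono fun t => hsq_two_le _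
      _ = 4 * ∫⁻ t in Ioo 0 T, hsq 1 (hat (u t)) ^ (1 / 2 : ℝ) *
          hsq 3 (hat (u t)) ^ (1 / 2 : ℝ) := lintegral_const_mul' _ _ (by norm_num)
      _ ≤ 4 * ((∫⁻ t in Ioo 0 T, hsq 1 (hat (u t))) ^ (1 / 2 : ℝ) *
          (∫⁻ t in Ioo 0 T, hsq 3 (hat (u t))) ^ (1 / 2 : ℝ)) := by
          gcongr
          exact lintegral_sqrt_mul_sqrt_le (aemeasurable_hsq hS 1) (aemeasurable_hsq hS 3)
      _ ≤ 4 * (((2 * p ^ 4) ^ 2) ^ (1 / 2 : ℝ) * ((y ^ 4) ^ 2) ^ (1 / 2 : ℝ)) := by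
          gcongr
          · refine hE1.trans ?_
            rw [mul_pow]
            gcongr
            norm_num
          · exact hE3.trans (le_of_eq (by ring))
      _ = _ := by
          rw [sq_rpow_half, sq_rpow_half]
          ring
  have hD32 : ∫⁻ t in Ioo 0 T, hsq 3 (hat (u t)) ^ (1 / 2 : ℝ) * hsq 2 (hat (u t)) ^ (1 / 2 : ℝ) ≤
      3 * (p ^ 2 * y ^ 6) := by
    calc _ ≤ (∫⁻ t in Ioo 0 T, hsq 3 (hat (u t))) ^ (1 / 2 : ℝ) *
          (∫⁻ t in Ioo 0 T, hsq 2 (hat (u t))) ^ (1 / 2 : ℝ) :=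
          lintegral_sqrt_mul_sqrt_le (aemeasurable_hsq hS 3) (aemeasurable_hsq hS 2)
      _ ≤ ((y ^ 4) ^ 2) ^ (1 / 2 : ℝ) * ((3 * (p ^ 2 * y ^ 2)) ^ 2) ^ (1 / 2 : ℝ) := by
          gcongr
          · exact hE3.trans (le_of_eq (by ring))
          · calc _ ≤ 8 * ((p : ℝ≥0∞) ^ 4 * y ^ 4) := hD2
              _ ≤ 9 * (p ^ 4 * y ^ 4) := by gcongr; norm_num
              _ = _ := by ring
      _ = _ := by
          rw [sq_rpow_half, sq_rpow_half]
          ring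
  have hI1 : ∀ R : ℝ, ∫⁻ t in Ioo 0 T, ‖T3 R 2 (hat (u t)) (hat (u t)) (hat (u t)) -
      T3 R 2 (low K (hat (u t))) (low K (hat (u t))) (low K (hat (u t)))‖ₑ ≤
      κ⁻¹ * (72 * c0 * w * y ^ 8) := by
    intro R
    calc _ ≤ ∫⁻ t in Ioo 0 T, κ⁻¹ * (72 * c0 * w) * hsq 3 (hat (u t)) := by
          refine lintegral_mono_ae ?_
          filter_upwards [hfix] with t ht
          rw [mul_assoc, ← ENNReal.div_eq_inv_mul, ENNReal.le_div_iff_mul_le (Or.inl hκ0)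
            (Or.inl hκt), mul_comm]
          calc _ ≤ _ := enorm_T3_two_sub_low_le K R (hat (u t))
            _ ≤ 3 * c0 * (8 * (3 * hsq 3 (hat (u t)) * w)) := by
                gcongr
                · exact mom_dens_sq_le 3 _
                · exact ht.2.2
            _ = _ := by ring
      _ = κ⁻¹ * (72 * c0 * w) * ∫⁻ t in Ioo 0 T, hsq 3 (hat (u t)) :=
          lintegral_const_mul' _ _ (by finiteness)
      _ ≤ κ⁻¹ * (72 * c0 * w) * y ^ 8 := by gcongr
      _ = _ := by ring
  have hP : ∀ᵐ t ∂(volume.restrict (Ioo 0 T)),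
      ‖T3 K 2 (low K (hat (u t))) (low K (hat (u t))) (low K (hat (u t)))‖ₑ ≤
        κ ^ 2 * (12 * c0 * w * (p ^ 2 * y ^ 6)) := by
    filter_upwards [hfix] with t ht
    calc _ ≤ _ := enorm_T3_low_le K (hat (u t))
      _ ≤ c0 * (2 * κ ^ 2 * ((2 * y ^ 4) * (3 * (p ^ 2 * y ^ 2)) * w)) := by
          gcongr
          · exact ht.1
          · exact ht.2.1
          · exact ht.2.2
      _ = _ := by ring
  have hdT : ∫⁻ t in Ioo 0 T, ‖dT3 K (b (N * t)) (hat (u t))‖ₑ ≤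
      κ ^ 2 * (144 * c0 * cLin * w * (p ^ 2 * y ^ 6) +
        864 * c0 * cNon * μ * w ^ 2 * (p ^ 4 * y ^ 4)) := by
    have hmeas : AEMeasurable (fun t => (108 * c0 * cNon * μ * w ^ 2) * hsq 2 (hat (u t)))
        (volume.restrict (Ioo 0 T)) := (aemeasurable_hsq hS 2).const_mul _
    calc _ ≤ ∫⁻ t in Ioo 0 T, κ ^ 2 * ((48 * c0 * cLin * w) *
          (hsq 3 (hat (u t)) ^ (1 / 2 : ℝ) * hsq 2 (hat (u t)) ^ (1 / 2 : ℝ)) +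
          (108 * c0 * cNon * μ * w ^ 2) * hsq 2 (hat (u t))) := by
          refine lintegral_mono_ae ?_
          filter_upwards [hfix, hb.ae_le hM hN] with t ht hbt
          calc _ ≤ _ := enorm_dT3_le (K := K) hbt (hat (u t))
            _ ≤ κ ^ 2 * (12 * c0 * cLin * ((2 * hsq 3 (hat (u t)) ^ (1 / 2 : ℝ)) *
                (2 * hsq 2 (hat (u t)) ^ (1 / 2 : ℝ)) * w) +
                36 * c0 * cNon * μ * ((3 * hsq 2 (hat (u t))) * w ^ 2)) := by
                gcongr
                · exact mom_dens_le_sqrt 3 _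
                · exact mom_dens_le_sqrt 2 _
                · exact ht.2.2
                · exact le_rfl
                · exact mom_dens_sq_le 2 _
                · exact ht.2.2
            _ = _ := by ring
      _ = κ ^ 2 * ((48 * c0 * cLin * w) * (∫⁻ t in Ioo 0 T,
          hsq 3 (hat (u t)) ^ (1 / 2 : ℝ) * hsq 2 (hat (u t)) ^ (1 / 2 : ℝ)) +
          (108 * c0 * cNon * μ * w ^ 2) * ∫⁻ t in Ioo 0 T, hsq 2 (hat (u t))) := by
          rw [lintegral_const_mul' _ _ (by finiteness), lintegral_add_right' _ hmeas,
            lintegral_const_mul' _ _ (by finiteness), lintegral_const_mul' _ _ (by finiteness)]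
      _ ≤ κ ^ 2 * ((48 * c0 * cLin * w) * (3 * (p ^ 2 * y ^ 6)) +
          (108 * c0 * cNon * μ * w ^ 2) * (8 * (p ^ 4 * y ^ 4))) := by gcongr
      _ = _ := by ring
  set A : ℝ≥0∞ := CA * (κ⁻¹ * (p * y ^ 11) +
    ENNReal.ofReal N⁻¹ * (κ ^ 2 * (p ^ 3 * y ^ 9 + p ^ 6 * y ^ 10))) with hA
  have hMN : ENNReal.ofReal (M / N) = μ * ENNReal.ofReal N⁻¹ := by
    rw [div_eq_mul_inv, ENNReal.ofReal_mul hM.le]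
    rfl
  -- Once the truncation radius n exceeds K the bound no longer depends on n, so the limit is taken
  -- with a constant sequence.
  have hQ : ∀ᶠ n : ℕ in atTop, ∀ t ∈ Icc 0 T,
      ‖∫ τ in (0 : ℝ)..t, b (N * τ) * T3 n 2 (hat (u τ)) (hat (u τ)) (hat (u τ))‖ₑ ≤ A := by
    obtain ⟨n₀, hn₀⟩ := exists_nat_ge K
    filter_upwards [eventually_ge_atTop n₀] with n hn t ht
    have hKn : K ≤ n := hn₀.trans (by exact_mod_cast hn)
    refine (enorm_integral_osc_le hb hM hN hT hS K n hKn hP ht).trans ?_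
    calc _ ≤ (μ : ℝ≥0∞) * (κ⁻¹ * (72 * c0 * w * y ^ 8)) + μ * ENNReal.ofReal N⁻¹ *
          (κ ^ 2 * (12 * c0 * w * (p ^ 2 * y ^ 6)) +
            κ ^ 2 * (144 * c0 * cLin * w * (p ^ 2 * y ^ 6) +
              864 * c0 * cNon * μ * w ^ 2 * (p ^ 4 * y ^ 4))) := by
          rw [hMN]
          gcongr
          · exact le_rfl
          · exact hI1 n
      _ = (μ * (1728 * c0 * Cw)) * (κ⁻¹ * (p * y ^ 11)) + ENNReal.ofReal N⁻¹ * (κ ^ 2 *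
          ((μ * (288 * c0 * Cw + 3456 * c0 * cLin * Cw)) * (p ^ 3 * y ^ 9) +
            (μ * (497664 * c0 * cNon * μ * Cw ^ 2)) * (p ^ 6 * y ^ 10))) := by
          rw [hw]
          ring
      _ ≤ CA * (κ⁻¹ * (p * y ^ 11)) + ENNReal.ofReal N⁻¹ * (κ ^ 2 *
          (CA * (p ^ 3 * y ^ 9) + CA * (p ^ 6 * y ^ 10))) := by
          have g1 : (μ : ℝ≥0∞) * (1728 * c0 * Cw) ≤ CA := by
            rw [hCA]
            push_cast
            gcongr
            rw [add_assoc, add_assoc]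
            exact le_self_add
          have g2 : (μ : ℝ≥0∞) * (288 * c0 * Cw + 3456 * c0 * cLin * Cw) ≤ CA := by
            rw [hCA]
            push_cast
            refine mul_le_mul' le_rfl (le_trans ?_ le_self_add)
            rw [add_assoc]
            exact le_add_self
          have g3 : (μ : ℝ≥0∞) * (497664 * c0 * cNon * μ * Cw ^ 2) ≤ CA := by
            rw [hCA]
            push_cast
            gcongr
            exact le_add_self
          gcongr
      _ = A := by
          rw [hA]
          ring
  obtain ⟨h1, h2⟩ := hsq_bounds hb hM hN hT hS 2 tendsto_const_nhds hQ
  refine (XT_le_of_hsq_le h1 h2).trans ?_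
  have h3 := hsq_le_homNorm_sq 2 u₀
  calc 2 * ENNReal.ofReal ((2 * Real.pi) ^ 6) * (hsq 2 (hat u₀) + 2 * A)
      ≤ 2 * ENNReal.ofReal ((2 * Real.pi) ^ 6) * ((1 + 2 * CA) * homNorm 2 u₀ ^ 2 + (1 + 2 * CA) *
        (κ⁻¹ * (p * y ^ 11) +
          ENNReal.ofReal N⁻¹ * (κ ^ 2 * (p ^ 3 * y ^ 9 + p ^ 6 * y ^ 10)))) := by
        refine mul_le_mul' le_rfl (add_le_add ?_ ?_)
        · exact h3.trans (le_mul_of_one_le_left zero_le le_self_add)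
        · rw [hA, ← mul_assoc]
          exact mul_le_mul' le_add_self le_rfl
    _ = _ := by
        push_cast
        change _ = 2 * ENNReal.ofReal ((2 * Real.pi) ^ 6) * _ * _
        ring

end

end OscNS

end

/-! ### Choice of the cutoff and conclusion. -/

noncomputable section

namespace OscNS

/-- Optimization of the frequency cut-off. -/
lemma exists_cutoff {e₁ e₂ : ℝ≥0} {N : ℝ} (hN : 0 < N) (h₁ : e₁ ≠ 0) (h₂ : e₂ ≠ 0) :
    ∃ K : ℝ, 0 < K ∧ (ENNReal.ofReal K)⁻¹ * (e₁ : ℝ≥0∞) +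
      ENNReal.ofReal N⁻¹ * (ENNReal.ofReal K ^ 2 * e₂) =
      2 * (ENNReal.ofReal (N ^ (-(1 / 3) : ℝ)) * (e₂ : ℝ≥0∞) ^ (1 / 3 : ℝ) *
        (e₁ : ℝ≥0∞) ^ (2 / 3 : ℝ)) := by
  have cube : ∀ z : ℝ≥0, (z ^ (1 / 3 : ℝ)) ^ 3 = z := fun z => by
    rw [← NNReal.rpow_natCast, ← NNReal.rpow_mul]
    norm_num
  obtain ⟨n, rfl⟩ : ∃ n : ℝ≥0, N = (n : ℝ) ^ 3 :=
    ⟨N.toNNReal ^ (1 / 3 : ℝ), by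
      rw [← NNReal.coe_pow, cube, Real.coe_toNNReal _ hN.le]⟩
  have hn : n ≠ 0 := by
    rintro rfl
    simp at hN
  obtain ⟨f, rfl⟩ : ∃ f : ℝ≥0, e₁ = f ^ 3 := ⟨e₁ ^ (1 / 3 : ℝ), (cube e₁).symm⟩
  obtain ⟨g, rfl⟩ : ∃ g : ℝ≥0, e₂ = g ^ 3 := ⟨e₂ ^ (1 / 3 : ℝ), (cube e₂).symm⟩
  have hf : f ≠ 0 := fun h => h₁ (by simp [h])
  have hg : g ≠ 0 := fun h => h₂ (by simp [h])
  have hK0 : n * f * g⁻¹ ≠ 0 := by positivity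
  -- K = (N e₁/e₂)^{1/3} makes the two terms equal, hence the factor 2. Cube roots are named
  -- beforehand so that the identity is polynomial.
  refine ⟨((n * f * g⁻¹ : ℝ≥0) : ℝ), by positivity, ?_⟩
  have e1 : ((n : ℝ) ^ 3) ^ (-(1 / 3) : ℝ) = ((n⁻¹ : ℝ≥0) : ℝ) := by
    rw [← Real.rpow_natCast, ← Real.rpow_mul n.coe_nonneg]
    norm_num
    rw [Real.rpow_neg_one]
  have e2 : (((g ^ 3 : ℝ≥0) : ℝ≥0∞)) ^ (1 / 3 : ℝ) = g := by
    rw [ENNReal.coe_pow, ← ENNReal.rpow_natCast, ← ENNReal.rpow_mul]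
    norm_num
  have e3 : (((f ^ 3 : ℝ≥0) : ℝ≥0∞)) ^ (2 / 3 : ℝ) = ((f ^ 2 : ℝ≥0) : ℝ≥0∞) := by
    rw [ENNReal.coe_pow, ENNReal.coe_pow, ← ENNReal.rpow_natCast, ← ENNReal.rpow_natCast,
      ← ENNReal.rpow_mul]
    norm_num
  have e4 : ((n : ℝ) ^ 3)⁻¹ = (((n ^ 3)⁻¹ : ℝ≥0) : ℝ) := by push_cast; rfl
  rw [e1, e2, e3, e4, ENNReal.ofReal_coe_nnreal, ENNReal.ofReal_coe_nnreal,
    ENNReal.ofReal_coe_nnreal, ← ENNReal.coe_inv hK0]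
  norm_cast
  field_simp
  ring

end OscNS

theorem proposition3p1 (M : ℝ) (hM : 0 < M) :
    ∃ C : ℝ≥0, ∀ (b : ℝ → ℝ) (N T : ℝ) (u₀ : OscNS.Field3) (u : ℝ → OscNS.Field3),
      OscNS.IsOscillating M b → 0 < N → 0 < T → OscNS.IsSolution b N u₀ T u →
      OscNS.XT T u ≤ C * (OscNS.homNorm 2 u₀ ^ 2 +
        ENNReal.ofReal (N ^ (-(1 / 3) : ℝ)) *
          (‖u₀‖ₑ ^ (3 / 4 : ℝ) * OscNS.XT T u ^ (9 / 8 : ℝ) +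
            ‖u₀‖ₑ ^ (3 / 2 : ℝ) * OscNS.XT T u ^ (5 / 4 : ℝ) +
            OscNS.sobNorm 2 u₀ ^ 3) ^ (1 / 3 : ℝ) *
          ‖u₀‖ₑ ^ (1 / 6 : ℝ) * OscNS.XT T u ^ (11 / 12 : ℝ)) := by
  obtain ⟨C, hC⟩ := OscNS.exists_XT_le_cutoff M hM
  refine ⟨2 * C, fun b N T u₀ u hb hN hT hS => ?_⟩
  obtain ⟨p, hp⟩ : ∃ p : ℝ≥0, ‖u₀‖ₑ = (p : ℝ≥0∞) ^ 4 := by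
    refine ⟨‖u₀‖₊ ^ (1 / 4 : ℝ), ?_⟩
    rw [← ENNReal.coe_pow, ← NNReal.rpow_natCast, ← NNReal.rpow_mul]
    norm_num
    rfl
  obtain ⟨y, hy⟩ : ∃ y : ℝ≥0, OscNS.XT T u = (y : ℝ≥0∞) ^ 8 := by
    refine ⟨(OscNS.XT T u).toNNReal ^ (1 / 8 : ℝ), ?_⟩
    rw [← ENNReal.coe_pow, ← NNReal.rpow_natCast, ← NNReal.rpow_mul]
    norm_num
    rw [ENNReal.coe_toNNReal (OscNS.XT_lt_top hS).ne]
  have hbase := fun K hK => hC b N T u₀ u p y K hb hN hT hS hp hy hK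
  -- Here there is no positive balancing cutoff, but p or y is zero, both error terms vanish, and K
  -- = 1 serves.
  by_cases h0 : p * y ^ 11 = 0
  · have h1 : p ^ 3 * y ^ 9 + p ^ 6 * y ^ 10 = 0 := by
      rcases mul_eq_zero.mp h0 with h | h
      · simp [h]
      · simp [pow_eq_zero_iff (by norm_num : (11 : ℕ) ≠ 0) |>.mp h]
    have h0' : (p : ℝ≥0∞) * y ^ 11 = 0 := by exact_mod_cast h0
    have h1' : (p : ℝ≥0∞) ^ 3 * y ^ 9 + p ^ 6 * y ^ 10 = 0 := by exact_mod_cast h1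
    have h := hbase 1 one_pos
    rw [h0', h1'] at h
    simp only [mul_zero, add_zero] at h
    refine h.trans (mul_le_mul' ?_ le_self_add)
    push_cast
    exact le_mul_of_one_le_left zero_le (by norm_num)
  · have h2 : p ^ 3 * y ^ 9 + p ^ 6 * y ^ 10 ≠ 0 := by
      have hp0 : p ≠ 0 := left_ne_zero_of_mul h0
      have hy0 : y ≠ 0 := fun h => h0 (by simp [h])
      positivity
    obtain ⟨K, hK, hKe⟩ := OscNS.exists_cutoff hN h0 h2
    have h := hbase K hK
    push_cast at hKe
    rw [hKe] at h
    refine h.trans ?_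
    have e1 : ‖u₀‖ₑ ^ (3 / 4 : ℝ) = (p : ℝ≥0∞) ^ 3 := by
      rw [hp, ← ENNReal.rpow_natCast, ← ENNReal.rpow_natCast, ← ENNReal.rpow_mul]
      norm_num
    have e2 : ‖u₀‖ₑ ^ (3 / 2 : ℝ) = (p : ℝ≥0∞) ^ 6 := by
      rw [hp, ← ENNReal.rpow_natCast, ← ENNReal.rpow_natCast, ← ENNReal.rpow_mul]
      norm_num
    have e3 : OscNS.XT T u ^ (9 / 8 : ℝ) = (y : ℝ≥0∞) ^ 9 := by
      rw [hy, ← ENNReal.rpow_natCast, ← ENNReal.rpow_natCast, ← ENNReal.rpow_mul]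
      norm_num
    have e4 : OscNS.XT T u ^ (5 / 4 : ℝ) = (y : ℝ≥0∞) ^ 10 := by
      rw [hy, ← ENNReal.rpow_natCast, ← ENNReal.rpow_natCast, ← ENNReal.rpow_mul]
      norm_num
    have e5 : ((p : ℝ≥0∞) * y ^ 11) ^ (2 / 3 : ℝ) =
        ‖u₀‖ₑ ^ (1 / 6 : ℝ) * OscNS.XT T u ^ (11 / 12 : ℝ) := by
      rw [hp, hy, ENNReal.mul_rpow_of_nonneg _ _ (by norm_num), ← ENNReal.rpow_natCast,
        ← ENNReal.rpow_natCast, ← ENNReal.rpow_natCast, ← ENNReal.rpow_mul, ← ENNReal.rpow_mul,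
        ← ENNReal.rpow_mul]
      norm_num
    rw [e1, e2, e3, e4, e5]
    set X := ‖u₀‖ₑ ^ (1 / 6 : ℝ) * OscNS.XT T u ^ (11 / 12 : ℝ)
    set g := (p : ℝ≥0∞) ^ 3 * y ^ 9 + p ^ 6 * y ^ 10
    set n := ENNReal.ofReal (N ^ (-(1 / 3) : ℝ))
    calc (C : ℝ≥0∞) * (OscNS.homNorm 2 u₀ ^ 2 + 2 * (n * g ^ (1 / 3 : ℝ) * X))
        ≤ C * (2 * OscNS.homNorm 2 u₀ ^ 2 +
            2 * (n * (g + OscNS.sobNorm 2 u₀ ^ 3) ^ (1 / 3 : ℝ) * X)) := by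
          gcongr
          · exact le_mul_of_one_le_left zero_le (by norm_num)
          -- The H² norm of the datum enters only by enlarging the bracket.
          · exact le_self_add
      _ = _ := by
          push_cast
          simp only [X]
          ring

end
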